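/- **Setting.** A hypergraph has nodes $1,\dots,m$ ($m\ge 1$), a finite set of labelled edges $e$, each attached to a nonempty string $\mathrm{att}(e)$ of pairwise distinct nodes whose length is the rank of its label, and a string of pairwise distinct external nodes; the other nodes are internal. A straight-line hyperedge replacement (SL-HR) grammar $G=(N,P,S)$ over a terminal alphabet $\{1,\dots,\sigma\}$ has a finite ranked set $N\subset\mathbb N$ of nonterminals disjoint from it, a start graph $S$, and for every $A\in N$ exactly one rule $A\to\mathrm{rhs}(A)$, where $\mathrm{rhs}(A)$ has $\mathrm{rank}(A)$ external nodes; the relation "$B$ labels an edge of $\mathrm{rhs}(A)$" on $N$ is acyclic, and every nonterminal is reachable from $S$. The size $|G|$ is the sum, over $S$ and all $\mathrm{rhs}(A)$, of the number of nodes plus the number of edges of rank at most $2$ plus the sum of the ranks of the other edges. The graph $\mathrm{val}(G)$ is obtained from $S$ by replacing all nonterminal edges in depth-first pre-order, where sibling edges are taken in lexicographic order of their attachment strings, then of their labels; replacing an edge labelled $A$ identifies the external nodes of $\mathrm{rhs}(A)$ with the attached nodes and gives its internal nodes, in increasing order, the next free numbers. These numbers are the node IDs. The $G$-representation of an ID $k$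 is the path $e_0\cdots e_r v$ in the derivation tree that creates node $k$: nonterminal edges $e_0$ of $S$, $e_1$ of $\mathrm{rhs}(\mathrm{lab}(e_0))$, and so on, and finally an internal node $v$ of $\mathrm{rhs}(\mathrm{lab}(e_r))$ (or just a node $v$ of $S$). The in-neighbours (out-neighbours) of $k$ are the nodes $u$ for which $\mathrm{val}(G)$ has an edge $e$ with $\mathrm{att}(e)=uk$ (respectively $\mathrm{att}(e)=ku$). Assume that every right-hand side of a rule (not necessarily $S$) has at most two nonterminal edges. Let $\ell$ be the number of nonterminal edges of $S$, let $h$ be the height of $G$ (the length of a longest chain of nonterminals, each occurring in the right-hand side of the previous one), and let $\nu=1+\log\ell+h$ (with $\log 0:=0$). **Proposition.** On a unit-cost random access machine (addition, truncated subtraction, halving, comparison, indirect addressing) there are fixed programs and constants such that the following holds for every such $G$. A preprocessing program, given $G$ (with the edges of each graph listed in the order above), stops within a number of steps polynomial in $|G|$. On the memory that it leaves, for every node ID $k\in\{1,\dots,|\mathrm{val}(G)|_V\}$: 1. the $G$-representation of $k$ is computed in time $O(\nu)$; 2. if $k$ has $n$ in-neighbours in $\mathrm{val}(G)$, a list without repetitions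 of their IDs is computed in time $O(\nu\cdot\max(1,n))$; 3. if $k$ has $n$ out-neighbours in $\mathrm{val}(G)$, a list without repetitions of their IDs is computed in time $O(\nu\cdot\max(1,n))$. The constants in the $O$-bounds do not depend on $G$ or $k$. -/

import Mathlib

/-! ## Hypergraphs -/

/-- An edge, given by its attachment string and its label.  Edges carry the lexicographic order:
first by attachment string (lexicographically), then by label.  Edges of one hypergraph that agree
in both components are interchangeable, so that the edges of a hypergraph form a multiset. -/
abbrev HREdge : Type := List ℕ ×ₗ ℕ

/-- The string of nodes that the edge is attached to. -/
def HREdge.att (e : HREdge) : List ℕ := (ofLex e).1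

/-- The label of the edge. -/
def HREdge.lab (e : HREdge) : ℕ := (ofLex e).2

/-- The edge with every attached node renamed by `ρ`. -/
def HREdge.rename (ρ : ℕ → ℕ) (e : HREdge) : HREdge := toLex (e.att.map ρ, e.lab)

/-- A hypergraph with node set `{1, …, numNodes}` and string `ext` of external nodes. -/
structure HyperGraph where
  numNodes : ℕ
  edges : Multiset HREdge
  ext : List ℕ

namespace HyperGraph

/-- The conditions on a hypergraph over a ranked alphabet with symbols `labels` and ranks `rank`:
there is a node; every edge has a label of its rank, has positive rank, is attached to nodes of the
graph only, and to none of them twice; the external nodes are pairwise distinct nodes. -/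
structure IsOver (labels : Set ℕ) (rank : ℕ → ℕ) (g : HyperGraph) : Prop where
  numNodes_pos : 1 ≤ g.numNodes
  lab_mem : ∀ e ∈ g.edges, e.lab ∈ labels
  length_att : ∀ e ∈ g.edges, e.att.length = rank e.lab
  att_ne_nil : ∀ e ∈ g.edges, e.att ≠ []
  att_mem : ∀ e ∈ g.edges, ∀ v ∈ e.att, 1 ≤ v ∧ v ≤ g.numNodes
  att_nodup : ∀ e ∈ g.edges, e.att.Nodup
  ext_mem : ∀ v ∈ g.ext, 1 ≤ v ∧ v ≤ g.numNodes
  ext_nodup : g.ext.Nodup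

/-- The internal (that is, not external) nodes, in increasing order. -/
def internal (g : HyperGraph) : List ℕ :=
  ((List.range g.numNodes).map (· + 1)).filter (· ∉ g.ext)

/-- The size: number of nodes plus edge size, where an edge of rank at most two counts one and an
edge of larger rank counts its rank. -/
def size (g : HyperGraph) : ℕ :=
  g.numNodes + (g.edges.map fun e => if e.att.length ≤ 2 then 1 else e.att.length).sum

/-- The incoming neighbors `u` of `v`: there is an edge attached to `u v`. -/
def inNeighbors (g : HyperGraph) (v : ℕ) : Set ℕ := {u | ∃ e ∈ g.edges, e.att = [u, v]}

/-- The outgoing neighbors `u` of `v`: there is an edge attached to `v u`. -/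
def outNeighbors (g : HyperGraph) (v : ℕ) : Set ℕ := {u | ∃ e ∈ g.edges, e.att = [v, u]}

/-- The node renaming used when an edge attached to `att` is replaced by `g` in a graph with `n`
nodes: the `i`-th external node becomes the `i`-th node of `att`, and the `i`-th internal node
becomes `n + i`. -/
def nodeMap (g : HyperGraph) (att : List ℕ) (n : ℕ) (v : ℕ) : ℕ :=
  if v ∈ g.ext then att.getD (g.ext.idxOf v) 0 else n + g.internal.idxOf v + 1

end HyperGraph

/-! ## Straight-line hyperedge replacement grammars -/

/-- A straight-line hyperedge replacement grammar over the terminal alphabet `{1, …, σ}`, with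
finite set `N` of nonterminals, start graph `start`, and exactly one rule `A → rhs A` for every
nonterminal `A` (the values of `rhs` outside `N` play no role). -/
structure SLHRGrammar where
  σ : ℕ
  N : Finset ℕ
  rank : ℕ → ℕ
  rhs : ℕ → HyperGraph
  start : HyperGraph
  N_disjoint : ∀ A ∈ N, A ∉ Set.Icc 1 σ
  start_isOver : start.IsOver (Set.Icc 1 σ ∪ N) rank
  rhs_isOver : ∀ A ∈ N, (rhs A).IsOver (Set.Icc 1 σ ∪ N) rank
  rank_rhs : ∀ A ∈ N, (rhs A).ext.length = rank A
  /-- no nonterminal derives itself -/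
  acyclic : ∀ A, ¬ Relation.TransGen
    (fun A B => A ∈ N ∧ B ∈ N ∧ ∃ e ∈ (rhs A).edges, e.lab = B) A A
  /-- every nonterminal occurs in the derivation -/
  reachable : ∀ A ∈ N, ∃ e ∈ start.edges, e.lab ∈ N ∧ Relation.ReflTransGen
    (fun A B => A ∈ N ∧ B ∈ N ∧ ∃ e ∈ (rhs A).edges, e.lab = B) e.lab A

namespace SLHRGrammar

/-- `B` labels an edge of the right-hand side of `A`. -/
def Dep (G : SLHRGrammar) (A B : ℕ) : Prop :=
  A ∈ G.N ∧ B ∈ G.N ∧ ∃ e ∈ (G.rhs A).edges, e.lab = B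

/-- The height of the grammar: the number of steps in a longest chain of nonterminals each of which
occurs in the right-hand side of the one before it (zero if there are no nonterminals). -/
noncomputable def height (G : SLHRGrammar) : ℕ :=
  sSup {m | ∃ p : List ℕ, p.length = m + 1 ∧ (∀ A ∈ p, A ∈ G.N) ∧ p.IsChain G.Dep}

/-- The sibling tuple of a graph: its nonterminal edges, ordered lexicographically by attachment
string and then by label. -/
def sib (G : SLHRGrammar) (g : HyperGraph) : List HREdge :=
  g.edges.sort.filter (·.lab ∈ G.N)

/-- The terminal edges of a graph. -/
def terminals (G : SLHRGrammar) (g : HyperGraph) : List HREdge :=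
  g.edges.sort.filter (·.lab ∉ G.N)

/-- The start graph and the right-hand sides, the latter in increasing order of the
nonterminals. -/
def rules (G : SLHRGrammar) : List HyperGraph := G.start :: G.N.sort.map G.rhs

/-- The size of the grammar, the sum of the sizes of its right-hand sides (and start graph). -/
def size (G : SLHRGrammar) : ℕ := (G.rules.map HyperGraph.size).sum

/-- Every right-hand side (of a rule, not the start graph) has at most two nonterminal edges. -/
def IsBinary (G : SLHRGrammar) : Prop := ∀ A ∈ G.N, (G.sib (G.rhs A)).length ≤ 2

/-- A state of the canonical derivation.  The nodes created so far are `1, …, nodes.length`; the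
list `nodes` records, for each of them, the path in the derivation tree that derives it.  Such a
path is a pair `(w, v)`: `w` lists the positions (counted from zero) of its edges in their sibling
tuples, and `v` is a node of the graph reached, which is internal there unless `w` is empty.
`edges` are the terminal edges created so far. -/
structure Derivation where
  nodes : List (List ℕ × ℕ)
  edges : List HREdge

/-- Derive the nonterminal edge `e`, reached by the path `w` in the derivation tree, completely and
in pre-order: first replace `e` by its right-hand side, giving the internal nodes of the right-hand
side, in increasing order, the next free numbers; then derive the nonterminal edges of the
right-hand side, each completely, in the order of their sibling tuple.  The first argument bounds
the depth of the recursion. -/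
def derive (G : SLHRGrammar) : ℕ → List ℕ → HREdge → Derivation → Derivation
  | 0, _, _, d => d
  | f + 1, w, e, d =>
    let h := G.rhs e.lab
    let ρ := h.nodeMap e.att d.nodes.length
    (G.sib h).zipIdx.foldl (fun d' x => G.derive f (w ++ [x.2]) (x.1.rename ρ) d')
      ⟨d.nodes ++ h.internal.map fun v => (w, v),
        d.edges ++ (G.terminals h).map (HREdge.rename ρ)⟩

/-- The canonical derivation from the start graph.  As the dependence between nonterminals is
acyclic, the derivation tree has depth at most `|N|`, so that the depth bound is not felt. -/
def derivation (G : SLHRGrammar) : Derivation :=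
  (G.sib G.start).zipIdx.foldl (fun d x => G.derive G.N.card [x.2] x.1 d)
    ⟨(List.range G.start.numNodes).map fun i => ([], i + 1), G.terminals G.start⟩

/-- The graph `val(G)`, with its canonical node numbering. -/
def val (G : SLHRGrammar) : HyperGraph where
  numNodes := G.derivation.nodes.length
  edges := G.derivation.edges
  ext := G.start.ext

/-- The `G`-representation of the node `k` of `val(G)`, written as one string `w v`. -/
def gRep (G : SLHRGrammar) (k : ℕ) : List ℕ :=
  let x := G.derivation.nodes.getD (k - 1) ([], 0)
  x.1 ++ [x.2]

/-- The cost `ν = 1 + log ℓ + h` of computing a `G`-representation, where `ℓ` is the number of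
nonterminal edges of the start graph and `h` is the height of the grammar. -/
noncomputable def nu (G : SLHRGrammar) : ℕ :=
  1 + Nat.log 2 (G.sib G.start).length + G.height

end SLHRGrammar

/-! ## Random access machines -/

namespace RAM

/-- The memory: registers and (named) arrays of natural numbers. -/
structure Memory where
  reg : ℕ → ℕ
  arr : ℕ → ℕ → ℕ

/-- The memory `M` with the value `n` stored in register `x`. -/
def Memory.setReg (M : Memory) (x n : ℕ) : Memory :=
  { M with reg := Function.update M.reg x n }

/-- The memory `M` with the value `n` stored in cell `i` of the array `a`. -/
def Memory.setArr (M : Memory) (a i n : ℕ) : Memory :=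
  { M with arr := Function.update M.arr a (Function.update (M.arr a) i n) }

/-- Expressions: constants, registers, array cells, addition, truncated subtraction, halving
(rounding down) and comparison. -/
inductive Expr where
  | const (n : ℕ)
  | reg (x : ℕ)
  | get (a : ℕ) (i : Expr)
  | add (p q : Expr)
  | sub (p q : Expr)
  | half (p : Expr)
  | lt (p q : Expr)
  | eq (p q : Expr)

/-- The value of an expression; comparisons have the value `1` (true) or `0` (false). -/
def Expr.eval (M : Memory) : Expr → ℕ
  | const n => n
  | reg x => M.reg x
  | get a i => M.arr a (i.eval M)
  | add p q => p.eval M + q.eval M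
  | sub p q => p.eval M - q.eval M
  | half p => p.eval M / 2
  | lt p q => if p.eval M < q.eval M then 1 else 0
  | eq p q => if p.eval M = q.eval M then 1 else 0

/-- The number of elementary operations in an expression. -/
def Expr.cost : Expr → ℕ
  | const _ => 1
  | reg _ => 1
  | get _ i => i.cost + 1
  | add p q => p.cost + q.cost + 1
  | sub p q => p.cost + q.cost + 1
  | half p => p.cost + 1
  | lt p q => p.cost + q.cost + 1
  | eq p q => p.cost + q.cost + 1

/-- Programs.  A condition is true if its value is not zero. -/
inductive Prog where
  | skip
  | setReg (x : ℕ) (p : Expr)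
  | setArr (a : ℕ) (i p : Expr)
  | seq (P Q : Prog)
  | ite (b : Expr) (P Q : Prog)
  | loop (b : Expr) (P : Prog)

/-- `Runs P M t M'`: started with memory `M`, the program `P` stops after `t` elementary steps with
memory `M'`.  (`loop b P` repeats `P` while `b` is true.) -/
inductive Runs : Prog → Memory → ℕ → Memory → Prop where
  | skip (M) : Runs .skip M 1 M
  | setReg (M x p) : Runs (.setReg x p) M (p.cost + 1) (M.setReg x (p.eval M))
  | setArr (M a i p) :
      Runs (.setArr a i p) M (i.cost + p.cost + 1) (M.setArr a (i.eval M) (p.eval M))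
  | seq {P Q M t M' t' M''} :
      Runs P M t M' → Runs Q M' t' M'' → Runs (.seq P Q) M (t + t') M''
  | ite_true {b P Q M t M'} :
      b.eval M ≠ 0 → Runs P M t M' → Runs (.ite b P Q) M (b.cost + t + 1) M'
  | ite_false {b P Q M t M'} :
      b.eval M = 0 → Runs Q M t M' → Runs (.ite b P Q) M (b.cost + t + 1) M'
  | loop_true {b P M t M' t' M''} :
      b.eval M ≠ 0 → Runs P M t M' → Runs (.loop b P) M' t' M'' →
        Runs (.loop b P) M (b.cost + t + t' + 1) M''
  | loop_false {b P M} : b.eval M = 0 → Runs (.loop b P) M (b.cost + 1) M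

/-- Started with memory `M` and the number `k` in register `0`, the program `P` stops within `T`
steps with the list `L` as its output: the length of `L` is in register `0` and its entries are in
the first cells of the array `0`. -/
def Answers (P : Prog) (M : Memory) (k T : ℕ) (L : List ℕ) : Prop :=
  ∃ t ≤ T, ∃ M', Runs P (M.setReg 0 k) t M' ∧ M'.reg 0 = L.length ∧
    ∀ (i : ℕ) (hi : i < L.length), M'.arr 0 i = L[i]

/-- The infinite array that starts with the list `L` and is zero from there on. -/
def ofList (L : List ℕ) : ℕ → ℕ := fun i => L.getD i 0

/-- The starting positions of the blocks in a concatenation of blocks of the lengths in `L`,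
followed by the total length. -/
def offsets (L : List ℕ) : List ℕ := (List.range (L.length + 1)).map fun r => (L.take r).sum

end RAM

namespace SLHRGrammar

/-- The edges of all right-hand sides, one right-hand side after the other. -/
def allEdges (G : SLHRGrammar) : List HREdge := G.rules.flatMap fun g => g.edges.sort

/-- The number that stands for a label in memory: a terminal stands for itself, the `i`-th
nonterminal is `σ + i`. -/
def labCode (G : SLHRGrammar) (a : ℕ) : ℕ :=
  if a ∈ G.N then G.σ + G.N.sort.idxOf a + 1 else a

/-- The grammar as input to a program.  Graph `0` is the start graph, graph `i` the right-hand side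
of the `i`-th nonterminal.  Registers `0` and `1` hold the numbers of nonterminals and of
terminals.  Array `1` holds the numbers of nodes of the graphs.  Array `3` is the concatenation of
their strings of external nodes, and array `2` tells where each of these starts.  Array `5` holds
the labels of the edges of all graphs, and array `4` tells where the edges of each graph start.
Array `7` is the concatenation of the attachment strings of these edges, and array `6` tells where
each of these starts. -/
def input (G : SLHRGrammar) : RAM.Memory where
  reg x := if x = 0 then G.N.card else if x = 1 then G.σ else 0
  arr a :=
    if a = 1 then RAM.ofList (G.rules.map (·.numNodes))
    else if a = 2 then RAM.ofList (RAM.offsets (G.rules.map (·.ext.length)))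
    else if a = 3 then RAM.ofList (G.rules.flatMap (·.ext))
    else if a = 4 then RAM.ofList (RAM.offsets (G.rules.map (·.edges.card)))
    else if a = 5 then RAM.ofList (G.allEdges.map fun e => G.labCode e.lab)
    else if a = 6 then RAM.ofList (RAM.offsets (G.allEdges.map (·.att.length)))
    else if a = 7 then RAM.ofList (G.allEdges.flatMap (·.att))
    else fun _ => 0

end SLHRGrammar

/-! The derivation tree can be exponentially large, but what a query must know about a subderivation
depends only on the graph at which it starts. It therefore suffices to tabulate, for every graph `g`
of the grammar: the number `sz g` of nodes created by deriving from `g`, the prefix sums `pre g s`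
of these numbers over the nonterminal edges, the number `cn g u v` of edges between two nodes of `g`
that exist after deriving, and the number `ne g v` of created nodes from which an edge leads to `v`.
Each table satisfies a recursion along the acyclic dependence of nonterminals, so a fixed-point
iteration over polynomially many cells computes it in as many rounds as there are levels. The
entries may be exponentially large numbers, which unit cost permits.

Locating a node. Pre-order numbering gives every subderivation an interval of consecutive IDs. Hence
`k` is either an internal node of the graph at hand, or binary search in `pre g` finds the
nonterminal edge to descend into. The search costs `log ℓ` in the start graph and, because the
grammar is binary, constant time in every other graph; this is the `O(ν)` of `locateProg_spec`.

Finding neighbors. Let `k` be the internal node `v` of the graph `g` at the end of its path. Nothing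
outside the subderivation at `g` can be attached to `v`, so all edges at `k` come from there
(`edge_path_iff`). A neighbor older than this subderivation is an external node `u` of `g` with `cn
g u v ≠ 0`; its ID is found by climbing the path until `u` becomes internal, which takes at most as
many steps as the path has (`resolveProg_spec`). A younger neighbor is an internal node of `g`,
again recognized by `cn`, or lies below a nonterminal edge attached to `v`. Only edges with nonzero
`ne` are entered, so every branch visited yields a neighbor, and the work can be charged to
neighbors times depth (`workCost_branches`). That each neighbor occurs exactly once is
`inNeighbors_list`.

Out-neighbors are in-neighbors after reversing all edges of rank two, which only changes the table
of terminal edges. The combinatorics is carried out in an abstract `RuleSystem`; `derivation_spec`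
identifies its edges and created nodes with those of the canonical derivation. On the machine side,
all tables are given by terms with bounded sums, whose programs are correct and polynomial by one
induction over the syntax. -/

namespace RAM

/-! ## A program logic with running times -/

/-- Started with memory `M`, the program stops within `T` steps with a memory satisfying `Q`. -/
def HaltsIn (P : Prog) (M : Memory) (T : ℕ) (Q : Memory → Prop) : Prop :=
  ∃ t ≤ T, ∃ M', Runs P M t M' ∧ Q M'

theorem HaltsIn.mono {P M T T' Q Q'} (h : HaltsIn P M T Q) (hT : T ≤ T')
    (hQ : ∀ M', Q M' → Q' M') : HaltsIn P M T' Q' := by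
  obtain ⟨t, ht, M', hr, hq⟩ := h
  exact ⟨t, ht.trans hT, M', hr, hQ _ hq⟩

theorem HaltsIn.seq {P P' M T T' Q R} (h : HaltsIn P M T Q)
    (h' : ∀ M', Q M' → HaltsIn P' M' T' R) : HaltsIn (.seq P P') M (T + T') R := by
  obtain ⟨t, ht, M', hr, hq⟩ := h
  obtain ⟨t', ht', M'', hr', hq'⟩ := h' M' hq
  exact ⟨t + t', by omega, M'', .seq hr hr', hq'⟩

theorem HaltsIn.seq' {P P' M T Q R} (T₁ T₂ : ℕ) (hT : T₁ + T₂ ≤ T) (h : HaltsIn P M T₁ Q)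
    (h' : ∀ M', Q M' → HaltsIn P' M' T₂ R) : HaltsIn (.seq P P') M T R :=
  (h.seq h').mono hT fun _ h => h

theorem HaltsIn.ite {b P P' M T Q} (h : b.eval M ≠ 0 → HaltsIn P M T Q)
    (h' : b.eval M = 0 → HaltsIn P' M T Q) : HaltsIn (.ite b P P') M (b.cost + T + 1) Q := by
  by_cases hb : b.eval M = 0
  · obtain ⟨t, ht, M', hr, hq⟩ := h' hb
    exact ⟨_, by omega, M', .ite_false hb hr, hq⟩
  · obtain ⟨t, ht, M', hr, hq⟩ := h hb
    exact ⟨_, by omega, M', .ite_true hb hr, hq⟩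

/-- The loop rule: the invariant is indexed by a bound on the remaining running time. -/
theorem HaltsIn.loop {b P Q} (I : ℕ → Memory → Prop)
    (h : ∀ φ M, I φ M → (b.eval M = 0 ∧ Q M ∧ b.cost + 1 ≤ φ) ∨
      (b.eval M ≠ 0 ∧ ∃ t φ', t + φ' + b.cost + 1 ≤ φ ∧ HaltsIn P M t (I φ'))) :
    ∀ φ M, I φ M → HaltsIn (.loop b P) M φ Q := by
  intro φ
  induction φ using Nat.strong_induction_on with
  | _ φ ih =>
    intro M hI
    rcases h φ M hI with ⟨hb, hQ, hc⟩ | ⟨hb, t, φ', hle, hP⟩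
    · exact ⟨_, hc, M, .loop_false hb, hQ⟩
    · obtain ⟨t₁, ht₁, M₁, hr₁, hI₁⟩ := hP
      obtain ⟨t₂, ht₂, M₂, hr₂, hQ⟩ := ih φ' (by omega) M₁ hI₁
      exact ⟨_, by omega, M₂, .loop_true hb hr₁ hr₂, hQ⟩

/-- The rule for counting loops: `n` rounds, each taking at most `c` steps. -/
theorem HaltsIn.for {b P M} (n c : ℕ) (I : ℕ → Memory → Prop) (h0 : I 0 M)
    (hn : ∀ M, I n M → b.eval M = 0)
    (h : ∀ i < n, ∀ M, I i M → b.eval M ≠ 0 ∧ HaltsIn P M c (I (i + 1))) :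
    HaltsIn (.loop b P) M (n * (c + b.cost + 1) + b.cost + 1) (I n) := by
  refine HaltsIn.loop (fun φ M => ∃ i ≤ n, I i M ∧ φ = (n - i) * (c + b.cost + 1) + b.cost + 1)
    ?_ _ M ⟨0, by omega, h0, by simp⟩
  rintro φ M ⟨i, hi, hI, rfl⟩
  rcases hi.eq_or_lt with rfl | hlt
  · exact .inl ⟨hn M hI, hI, by simp⟩
  · refine .inr ⟨(h i hlt M hI).1, c, (n - (i + 1)) * (c + b.cost + 1) + b.cost + 1, ?_,
      (h i hlt M hI).2.mono le_rfl fun M' hM' => ⟨i + 1, hlt, hM', rfl⟩⟩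
    obtain ⟨m, rfl⟩ : ∃ m, n = i + 1 + m := ⟨n - (i + 1), by omega⟩
    rw [show i + 1 + m - (i + 1) = m by omega, show i + 1 + m - i = m + 1 by omega, Nat.succ_mul]
    omega

/-- The effect of a program without loops. -/
def Prog.exec : Prog → Memory → Memory
  | skip, M => M
  | setReg x p, M => M.setReg x (p.eval M)
  | setArr a i p, M => M.setArr a (i.eval M) (p.eval M)
  | seq P Q, M => Q.exec (P.exec M)
  | ite b P Q, M => if b.eval M ≠ 0 then P.exec M else Q.exec M
  | loop _ _, M => M

/-- A bound on the running time of a program without loops. -/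
def Prog.time : Prog → ℕ
  | skip => 1
  | setReg _ p => p.cost + 1
  | setArr _ i p => i.cost + p.cost + 1
  | seq P Q => P.time + Q.time
  | ite b P Q => b.cost + max P.time Q.time + 1
  | loop _ _ => 0

/-- The program has no loops. -/
def Prog.loopFree : Prog → Bool
  | seq P Q => P.loopFree && Q.loopFree
  | ite _ P Q => P.loopFree && Q.loopFree
  | loop _ _ => false
  | _ => true

/-- Straight-line code needs no invariants: loop-freeness holds by `rfl`, the running time is a
computation, and the postcondition becomes a symbolic evaluation left to `simp`. -/
theorem HaltsIn.exec {P M Q} (h : P.loopFree = true) (hQ : Q (P.exec M)) :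
    HaltsIn P M P.time Q := by
  suffices ∀ P : Prog, P.loopFree = true → ∀ M, HaltsIn P M P.time (· = P.exec M) from
    (this P h M).mono le_rfl (by rintro _ rfl; exact hQ)
  clear h hQ
  intro P
  induction P with
  | skip => exact fun _ M => ⟨_, le_rfl, _, .skip M, rfl⟩
  | setReg x p => exact fun _ M => ⟨_, le_rfl, _, .setReg M x p, rfl⟩
  | setArr a i p => exact fun _ M => ⟨_, le_rfl, _, .setArr M a i p, rfl⟩
  | seq P Q ihP ihQ =>
    intro h M
    simp only [Prog.loopFree, Bool.and_eq_true] at h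
    refine (ihP h.1 M).seq ?_
    rintro _ rfl
    exact ihQ h.2 _
  | ite b P Q ihP ihQ =>
    intro h M
    simp only [Prog.loopFree, Bool.and_eq_true] at h
    refine HaltsIn.ite (fun hb => ?_) (fun hb => ?_)
    · exact (ihP h.1 M).mono (le_max_left _ _) (by rintro _ rfl; simp [Prog.exec, hb])
    · exact (ihQ h.2 M).mono (le_max_right _ _) (by rintro _ rfl; simp [Prog.exec, hb])
  | loop b P => exact fun h => by simp [Prog.loopFree] at h

@[simp] theorem Memory.setReg_arr (M : Memory) (x n) : (M.setReg x n).arr = M.arr := rfl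

@[simp] theorem Memory.setArr_reg (M : Memory) (a i n) : (M.setArr a i n).reg = M.reg := rfl

theorem Memory.setReg_reg (M : Memory) (x n y) :
    (M.setReg x n).reg y = if y = x then n else M.reg y := by
  simp [setReg, Function.update_apply]

theorem Memory.setArr_arr (M : Memory) (a i n b) :
    (M.setArr a i n).arr b = if b = a then Function.update (M.arr a) i n else M.arr b := by
  simp [setArr, Function.update_apply]

theorem Memory.setArr_arr_apply (M : Memory) (a i n b j) :
    (M.setArr a i n).arr b j = if b = a ∧ j = i then n else M.arr b j := by
  by_cases h : b = a <;> by_cases h' : j = i <;> simp [setArr_arr, h, h']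

/-! ## Terms with bounded sums -/

/-- The binary operations. -/
inductive Op where
  | add
  | sub
  | lt
  | eq

/-- The value of a binary operation. -/
def Op.eval : Op → ℕ → ℕ → ℕ
  | add, m, n => m + n
  | sub, m, n => m - n
  | lt, m, n => if m < n then 1 else 0
  | eq, m, n => if m = n then 1 else 0

/-- The expression that applies a binary operation. -/
def Op.toExpr : Op → Expr → Expr → Expr
  | add => .add
  | sub => .sub
  | lt => .lt
  | eq => .eq

/-- Terms over variables and arrays.  A sum `sum x p` runs over all values of the variable `x` below
the value of the variable `22`. -/
inductive Term where
  | const (n : ℕ)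
  | var (x : ℕ)
  | get (a : ℕ) (i : Term)
  | bin (o : Op) (p q : Term)
  | ite (c p q : Term)
  | sum (x : ℕ) (p : Term)

/-- The value of a term. -/
def Term.eval (A : ℕ → ℕ → ℕ) : Term → (ℕ → ℕ) → ℕ
  | const n, _ => n
  | var x, ρ => ρ x
  | get a i, ρ => A a (i.eval A ρ)
  | bin o p q, ρ => o.eval (p.eval A ρ) (q.eval A ρ)
  | ite c p q, ρ => if c.eval A ρ ≠ 0 then p.eval A ρ else q.eval A ρ
  | sum x p, ρ => ∑ i ∈ Finset.range (ρ 22), p.eval A (Function.update ρ x i)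

/-- The program that computes the value of a term in register `2 * d + 1`, using besides only odd
registers beyond; register `2 * x` holds the value of the variable `x`. -/
def Term.compile : ℕ → Term → Prog
  | d, const n => .setReg (2 * d + 1) (.const n)
  | d, var x => .setReg (2 * d + 1) (.reg (2 * x))
  | d, get a i => .seq (i.compile d) (.setReg (2 * d + 1) (.get a (.reg (2 * d + 1))))
  | d, bin o p q => .seq (p.compile d) (.seq (q.compile (d + 1))
      (.setReg (2 * d + 1) (o.toExpr (.reg (2 * d + 1)) (.reg (2 * d + 3)))))
  | d, ite c p q => .seq (c.compile d) (.ite (.reg (2 * d + 1)) (p.compile d) (q.compile d))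
  | d, sum x p => .seq
      (.seq (.setReg (2 * d + 1) (.const 0)) <| .seq (.setReg (2 * d + 3) (.reg (2 * x))) <|
        .seq (.setReg (2 * d + 5) (.reg 44)) (.setReg (2 * x) (.const 0)))
      (.seq (.loop (.lt (.reg (2 * x)) (.reg (2 * d + 5)))
        (.seq (p.compile (d + 3))
          (.seq (.setReg (2 * d + 1) (.add (.reg (2 * d + 1)) (.reg (2 * d + 7))))
            (.setReg (2 * x) (.add (.reg (2 * x)) (.const 1))))))
        (.setReg (2 * x) (.reg (2 * d + 3))))

/-- A bound on the time for the computation of a term. -/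
def Term.cost (B : ℕ) : Term → ℕ
  | const _ => 2
  | var _ => 2
  | get _ i => i.cost B + 3
  | bin _ p q => p.cost B + q.cost B + 4
  | ite c p q => c.cost B + p.cost B + q.cost B + 2
  | sum _ p => B * (p.cost B + 12) + 14

/-- Even registers hold variables, odd registers from `2 * d + 1` on serve as an evaluation stack.
The last clause is the frame condition that makes the induction compose: a subterm at greater depth
preserves all partial results below it. A sum overwrites the register of its own variable but
restores it, so even registers are preserved without exception. -/
theorem Term.compile_spec (e : Term) : ∀ (d : ℕ) (M : Memory) (B : ℕ), M.reg 44 ≤ B →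
    HaltsIn (e.compile d) M (e.cost B) fun M' => M'.arr = M.arr ∧
      M'.reg (2 * d + 1) = e.eval M.arr (fun x => M.reg (2 * x)) ∧
      ∀ y, y % 2 = 0 ∨ y < 2 * d → M'.reg y = M.reg y := by
  induction e with
  | const n =>
    intro d M B _
    refine (HaltsIn.exec (P := .setReg _ _) rfl ?_ : HaltsIn _ M _ _)
    refine ⟨rfl, by simp [Prog.exec, Memory.setReg_reg, Expr.eval, Term.eval], fun y hy => ?_⟩
    simp [Prog.exec, Memory.setReg_reg, show y ≠ 2 * d + 1 by omega]
  | var n =>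
    intro d M B _
    refine (HaltsIn.exec (P := .setReg _ _) rfl ?_ : HaltsIn _ M _ _)
    refine ⟨rfl, by simp [Prog.exec, Memory.setReg_reg, Expr.eval, Term.eval], fun y hy => ?_⟩
    simp [Prog.exec, Memory.setReg_reg, show y ≠ 2 * d + 1 by omega]
  | get a i ih =>
    intro d M B hB
    refine (ih d M B hB).seq fun M₁ ⟨hA, hv, hf⟩ => (HaltsIn.exec rfl ?_ : HaltsIn _ _ 3 _)
    refine ⟨hA, by simp [Prog.exec, Memory.setReg_reg, Expr.eval, Term.eval, hA, hv], fun y hy => ?_⟩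
    simp [Prog.exec, Memory.setReg_reg, show y ≠ 2 * d + 1 by omega, hf y hy]
  | bin o p q ihp ihq =>
    intro d M B hB
    refine (ihp d M B hB).seq' _ (q.cost B + 4) (by simp [Term.cost]; omega)
      fun M₁ ⟨hA₁, hv₁, hf₁⟩ => ?_
    have h44 : M₁.reg 44 = M.reg 44 := hf₁ 44 (by simp)
    refine (ihq (d + 1) M₁ B (by omega)).seq fun M₂ ⟨hA₂, hv₂, hf₂⟩ => ?_
    have hvar : (fun x => M₁.reg (2 * x)) = fun x => M.reg (2 * x) := by
      funext x; exact hf₁ _ (by simp)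
    have hc : (Prog.setReg (2 * d + 1) (o.toExpr (.reg (2 * d + 1)) (.reg (2 * d + 3)))).time = 4 := by
      cases o <;> rfl
    rw [← hc]
    refine HaltsIn.exec rfl ⟨by simp [Prog.exec, hA₁, hA₂], ?_, fun y hy => ?_⟩
    · have e1 := hf₂ (2 * d + 1) (by omega)
      have e2 : M₂.reg (2 * d + 3) = _ := hv₂
      rw [hvar, hA₁] at e2
      cases o <;> simp [Prog.exec, Memory.setReg_reg, Op.toExpr, Expr.eval, Term.eval, Op.eval, e1, e2, hv₁]
    · simp [Prog.exec, Memory.setReg_reg, show y ≠ 2 * d + 1 by omega, hf₂ y (by omega), hf₁ y hy]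
  | ite c p q ihc ihp ihq =>
    intro d M B hB
    refine (ihc d M B hB).seq' _ (1 + (p.cost B + q.cost B) + 1) (by simp [Term.cost]; omega)
      fun M₁ ⟨hA₁, hv₁, hf₁⟩ => ?_
    have h44 : M₁.reg 44 = M.reg 44 := hf₁ 44 (by simp)
    have hvar : (fun x => M₁.reg (2 * x)) = fun x => M.reg (2 * x) := by
      funext x; exact hf₁ _ (by simp)
    refine HaltsIn.ite (b := .reg (2 * d + 1)) (fun hb => ?_) (fun hb => ?_)
    · refine (ihp d M₁ B (by omega)).mono (by omega) fun M₂ ⟨hA₂, hv₂, hf₂⟩ =>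
        ⟨hA₂.trans hA₁, ?_, fun y hy => (hf₂ y hy).trans (hf₁ y hy)⟩
      rw [hv₂, hvar, hA₁, Term.eval, if_pos (by rw [← hv₁]; exact hb)]
    · refine (ihq d M₁ B (by omega)).mono (by omega) fun M₂ ⟨hA₂, hv₂, hf₂⟩ =>
        ⟨hA₂.trans hA₁, ?_, fun y hy => (hf₂ y hy).trans (hf₁ y hy)⟩
      rw [hv₂, hvar, hA₁, Term.eval, if_neg (by rw [← hv₁]; exact not_not.2 hb)]
  | sum x p ih =>
    intro d M B hB
    set ρ : ℕ → ℕ := fun x => M.reg (2 * x) with hρ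
    -- Register `2 * d + 1` accumulates the sum, `2 * d + 3` saves the old value of the variable,
    -- and `2 * d + 5` keeps the number of rounds. The summand is compiled at depth `d + 3`, beyond
    -- these three.
    let I : ℕ → Memory → Prop := fun i M' => M'.arr = M.arr ∧
      M'.reg (2 * d + 1) = ∑ j ∈ Finset.range i, p.eval M.arr (Function.update ρ x j) ∧
      M'.reg (2 * d + 3) = M.reg (2 * x) ∧ M'.reg (2 * d + 5) = M.reg 44 ∧ M'.reg (2 * x) = i ∧
      ∀ y, y % 2 = 0 ∨ y < 2 * d → y ≠ 2 * x → M'.reg y = M.reg y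
    refine HaltsIn.seq' (Q := I 0) 8 (B * (p.cost B + 12) + 6) (by simp [Term.cost]; omega)
      (HaltsIn.exec rfl ?_ : HaltsIn _ _ 8 _) fun M₁ h₁ => ?_
    · simp only [Prog.exec, Expr.eval, I]
      refine ⟨rfl, ?_, ?_, ?_, ?_, fun y hy hx => ?_⟩
      · simp [Memory.setReg_reg, show 2 * d + 1 ≠ 2 * x by omega]
      · simp [Memory.setReg_reg, show 2 * d + 3 ≠ 2 * x by omega, show 2 * x ≠ 2 * d + 1 by omega]
      · simp [Memory.setReg_reg, show 2 * d + 5 ≠ 2 * x by omega, show 44 ≠ 2 * d + 1 by omega,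
          show 44 ≠ 2 * d + 3 by omega]
      · simp [Memory.setReg_reg]
      · simp [Memory.setReg_reg, hx, show y ≠ 2 * d + 1 by omega, show y ≠ 2 * d + 3 by omega,
          show y ≠ 2 * d + 5 by omega]
    refine HaltsIn.seq' (Q := I (M.reg 44)) (B * (p.cost B + 12) + 4) 2 le_rfl ?_ fun M₂ h₂ => ?_
    · refine (HaltsIn.for (M.reg 44) (p.cost B + 8) I h₁ (fun M' h' => ?_)
        fun i hi M' h' => ⟨?_, ?_⟩).mono ?_ fun _ h => h
      · simp [Expr.eval, h'.2.2.2.1, h'.2.2.2.2.1]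
      · simp [Expr.eval, h'.2.2.2.1, h'.2.2.2.2.1, hi]
      · obtain ⟨hA, hacc, hsv, hbd, hx, hf⟩ := h'
        -- The summation variable may be the bound variable `22` itself; its current value `i` is
        -- then still below the old bound.
        have h44 : M'.reg 44 ≤ B := by
          by_cases h : 44 = 2 * x
          · rw [h, hx]; omega
          · rw [hf 44 (by simp) h]; exact hB
        have hvar : (fun x => M'.reg (2 * x)) = Function.update ρ x i := by
          funext z
          by_cases h : z = x
          · simp [h, hx]
          · simp [h, hρ, hf (2 * z) (by simp) (by omega)]
        refine (ih (d + 3) M' B h44).seq fun M'' ⟨hA', hv', hf'⟩ =>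
          (HaltsIn.exec rfl ?_ : HaltsIn _ _ 8 _)
        rw [hA, hvar] at hv'
        have hv'' : M''.reg (2 * d + 7) = _ := hv'
        have e1 := hf' (2 * d + 1) (by omega)
        have e2 := hf' (2 * d + 3) (by omega)
        have e3 := hf' (2 * d + 5) (by omega)
        have e4 := hf' (2 * x) (by omega)
        simp only [Prog.exec, Expr.eval, I]
        refine ⟨hA'.trans hA, ?_, ?_, ?_, ?_, fun y hy hyx => ?_⟩
        · simp [Memory.setReg_reg, show 2 * d + 1 ≠ 2 * x by omega, e1, hv'', hacc,
            Finset.sum_range_succ]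
        · simp [Memory.setReg_reg, show 2 * d + 3 ≠ 2 * x by omega, e2, hsv]
        · simp [Memory.setReg_reg, show 2 * d + 5 ≠ 2 * x by omega, e3, hbd]
        · simp [Memory.setReg_reg, show 2 * x ≠ 2 * d + 1 by omega, e4, hx]
        · simp [Memory.setReg_reg, hyx, show y ≠ 2 * d + 1 by omega, hf' y (by omega), hf y hy hyx]
      · simp only [Expr.cost]
        have : M.reg 44 * (p.cost B + 8 + (1 + 1 + 1) + 1) ≤ B * (p.cost B + 12) :=
          Nat.mul_le_mul hB (by omega)
        omega
    · obtain ⟨hA, hacc, hsv, hbd, hx, hf⟩ := h₂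
      refine (HaltsIn.exec (P := .setReg _ (.reg _)) rfl ?_ : HaltsIn _ _ 2 _)
      simp only [Prog.exec, Expr.eval]
      refine ⟨hA, ?_, fun y hy => ?_⟩
      · simp [Memory.setReg_reg, show 2 * d + 1 ≠ 2 * x by omega, hacc, Term.eval, hρ]
      · by_cases h : y = 2 * x
        · simp [Memory.setReg_reg, h, hsv]
        · simp [Memory.setReg_reg, h, hf y hy h]

/-- Functions bounded by a polynomial. -/
def PolyBdd (f : ℕ → ℕ) : Prop := ∃ K c, ∀ B, f B ≤ K * (B + 1) ^ c

theorem PolyBdd.const (n : ℕ) : PolyBdd fun _ => n := ⟨n, 0, by simp⟩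

theorem PolyBdd.id : PolyBdd fun B => B := ⟨1, 1, by simp⟩

theorem PolyBdd.add {f g} (hf : PolyBdd f) (hg : PolyBdd g) : PolyBdd fun B => f B + g B := by
  obtain ⟨K, c, hf⟩ := hf
  obtain ⟨K', c', hg⟩ := hg
  refine ⟨K + K', c + c', fun B => ?_⟩
  rw [add_mul]
  refine Nat.add_le_add ((hf B).trans ?_) ((hg B).trans ?_)
  · exact Nat.mul_le_mul_left _ (Nat.pow_le_pow_right (by omega) (by omega))
  · exact Nat.mul_le_mul_left _ (Nat.pow_le_pow_right (by omega) (by omega))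

theorem PolyBdd.mul {f g} (hf : PolyBdd f) (hg : PolyBdd g) : PolyBdd fun B => f B * g B := by
  obtain ⟨K, c, hf⟩ := hf
  obtain ⟨K', c', hg⟩ := hg
  refine ⟨K * K', c + c', fun B => (Nat.mul_le_mul (hf B) (hg B)).trans (le_of_eq ?_)⟩
  ring

/-- Only sums multiply the cost by `B`, so the degree is the nesting depth of sums, which is fixed
with the term. -/
theorem Term.polyBdd_cost (e : Term) : PolyBdd fun B => e.cost B := by
  induction e with
  | const n => exact .const 2
  | var x => exact .const 2
  | get a i ih => exact ih.add (.const 3)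
  | bin o p q ihp ihq => exact (ihp.add ihq).add (.const 4)
  | ite c p q ihc ihp ihq => exact ((ihc.add ihp).add ihq).add (.const 2)
  | sum x p ih => exact (PolyBdd.id.mul (ih.add (.const 12))).add (.const 14)

end RAM

namespace RAM

/-! ## Filling tables -/

/-- The arrays that a term reads. -/
def Term.arrays : Term → List ℕ
  | const _ => []
  | var _ => []
  | get a i => a :: i.arrays
  | bin _ p q => p.arrays ++ q.arrays
  | ite c p q => c.arrays ++ (p.arrays ++ q.arrays)
  | sum _ p => p.arrays

theorem Term.eval_congr {A A' : ℕ → ℕ → ℕ} (e : Term) (h : ∀ a ∈ e.arrays, A a = A' a)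
    (ρ : ℕ → ℕ) : e.eval A ρ = e.eval A' ρ := by
  induction e generalizing ρ with
  | const n => rfl
  | var x => rfl
  | get a i ih =>
    simp only [arrays, List.mem_cons, forall_eq_or_imp] at h
    simp [eval, h.1, ih h.2]
  | bin o p q ihp ihq =>
    simp only [arrays, List.mem_append] at h
    simp [eval, ihp (fun a ha => h a (.inl ha)), ihq (fun a ha => h a (.inr ha))]
  | ite c p q ihc ihp ihq =>
    simp only [arrays, List.mem_append] at h
    simp [eval, ihc (fun a ha => h a (.inl ha)), ihp (fun a ha => h a (.inr (.inl ha))),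
      ihq (fun a ha => h a (.inr (.inr ha)))]
  | sum x p ih => simp [eval, ih h]

/-- The variables while cell `x` of a table is computed: the digits of `x` to base `B`, then `x`. -/
def cellEnv (B : ℕ) (ρ : ℕ → ℕ) (x : ℕ) : ℕ → ℕ := fun y =>
  if y = 0 then x / (B * B) else if y = 1 then x / B % B else if y = 2 then x % B
  else if y = 3 then x else ρ y

/-- Store the value of register `5` in the array `a` and advance to the next cell. -/
def storeNext (a : ℕ) : Prog :=
  .seq (.setArr a (.reg 6) (.reg 5)) <| .seq (.setReg 6 (.add (.reg 6) (.const 1))) <|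
    .seq (.setReg 4 (.add (.reg 4) (.const 1))) <|
    .ite (.lt (.reg 4) (.reg 44)) .skip <| .seq (.setReg 4 (.const 0)) <|
    .seq (.setReg 2 (.add (.reg 2) (.const 1))) <|
    .ite (.lt (.reg 2) (.reg 44)) .skip <| .seq (.setReg 2 (.const 0)) <|
    .setReg 0 (.add (.reg 0) (.const 1))

/-- Fill the first `B ^ 3` cells of the array `a` with the values of the term `e`. -/
def fillProg (a : ℕ) (e : Term) : Prog :=
  .seq (.seq (.setReg 0 (.const 0)) <| .seq (.setReg 2 (.const 0)) <|
      .seq (.setReg 4 (.const 0)) (.setReg 6 (.const 0)))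
    (.loop (.lt (.reg 0) (.reg 44)) <| .seq (e.compile 2) (storeNext a))

/-- The even registers from `8` on hold the values of the variables. -/
def VarsOk (ρ : ℕ → ℕ) (M : Memory) : Prop := ∀ x, 4 ≤ x → M.reg (2 * x) = ρ x

/-- There is no division on this machine, so the base-`B` digits of the cell number are kept as
counters in registers `0`, `2`, `4`, next to the number itself in register `6`. The three cases of
the proof are no carry, one carry and two carries. -/
theorem storeNext_spec {B i j l p v : ℕ} (a : ℕ) {M : Memory} (hj : j < B) (hl : l < B)
    (h0 : M.reg 0 = i) (h2 : M.reg 2 = j) (h4 : M.reg 4 = l) (h6 : M.reg 6 = p)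
    (h5 : M.reg 5 = v) (h44 : M.reg 44 = B) (hp : p = (i * B + j) * B + l) :
    HaltsIn (storeNext a) M 36 fun M' => (∀ y, 6 < y ∨ y = 3 → M'.reg y = M.reg y) ∧
      M'.arr = Function.update M.arr a (Function.update (M.arr a) p v) ∧
      ∃ i j l, M'.reg 0 = i ∧ M'.reg 2 = j ∧ M'.reg 4 = l ∧ M'.reg 6 = p + 1 ∧ j < B ∧ l < B ∧
        p + 1 = (i * B + j) * B + l := by
  have hgen : ∀ y, 6 < y ∨ y = 3 → y ≠ 0 ∧ y ≠ 2 ∧ y ≠ 4 ∧ y ≠ 6 := by omega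
  refine (HaltsIn.exec rfl ?_).mono (by simp [Prog.time, Expr.cost, storeNext]) fun _ h => h
  by_cases c1 : l + 1 < B
  · simp only [storeNext, Prog.exec, Expr.eval, Memory.setReg_reg, Memory.setArr_reg, h0, h2, h4, h6,
      h44, h5, reduceIte, Nat.reduceEqDiff, c1]
    refine ⟨fun y hy => ?_, ?_, i, j, l + 1, ?_, ?_, ?_, ?_, hj, c1, by rw [hp]; ring⟩
    · simp [Memory.setReg_reg, hgen y hy]
    · simp [Memory.setArr]
    · simp [Memory.setReg_reg, h0]
    · simp [Memory.setReg_reg, h2]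
    · simp [Memory.setReg_reg]
    · simp [Memory.setReg_reg]
  · have hl' : l + 1 = B := by omega
    by_cases c2 : j + 1 < B
    · simp only [storeNext, Prog.exec, Expr.eval, Memory.setReg_reg, Memory.setArr_reg, h0, h2, h4,
        h6, h44, h5, reduceIte, Nat.reduceEqDiff, c1, c2, ne_eq, not_true]
      refine ⟨fun y hy => ?_, ?_, i, j + 1, 0, ?_, ?_, ?_, ?_, c2, by omega, ?_⟩
      · simp [Memory.setReg_reg, hgen y hy]
      · simp [Memory.setArr]
      · simp [Memory.setReg_reg, h0]
      · simp [Memory.setReg_reg]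
      · simp [Memory.setReg_reg]
      · simp [Memory.setReg_reg]
      · rw [hp, ← hl']; ring
    · have hj' : j + 1 = B := by omega
      simp only [storeNext, Prog.exec, Expr.eval, Memory.setReg_reg, Memory.setArr_reg, h0, h2, h4,
        h6, h44, h5, reduceIte, Nat.reduceEqDiff, c1, c2, ne_eq, not_true]
      refine ⟨fun y hy => ?_, ?_, i + 1, 0, 0, ?_, ?_, ?_, ?_, by omega, by omega, ?_⟩
      · simp [hgen y hy]
      · simp [Memory.setArr]
      · simp
      · simp
      · simp
      · simp
      · rw [hp, add_assoc, hl', add_zero, add_zero, add_mul, add_mul i, one_mul, ← hj']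
        ring

/-- While the table is being filled only the array `a` changes, and `e` does not read it, so all
cells are computed from the original memory. The term is compiled at depth `2` to spare register
`3`, which counts the rounds of an enclosing `fix`. -/
theorem fillProg_spec {B : ℕ} {ρ : ℕ → ℕ} (hB : 1 ≤ B) (hρ : ρ 22 = B) {a : ℕ} {e : Term}
    (ha : a ∉ e.arrays) (M : Memory) (hM : VarsOk ρ M) :
    HaltsIn (fillProg a e) M (B * B * B * (e.cost B + 40) + 20) fun M' => VarsOk ρ M' ∧
      M'.reg 3 = M.reg 3 ∧ M'.arr = Function.update M.arr a fun x =>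
        if x < B * B * B then e.eval M.arr (cellEnv B ρ x) else M.arr a x := by
  let F : ℕ → ℕ → ℕ → ℕ := fun p => Function.update M.arr a fun x =>
        if x < p then e.eval M.arr (cellEnv B ρ x) else M.arr a x
  let I : ℕ → Memory → Prop := fun p M' => VarsOk ρ M' ∧ M'.reg 3 = M.reg 3 ∧ M'.arr = F p ∧
    ∃ i j l, M'.reg 0 = i ∧ M'.reg 2 = j ∧ M'.reg 4 = l ∧ M'.reg 6 = p ∧ j < B ∧ l < B ∧
      p = (i * B + j) * B + l
  refine HaltsIn.seq' (Q := I 0) 8 (B * B * B * (e.cost B + 40) + 4) (by omega)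
      (HaltsIn.exec rfl ?_ : HaltsIn _ _ 8 _) fun M₁ h₁ => ?_
  · refine ⟨fun x hx => ?_, ?_, ?_, 0, 0, 0, ?_, ?_, ?_, ?_, by omega, by omega, by simp⟩
    · simp [Prog.exec, Memory.setReg_reg, show x ≠ 0 by omega, show 2 * x ≠ 2 by omega,
        show 2 * x ≠ 4 by omega, show 2 * x ≠ 6 by omega, hM x hx]
    all_goals simp [Prog.exec, Memory.setReg_reg, Expr.eval, F]
  refine (HaltsIn.for (B * B * B) (e.cost B + 36) I h₁ ?_ ?_).mono
    (by
      have : e.cost B + 36 + (1 + 1 + 1) + 1 = e.cost B + 40 := by omega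
      simp only [Expr.cost, this]; omega) fun M' h => ⟨h.1, h.2.1, h.2.2.1⟩
  · rintro M' ⟨hV, h3, hA, i, j, l, h0, h2, h4, h6, hj, hl, hp⟩
    have h44 : M'.reg 44 = B := (hV 22 (by omega)).trans hρ
    have : ¬ i < B := by
      intro hi
      have h1 : i * B + j + 1 ≤ B * B := by nlinarith
      nlinarith
    simp [Expr.eval, h0, h44, this]
  · rintro p hpB M' ⟨hV, h3, hA, i, j, l, h0, h2, h4, h6, hj, hl, hp⟩
    have h44 : M'.reg 44 = B := (hV 22 (by omega)).trans hρ
    have hi : i < B := by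
      by_contra hi
      have h1 : B * B ≤ i * B + j := by nlinarith
      have h2 : B * B * B ≤ (i * B + j) * B := Nat.mul_le_mul_right _ h1
      omega
    refine ⟨by simp [Expr.eval, h0, h44, hi], ?_⟩
    refine HaltsIn.seq' (e.cost B) 36 le_rfl (e.compile_spec 2 M' B h44.le) fun M₂ ⟨hA₂, hv, hf⟩ => ?_
    have hev : e.eval M'.arr (fun x => M'.reg (2 * x)) = e.eval M.arr (cellEnv B ρ p) := by
      have henv : (fun x => M'.reg (2 * x)) = cellEnv B ρ p := by
        have hpB : p / B = i * B + j := by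
          rw [hp, mul_comm _ B, Nat.mul_add_div (by omega), Nat.div_eq_of_lt hl, add_zero]
        funext x
        unfold cellEnv
        split_ifs with c0 c1 c2 c3
        · rw [← Nat.div_div_eq_div_mul, hpB, mul_comm _ B, Nat.mul_add_div (by omega),
            Nat.div_eq_of_lt hj, c0, add_zero]; exact h0
        · rw [hpB, mul_comm _ B, Nat.mul_add_mod, Nat.mod_eq_of_lt hj, c1]; exact h2
        · rw [hp, mul_comm _ B, Nat.mul_add_mod, Nat.mod_eq_of_lt hl, c2]; exact h4
        · rw [c3]; exact h6
        · exact hV x (by omega)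
      rw [henv]
      refine e.eval_congr (fun b hb => ?_) _
      rw [hA]
      exact Function.update_of_ne (by rintro rfl; exact ha hb) _ _
    rw [hev] at hv
    have hr : ∀ y, y % 2 = 0 ∨ y < 4 → M₂.reg y = M'.reg y := hf
    have hv' : M₂.reg 5 = _ := hv
    have e0 := (hr 0 (by simp)).trans h0
    have e2 := (hr 2 (by simp)).trans h2
    have e3 := (hr 3 (by simp)).trans h3
    have e4 := (hr 4 (by simp)).trans h4
    have e6 := (hr 6 (by simp)).trans h6
    have e44 := (hr 44 (by simp)).trans h44
    have eV : VarsOk ρ M₂ := fun x hx => (hr _ (by simp)).trans (hV x hx)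
    have hF : Function.update (F p) a (Function.update (F p a) p (e.eval M.arr (cellEnv B ρ p))) =
        F (p + 1) := by
      simp only [F, Function.update_self, Function.update_idem]
      congr 1
      funext x
      simp only [Function.update_apply]
      rcases lt_trichotomy x p with h | rfl | h
      · simp [h.ne, h, show x < p + 1 by omega]
      · simp
      · simp [h.ne', show ¬ x < p by omega, show ¬ x < p + 1 by omega]
    refine (storeNext_spec a hj hl e0 e2 e4 e6 hv' e44 hp).mono le_rfl fun M₃ ⟨hr₃, hA₃, hx⟩ =>
      ⟨fun x hx => ?_, (hr₃ 3 (.inr rfl)).trans e3, by rw [hA₃, hA₂, hA, hF], hx⟩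
    rw [hr₃ _ (.inl (by omega)), eV x hx]

/-- A statement that computes a table: either directly by a term, or as the last of `B` iterates of
a term that refers to the table itself. -/
inductive Stmt where
  | fill (a : ℕ) (e : Term)
  | fix (a tmp : ℕ) (e : Term)

/-- The program for a statement. -/
def Stmt.prog : Stmt → Prog
  | fill a e => fillProg a e
  | fix a tmp e => .seq (.setReg 3 (.reg 44)) <| .loop (.reg 3) <|
      .seq (fillProg tmp e) <| .seq (fillProg a (.get tmp (.var 3))) <|
        .setReg 3 (.sub (.reg 3) (.const 1))

/-- The arrays written by a statement. -/
def Stmt.targets : Stmt → List ℕ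
  | fill a _ => [a]
  | fix a tmp _ => [a, tmp]

/-- The arrays used by a statement. -/
def Stmt.arrays : Stmt → List ℕ
  | fill a e => a :: e.arrays
  | fix a tmp e => a :: tmp :: e.arrays

/-- The statement does not read what it writes, except for the iterated table. -/
def Stmt.ok : Stmt → Bool
  | fill a e => a ∉ e.arrays
  | fix a tmp e => a ≠ tmp ∧ tmp ∉ e.arrays

/-- One round of the iteration of a term `e` for the table `a`. -/
def roundOf (B : ℕ) (ρ : ℕ → ℕ) (A : ℕ → ℕ → ℕ) (a : ℕ) (e : Term) (X : ℕ → ℕ) : ℕ → ℕ := fun x =>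
  if x < B * B * B then e.eval (Function.update A a X) (cellEnv B ρ x) else X x

/-- The table computed by a statement is as the statement says. -/
def Stmt.Holds (B : ℕ) (ρ : ℕ → ℕ) (A : ℕ → ℕ → ℕ) : Stmt → Prop
  | fill a e => ∀ x < B * B * B, A a x = e.eval A (cellEnv B ρ x)
  | fix a _ e => ∃ X, A a = (roundOf B ρ A a e)^[B] X

theorem roundOf_congr {B ρ A A' a e} (h : ∀ b ∈ e.arrays, b ≠ a → A b = A' b) :
    roundOf B ρ A a e = roundOf B ρ A' a e := by
  funext X x
  unfold roundOf
  split_ifs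
  · refine e.eval_congr (fun b hb => ?_) _
    by_cases hba : b = a
    · simp [hba]
    · simp [hba, h b hb hba]
  · rfl

theorem Stmt.Holds.congr {B ρ A A'} {s : Stmt} (h : s.Holds B ρ A)
    (hA : ∀ b ∈ s.arrays, A b = A' b) : s.Holds B ρ A' := by
  cases s with
  | fill a e =>
    intro x hx
    rw [← hA a (by simp [arrays]), h x hx]
    exact e.eval_congr (fun b hb => hA b (by simp [arrays, hb])) _
  | fix a tmp e =>
    obtain ⟨X, hX⟩ := h
    refine ⟨X, ?_⟩
    rw [← hA a (by simp [arrays]), hX,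
      roundOf_congr fun b hb _ => hA b (by simp [arrays, hb])]

/-- A bound on the running time of a statement. -/
def Stmt.cost (B : ℕ) : Stmt → ℕ
  | fill _ e => B * B * B * (e.cost B + 40) + 20
  | fix _ _ e => B * (B * B * B * (e.cost B + 90) + 60) + 10

theorem Stmt.polyBdd_cost (s : Stmt) : PolyBdd fun B => s.cost B := by
  have h3 := (PolyBdd.id.mul .id).mul .id
  cases s with
  | fill a e => exact (h3.mul (e.polyBdd_cost.add (.const 40))).add (.const 20)
  | fix a tmp e =>
    exact (PolyBdd.id.mul ((h3.mul (e.polyBdd_cost.add (.const 90))).add (.const 60))).add (.const 10)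

/-- In a `fix`, each round writes to the temporary array, so that all cells are computed from the
previous state of the table, and then copies back. This makes one round exactly `roundOf`. The
initial content of the table is irrelevant and stays existentially quantified in `Holds`. -/
theorem Stmt.prog_spec {B : ℕ} {ρ : ℕ → ℕ} (hB : 1 ≤ B) (hρ : ρ 22 = B) {s : Stmt}
    (hs : s.ok = true) (M : Memory) (hM : VarsOk ρ M) :
    HaltsIn s.prog M (s.cost B) fun M' => VarsOk ρ M' ∧ (∀ b ∉ s.targets, M'.arr b = M.arr b) ∧
      s.Holds B ρ M'.arr := by
  cases s with
  | fill a e =>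
    have ha : a ∉ e.arrays := by simpa [ok] using hs
    refine (fillProg_spec hB hρ ha M hM).mono le_rfl fun M' ⟨hV, _, hA⟩ => ⟨hV, fun b hb => ?_, ?_⟩
    · rw [hA, Function.update_of_ne (by simpa [targets] using hb)]
    · intro x hx
      have : e.eval M'.arr (cellEnv B ρ x) = e.eval M.arr (cellEnv B ρ x) :=
        e.eval_congr (fun b hb => by
          rw [hA, Function.update_of_ne (by rintro rfl; exact ha hb)]) _
      rw [this, hA]
      simp [hx]
  | fix a tmp e =>
    have hat : a ≠ tmp ∧ tmp ∉ e.arrays := by simpa [ok] using hs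
    let I : ℕ → Memory → Prop := fun i M' => VarsOk ρ M' ∧ M'.reg 3 = B - i ∧
      (∀ b ∉ [a, tmp], M'.arr b = M.arr b) ∧ M'.arr a = (roundOf B ρ M.arr a e)^[i] (M.arr a)
    refine HaltsIn.seq' (Q := I 0) 2 (B * (B * B * B * (e.cost B + 90) + 60) + 2)
      (by simp [Stmt.cost]; omega) (HaltsIn.exec (P := .setReg _ (.reg _)) rfl ?_ : HaltsIn _ _ 2 _) fun M₁ h₁ => ?_
    · refine ⟨fun x hx => ?_, ?_, ?_, ?_⟩
      · simp [Prog.exec, Memory.setReg_reg, hM x hx, show 2 * x ≠ 3 by omega]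
      · simpa [Prog.exec, Memory.setReg_reg, Expr.eval] using (hM 22 (by omega)).trans hρ
      · simp [Prog.exec]
      · simp [Prog.exec]
    refine (HaltsIn.for B (B * B * B * (e.cost B + 90) + 58) I h₁ ?_ ?_).mono
      (by simp [Expr.cost]) fun M' h => ⟨h.1, h.2.2.1, ?_⟩
    · rintro M' ⟨hV, h3, hA⟩
      simp [Expr.eval, h3]
    · rintro i hi M' ⟨hV, h3, hb, ha⟩
      refine ⟨by simp [Expr.eval, h3]; omega, ?_⟩
      refine HaltsIn.seq' _ (B * B * B * 50 + 38) (by nlinarith)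
        (fillProg_spec hB hρ hat.2 M' hV) fun M₂ ⟨hV₂, h3₂, hA₂⟩ => ?_
      -- Copying is another fill, since variable `3` is the number of the cell being computed.
      refine HaltsIn.seq' _ 4 (by simp [Term.cost]; omega)
        (fillProg_spec hB hρ (a := a) (e := .get tmp (.var 3)) (by simpa [Term.arrays] using hat.1)
          M₂ hV₂) fun M₃ ⟨hV₃, h3₃, hA₃⟩ => ?_
      refine (HaltsIn.exec rfl ?_ : HaltsIn (.setReg 3 (.sub (.reg 3) (.const 1))) _ 4 _)
      refine ⟨fun x hx => ?_, ?_, fun b hb' => ?_, ?_⟩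
      · simp [Prog.exec, Memory.setReg_reg, hV₃ x hx, show 2 * x ≠ 3 by omega]
      · simp [Prog.exec, Memory.setReg_reg, Expr.eval, h3₃, h3₂, h3]; omega
      · have hb'' : b ≠ a ∧ b ≠ tmp := by simpa using hb'
        simp [Prog.exec, hA₃, hA₂, hb'', hb b hb']
      · rw [Function.iterate_succ_apply', ← ha]
        have hr : roundOf B ρ M.arr a e = roundOf B ρ M'.arr a e :=
          roundOf_congr fun b hbe hba => (hb b (by
            simp only [List.mem_cons, List.not_mem_nil, or_false, not_or]
            exact ⟨hba, by rintro rfl; exact hat.2 hbe⟩)).symm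
        rw [hr]
        funext x
        simp only [Prog.exec, Memory.setReg_arr, hA₃, Function.update_self, roundOf]
        split_ifs with hx
        · simp only [Term.eval, cellEnv, hA₂]
          simp [hx, Function.update_eq_self]
        · simp [hA₂, hat.1]
    · refine ⟨M.arr a, ?_⟩
      rw [h.2.2.2]
      congr 1
      exact roundOf_congr fun b hbe hba => (h.2.2.1 b (by
            simp only [List.mem_cons, List.not_mem_nil, or_false, not_or]
            exact ⟨hba, by rintro rfl; exact hat.2 hbe⟩)).symm

/-- The program for a list of statements. -/
def stmtsProg : List Stmt → Prog
  | [] => .skip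
  | s :: L => .seq s.prog (stmtsProg L)

/-- A bound on the running time of a list of statements. -/
def stmtsCost (B : ℕ) : List Stmt → ℕ
  | [] => 1
  | s :: L => s.cost B + stmtsCost B L

/-- No statement writes into arrays used before (or listed in `W`). -/
def stmtsOk : List ℕ → List Stmt → Bool
  | _, [] => true
  | W, s :: L => s.ok && s.targets.all (· ∉ W) && stmtsOk (s.arrays ++ W) L

theorem polyBdd_stmtsCost (L : List Stmt) : PolyBdd fun B => stmtsCost B L := by
  induction L with
  | nil => exact .const 1
  | cons s L ih => exact s.polyBdd_cost.add ih

/-- `W` collects all arrays used so far. As no later statement writes to them, what a statement has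
established survives, and all statements hold simultaneously of the final memory. -/
theorem stmtsProg_spec {B : ℕ} {ρ : ℕ → ℕ} (hB : 1 ≤ B) (hρ : ρ 22 = B) (L : List Stmt) :
    ∀ (W : List ℕ), stmtsOk W L = true → ∀ M, VarsOk ρ M →
    HaltsIn (stmtsProg L) M (stmtsCost B L) fun M' => (∀ b ∈ W, M'.arr b = M.arr b) ∧
      ∀ s ∈ L, s.Holds B ρ M'.arr := by
  induction L with
  | nil => exact fun W _ M _ => (HaltsIn.exec rfl (by simp [Prog.exec]) : HaltsIn .skip M 1 _)
  | cons s L ih =>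
    intro W h M hM
    simp only [stmtsOk, Bool.and_eq_true, List.all_eq_true, decide_eq_true_eq] at h
    obtain ⟨⟨hs, hW⟩, hL⟩ := h
    refine (s.prog_spec hB hρ hs M hM).seq fun M₁ ⟨hV, ht, hh⟩ => ?_
    refine (ih _ hL M₁ hV).mono le_rfl fun M₂ ⟨h₂, hh₂⟩ => ⟨fun b hb => ?_, fun s' hs' => ?_⟩
    · rw [h₂ b (by simp [hb]), ht b fun hb' => hW b hb' hb]
    · rcases List.mem_cons.1 hs' with rfl | hs'
      · exact hh.congr fun b hb => (h₂ b (by simp [hb])).symm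
      · exact hh₂ s' hs'

end RAM

/-! ## Derivation trees, abstractly -/

/-- Under a locality condition, iterates become stationary, whatever they start from. -/
theorem iterate_stable {α : Type*} {step : (ℕ → α) → ℕ → α} {dp : ℕ → ℕ} {V : ℕ → Prop}
    (hloc : ∀ g, V g → ∀ f f' : ℕ → α, (∀ g', V g' → dp g' < dp g → f g' = f' g') →
      step f g = step f' g) :
    ∀ (k k' : ℕ) (f f' : ℕ → α) (g : ℕ), V g → dp g < k → dp g < k' →
      step^[k] f g = step^[k'] f' g := by
  intro k
  induction k with
  | zero => intro k' f f' g _ h; omega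
  | succ k ih =>
    intro k' f f' g hg hk hk'
    obtain ⟨m, rfl⟩ : ∃ m, k' = m + 1 := ⟨k' - 1, by omega⟩
    rw [Function.iterate_succ_apply', Function.iterate_succ_apply']
    exact hloc g hg _ _ fun g' hg' hlt => ih m f f' g' hg' (by omega) (by omega)

/-- Numbered graphs `0, …, last` with their nodes `1, …, nn g` (external if `xt g v ≠ 0`) and
nonterminal edges `0, …, ns g - 1`.  The edge `s` of `g` is to be replaced by the graph `ch g s`;
`up g s x` is the node of `g` that is identified with the external node `x` of `ch g s`, and `dn g s`
is the inverse of `up g s`, with value zero outside its domain.  The number of terminal edges from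
`u` to `v` is `tt g u v`. -/
structure RuleSystem where
  last : ℕ
  bound : ℕ
  nn : ℕ → ℕ
  ns : ℕ → ℕ
  ch : ℕ → ℕ → ℕ
  xt : ℕ → ℕ → ℕ
  up : ℕ → ℕ → ℕ → ℕ
  dn : ℕ → ℕ → ℕ → ℕ
  tt : ℕ → ℕ → ℕ → ℕ
  dp : ℕ → ℕ

namespace RuleSystem

variable (S : RuleSystem)

/-- `v` is a node of the graph `g`. -/
def IsNode (g v : ℕ) : Prop := 1 ≤ v ∧ v ≤ S.nn g

/-- `v` is an internal node of the graph `g`. -/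
def IsInt (g v : ℕ) : Prop := (1 ≤ v ∧ v ≤ S.nn g) ∧ S.xt g v = 0

instance (g v : ℕ) : Decidable (S.IsInt g v) := by unfold IsInt; infer_instance

/-- The conditions on a rule system. -/
structure WF : Prop where
  nn_lt : ∀ g ≤ S.last, S.nn g < S.bound
  ns_le : ∀ g ≤ S.last, S.ns g ≤ S.bound
  dp_lt_bound : ∀ g ≤ S.last, S.dp g < S.bound
  ch_le : ∀ g ≤ S.last, ∀ s < S.ns g, S.ch g s ≤ S.last
  dp_lt : ∀ g ≤ S.last, ∀ s < S.ns g, S.dp (S.ch g s) < S.dp g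
  node_of_xt : ∀ g ≤ S.last, ∀ x, S.xt g x ≠ 0 → S.IsNode g x
  xt_zero : ∀ x, S.xt 0 x = 0
  node_up : ∀ g ≤ S.last, ∀ s < S.ns g, ∀ x, S.xt (S.ch g s) x ≠ 0 → S.IsNode g (S.up g s x)
  dn_up : ∀ g ≤ S.last, ∀ s < S.ns g, ∀ x, S.xt (S.ch g s) x ≠ 0 → S.dn g s (S.up g s x) = x
  xt_dn : ∀ g ≤ S.last, ∀ s < S.ns g, ∀ v, S.dn g s v ≠ 0 → S.xt (S.ch g s) (S.dn g s v) ≠ 0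
  up_dn : ∀ g ≤ S.last, ∀ s < S.ns g, ∀ v, S.dn g s v ≠ 0 → S.up g s (S.dn g s v) = v
  node_of_tt : ∀ g ≤ S.last, ∀ u v, S.tt g u v ≠ 0 → S.IsNode g u ∧ S.IsNode g v

/-- The number of internal nodes up to `v`. -/
def ix (g v : ℕ) : ℕ :=
  ∑ u ∈ Finset.range S.bound, if (1 ≤ u ∧ u ≤ v) ∧ S.xt g u = 0 then 1 else 0

/-- The number of internal nodes. -/
def ic (g : ℕ) : ℕ := S.ix g (S.nn g)

/-- The `x`-th internal node. -/
def inode (g x : ℕ) : ℕ :=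
  ∑ v ∈ Finset.range S.bound, if S.IsInt g v ∧ S.ix g v = x then v else 0

/-- The recursive equation for `sz`. -/
def szStep (f : ℕ → ℕ) (g : ℕ) : ℕ := S.ic g + ∑ s ∈ Finset.range (S.ns g), f (S.ch g s)

/-- The number of nodes that are created by deriving from the graph `g`. -/
def sz : ℕ → ℕ := S.szStep^[S.bound] fun _ => 0

/-- The number of nodes created by deriving from `g` before the nonterminal edge `s` is derived. -/
def pre (g s : ℕ) : ℕ := S.ic g + ∑ i ∈ Finset.range s, S.sz (S.ch g i)

/-- The recursive equation for `cn`. -/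
def cnStep (f : ℕ → ℕ → ℕ → ℕ) (g u v : ℕ) : ℕ :=
  S.tt g u v + ∑ s ∈ Finset.range (S.ns g),
    if S.dn g s u ≠ 0 ∧ S.dn g s v ≠ 0 then f (S.ch g s) (S.dn g s u) (S.dn g s v) else 0

/-- The number of edges from `u` to `v` that are created by deriving from `g`. -/
def cn : ℕ → ℕ → ℕ → ℕ := S.cnStep^[S.bound] fun _ _ _ => 0

/-- The internal nodes of `g` from which an edge leads to `v` after deriving from `g`. -/
def intNbrs (g v : ℕ) : List ℕ :=
  (List.range S.bound).filter fun u => S.IsInt g u ∧ S.cn g u v ≠ 0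

/-- The external nodes of `g` from which an edge leads to `v` after deriving from `g`. -/
def extNbrs (g v : ℕ) : List ℕ :=
  (List.range S.bound).filter fun u => S.xt g u ≠ 0 ∧ S.cn g u v ≠ 0

/-- The recursive equation for `ne`. -/
def neStep (f : ℕ → ℕ → ℕ) (g v : ℕ) : ℕ :=
  (S.intNbrs g v).length + ∑ s ∈ Finset.range (S.ns g),
    if S.dn g s v ≠ 0 then f (S.ch g s) (S.dn g s v) else 0

/-- The number of nodes created by deriving from `g` from which an edge leads to `v`. -/
def ne : ℕ → ℕ → ℕ := S.neStep^[S.bound] fun _ _ => 0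

/-- The nonterminal edges of `g` whose derivation creates nodes from which an edge leads to `v`. -/
def branches (g v : ℕ) : List ℕ :=
  (List.range S.bound).filter fun s =>
    s < S.ns g ∧ S.dn g s v ≠ 0 ∧ S.ne (S.ch g s) (S.dn g s v) ≠ 0

/-- The recursive equation for `out`. -/
def outStep (f : ℕ → ℕ → ℕ → List ℕ) (g v n : ℕ) : List ℕ :=
  (S.intNbrs g v).map (fun u => n + S.ix g u) ++
    (S.branches g v).flatMap fun s => f (S.ch g s) (S.dn g s v) (n + S.pre g s)

/-- The numbers of the nodes that are created by deriving from `g`, starting with number `n + 1`, and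
from which an edge leads to `v`. -/
def out : ℕ → ℕ → ℕ → List ℕ := S.outStep^[S.bound] fun _ _ _ => []

variable {S} (h : S.WF)
include h

/-- The recursive quantities are defined as iterates numbered `bound`. Since `dp g` is below
`bound`, one more round changes nothing, which turns the definition into the recursive equation. The
same argument gives `cn_eq`, `ne_eq'`, `out_eq` and `created_eq`. -/
theorem sz_eq {g : ℕ} (hg : g ≤ S.last) :
    S.sz g = S.ic g + ∑ s ∈ Finset.range (S.ns g), S.sz (S.ch g s) := by
  have hd := h.dp_lt_bound g hg
  refine (iterate_stable (V := fun g => g ≤ S.last) (dp := S.dp) (step := S.szStep)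
    (fun g hg f f' hff => ?_) S.bound (S.bound + 1) _ (fun _ => 0) g hg hd (by omega)).trans ?_
  · unfold szStep
    congr 1
    refine Finset.sum_congr rfl fun s hs => ?_
    have hs := Finset.mem_range.1 hs
    exact hff _ (h.ch_le g hg s hs) (h.dp_lt g hg s hs)
  · rw [Function.iterate_succ_apply']
    rfl

theorem cn_eq {g : ℕ} (hg : g ≤ S.last) (u v : ℕ) :
    S.cn g u v = S.tt g u v + ∑ s ∈ Finset.range (S.ns g),
      if S.dn g s u ≠ 0 ∧ S.dn g s v ≠ 0 then S.cn (S.ch g s) (S.dn g s u) (S.dn g s v) else 0 := by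
  have hd := h.dp_lt_bound g hg
  refine (congrFun₂ (iterate_stable (V := fun g => g ≤ S.last) (dp := S.dp) (step := S.cnStep)
    (fun g hg f f' hff => ?_) S.bound (S.bound + 1) _ (fun _ _ _ => 0) g hg hd (by omega)) u v).trans ?_
  · funext u v
    unfold cnStep
    congr 1
    refine Finset.sum_congr rfl fun s hs => ?_
    have hs := Finset.mem_range.1 hs
    rw [hff _ (h.ch_le g hg s hs) (h.dp_lt g hg s hs)]
  · rw [Function.iterate_succ_apply']
    rfl

theorem ne_eq' {g : ℕ} (hg : g ≤ S.last) (v : ℕ) :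
    S.ne g v = (S.intNbrs g v).length + ∑ s ∈ Finset.range (S.ns g),
      if S.dn g s v ≠ 0 then S.ne (S.ch g s) (S.dn g s v) else 0 := by
  have hd := h.dp_lt_bound g hg
  refine (congrFun (iterate_stable (V := fun g => g ≤ S.last) (dp := S.dp) (step := S.neStep)
    (fun g hg f f' hff => ?_) S.bound (S.bound + 1) _ (fun _ _ => 0) g hg hd (by omega)) v).trans ?_
  · funext v
    unfold neStep
    congr 1
    refine Finset.sum_congr rfl fun s hs => ?_
    have hs := Finset.mem_range.1 hs
    rw [hff _ (h.ch_le g hg s hs) (h.dp_lt g hg s hs)]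
  · rw [Function.iterate_succ_apply']
    rfl

omit h in
theorem mem_branches {g v s : ℕ} : s ∈ S.branches g v ↔ s < S.bound ∧
    s < S.ns g ∧ S.dn g s v ≠ 0 ∧ S.ne (S.ch g s) (S.dn g s v) ≠ 0 := by
  simp [branches]

theorem out_eq {g : ℕ} (hg : g ≤ S.last) (v n : ℕ) :
    S.out g v n = (S.intNbrs g v).map (fun u => n + S.ix g u) ++
      (S.branches g v).flatMap fun s => S.out (S.ch g s) (S.dn g s v) (n + S.pre g s) := by
  have hd := h.dp_lt_bound g hg
  refine (congrFun₂ (iterate_stable (V := fun g => g ≤ S.last) (dp := S.dp) (step := S.outStep)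
    (fun g hg f f' hff => ?_) S.bound (S.bound + 1) _ (fun _ _ _ => []) g hg hd (by omega)) v n).trans ?_
  · funext v n
    unfold outStep
    congr 1
    refine List.flatMap_congr fun s hs => ?_
    have hs := (mem_branches.1 hs).2.1
    rw [hff _ (h.ch_le g hg s hs) (h.dp_lt g hg s hs)]
  · rw [Function.iterate_succ_apply']
    rfl

/-! ### Internal nodes -/

omit h in
theorem ix_mono (g : ℕ) : Monotone (S.ix g) := by
  intro a b hab
  refine Finset.sum_le_sum fun u _ => ?_
  split_ifs <;> omega

theorem ix_lt {g : ℕ} (hg : g ≤ S.last) {a b : ℕ} (hab : a < b) (hb : S.IsInt g b) :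
    S.ix g a < S.ix g b := by
  refine Finset.sum_lt_sum (fun u _ => ?_) ⟨b, ?_, ?_⟩
  · split_ifs <;> omega
  · have := h.nn_lt g hg; exact Finset.mem_range.2 (by have := hb.1.2; omega)
  · rw [if_neg (by omega), if_pos ⟨⟨hb.1.1, le_rfl⟩, hb.2⟩]; omega

omit h in
theorem ix_zero (g : ℕ) : S.ix g 0 = 0 :=
  Finset.sum_eq_zero fun u _ => if_neg (by omega)

theorem one_le_ix {g v : ℕ} (hg : g ≤ S.last) (hv : S.IsInt g v) : 1 ≤ S.ix g v := by
  have := ix_lt h hg (a := 0) hv.1.1 hv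
  omega

omit h in
theorem ix_le_ic {g v : ℕ} (hv : S.IsInt g v) : S.ix g v ≤ S.ic g := ix_mono g hv.1.2

theorem ix_inj {g a b : ℕ} (hg : g ≤ S.last) (ha : S.IsInt g a) (hb : S.IsInt g b)
    (hab : S.ix g a = S.ix g b) : a = b := by
  rcases lt_trichotomy a b with hlt | he | hlt
  · have := ix_lt h hg hlt hb; omega
  · exact he
  · have := ix_lt h hg hlt ha; omega

theorem inode_ix {g v : ℕ} (hg : g ≤ S.last) (hv : S.IsInt g v) : S.inode g (S.ix g v) = v := by
  unfold inode
  rw [Finset.sum_eq_single v]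
  · simp [hv]
  · intro u _ hu
    exact if_neg fun hh => hu (ix_inj h hg hh.1 hv hh.2)
  · intro hn
    have := h.nn_lt g hg
    exact absurd (Finset.mem_range.2 (by have := hv.1.2; omega)) hn

omit h in
theorem ix_succ {g v : ℕ} (hv : v + 1 < S.bound) :
    S.ix g (v + 1) = S.ix g v + if S.xt g (v + 1) = 0 then 1 else 0 := by
  have key : ∀ u, (if (1 ≤ u ∧ u ≤ v + 1) ∧ S.xt g u = 0 then 1 else 0) =
      (if (1 ≤ u ∧ u ≤ v) ∧ S.xt g u = 0 then 1 else 0) +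
        if u = v + 1 then (if S.xt g (v + 1) = 0 then 1 else 0) else 0 := by
    intro u
    by_cases hu : u = v + 1
    · simp [hu]
    · have : u ≤ v + 1 ↔ u ≤ v := by omega
      simp [hu, this]
  unfold ix
  rw [Finset.sum_congr rfl fun u _ => key u, Finset.sum_add_distrib,
    Finset.sum_ite_eq' (Finset.range S.bound), if_pos (Finset.mem_range.2 hv)]

/-- Discrete intermediate values: `ix g` starts at zero and grows by at most one per node, precisely
at internal nodes. -/
theorem exists_ix_eq {g x : ℕ} (hg : g ≤ S.last) (h1 : 1 ≤ x) (hx : x ≤ S.ic g) :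
    ∃ v, S.IsInt g v ∧ S.ix g v = x := by
  suffices ∀ m ≤ S.nn g, x ≤ S.ix g m → ∃ v, S.IsInt g v ∧ S.ix g v = x from
    this _ le_rfl hx
  intro m
  induction m with
  | zero => intro _ hx; rw [ix_zero] at hx; omega
  | succ m ih =>
    intro hm hx
    by_cases hx' : x ≤ S.ix g m
    · exact ih (by omega) hx'
    · have := h.nn_lt g hg
      rw [ix_succ (by omega)] at hx
      have h0 : S.xt g (m + 1) = 0 := by
        by_contra h0
        rw [if_neg h0] at hx
        omega
      refine ⟨m + 1, ⟨⟨by omega, hm⟩, h0⟩, ?_⟩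
      rw [ix_succ (by omega)]
      rw [if_pos h0] at hx ⊢
      omega

theorem inode_spec {g x : ℕ} (hg : g ≤ S.last) (h1 : 1 ≤ x) (hx : x ≤ S.ic g) :
    S.IsInt g (S.inode g x) ∧ S.ix g (S.inode g x) = x := by
  obtain ⟨v, hv, rfl⟩ := exists_ix_eq h hg h1 hx
  rw [inode_ix h hg hv]
  exact ⟨hv, rfl⟩

/-! ### Sizes -/

omit h in
theorem pre_succ (g s : ℕ) : S.pre g (s + 1) = S.pre g s + S.sz (S.ch g s) := by
  simp [pre, Finset.sum_range_succ, add_assoc]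

omit h in
theorem pre_mono (g : ℕ) : Monotone (S.pre g) :=
  monotone_nat_of_le_succ fun s => by rw [pre_succ]; omega

omit h in
theorem pre_zero (g : ℕ) : S.pre g 0 = S.ic g := by simp [pre]

omit h in
theorem ic_le_pre (g s : ℕ) : S.ic g ≤ S.pre g s := by simp [pre]

theorem pre_ns {g : ℕ} (hg : g ≤ S.last) : S.pre g (S.ns g) = S.sz g := (sz_eq h hg).symm

/-- The intervals from `pre g s` to `pre g (s + 1)` belonging to the nonterminal edges are
consecutive and end at `sz g`. That they do not overlap decides, from its number alone, in which
subderivation a node was created. -/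
theorem pre_add_le {g s : ℕ} (hg : g ≤ S.last) (hs : s < S.ns g) :
    S.pre g s + S.sz (S.ch g s) ≤ S.sz g := by
  rw [← pre_succ, ← pre_ns h hg]
  exact pre_mono g hs

theorem ic_le_sz {g : ℕ} (hg : g ≤ S.last) : S.ic g ≤ S.sz g := by
  rw [sz_eq h hg]; omega

/-! ### Edges -/

variable (S) in
omit h in
/-- The numbering of the nodes of `ch g s`, if those of `g` are numbered by `ρ` and `n` is the number
of nodes created before those of `g`. -/
def childMap (g s : ℕ) (ρ : ℕ → ℕ) (n : ℕ) (x : ℕ) : ℕ :=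
  if S.xt (S.ch g s) x ≠ 0 then ρ (S.up g s x) else n + S.pre g s + S.ix (S.ch g s) x

variable (S) in
omit h in
/-- Deriving from `g`, with the nodes of `g` numbered by `ρ` and `n` nodes created before, creates an
edge from node `x` to node `y`. -/
inductive Edge : ℕ → (ℕ → ℕ) → ℕ → ℕ → ℕ → Prop
  | ter {g ρ n u v} : S.tt g u v ≠ 0 → Edge g ρ n (ρ u) (ρ v)
  | sub {g ρ n s x y} : s < S.ns g →
      Edge (S.ch g s) (S.childMap g s ρ n) (n + S.pre g s) x y → Edge g ρ n x y

omit h in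
theorem edge_iff {g ρ n x y} : S.Edge g ρ n x y ↔
    (∃ u v, S.tt g u v ≠ 0 ∧ x = ρ u ∧ y = ρ v) ∨
      ∃ s < S.ns g, S.Edge (S.ch g s) (S.childMap g s ρ n) (n + S.pre g s) x y := by
  constructor
  · rintro (⟨ht⟩ | ⟨hs, he⟩)
    · exact .inl ⟨_, _, ht, rfl, rfl⟩
    · exact .inr ⟨_, hs, he⟩
  · rintro (⟨u, v, ht, rfl, rfl⟩ | ⟨s, hs, he⟩)
    · exact .ter ht
    · exact .sub hs he

variable (S) in
omit h in
/-- `ρ` is a numbering of the nodes of `g` as it occurs in a derivation in which `n` nodes were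
created before those of `g`. -/
structure Numbering (g : ℕ) (ρ : ℕ → ℕ) (n : ℕ) : Prop where
  inj : ∀ u v, S.IsNode g u → S.IsNode g v → ρ u = ρ v → u = v
  ext_le : ∀ x, S.xt g x ≠ 0 → ρ x ≤ n
  int_eq : ∀ x, S.IsInt g x → ρ x = n + S.ix g x

omit h in
theorem Numbering.le {g ρ n} (hρ : S.Numbering g ρ n) {v} (hv : S.IsNode g v) :
    ρ v ≤ n + S.ic g := by
  by_cases h0 : S.xt g v = 0
  · rw [hρ.int_eq v ⟨hv, h0⟩]
    have := ix_le_ic ⟨hv, h0⟩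
    omega
  · have := hρ.ext_le v h0
    omega

/-- External nodes of the child inherit numbers of nodes of `g`, which are at most `n + pre g s`;
internal ones receive larger numbers, so the two kinds cannot collide. Among external nodes
injectivity comes from that of `up`, which has the left inverse `dn`. -/
theorem Numbering.child {g ρ n s} (hg : g ≤ S.last) (hs : s < S.ns g) (hρ : S.Numbering g ρ n) :
    S.Numbering (S.ch g s) (S.childMap g s ρ n) (n + S.pre g s) := by
  have hc := h.ch_le g hg s hs
  have hext : ∀ x, S.xt (S.ch g s) x ≠ 0 → S.childMap g s ρ n x ≤ n + S.pre g s := by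
    intro x hx
    rw [childMap, if_pos hx]
    have := Numbering.le hρ (h.node_up g hg s hs x hx)
    have := S.ic_le_pre g s
    omega
  have hint : ∀ x, S.IsInt (S.ch g s) x →
      S.childMap g s ρ n x = n + S.pre g s + S.ix (S.ch g s) x := by
    intro x hx
    rw [childMap, if_neg (not_not.2 hx.2)]
  refine ⟨fun u v hu hv huv => ?_, hext, hint⟩
  by_cases hu0 : S.xt (S.ch g s) u = 0 <;> by_cases hv0 : S.xt (S.ch g s) v = 0
  · rw [hint u ⟨hu, hu0⟩, hint v ⟨hv, hv0⟩] at huv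
    exact ix_inj h hc ⟨hu, hu0⟩ ⟨hv, hv0⟩ (by omega)
  · have := one_le_ix h hc ⟨hu, hu0⟩
    have := hext v hv0
    rw [hint u ⟨hu, hu0⟩] at huv
    omega
  · have := one_le_ix h hc ⟨hv, hv0⟩
    have := hext u hu0
    rw [hint v ⟨hv, hv0⟩] at huv
    omega
  · rw [childMap, if_pos hu0, childMap, if_pos hv0] at huv
    have := hρ.inj _ _ (h.node_up g hg s hs u hu0) (h.node_up g hg s hs v hv0) huv
    rw [← h.dn_up g hg s hs u hu0, this, h.dn_up g hg s hs v hv0]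

theorem Numbering.range {g ρ n} (hg : g ≤ S.last) (hρ : S.Numbering g ρ n) {v}
    (hv : S.IsNode g v) :
    (n < ρ v ∧ ρ v ≤ n + S.sz g) ∨ ∃ u, S.xt g u ≠ 0 ∧ ρ v = ρ u := by
  by_cases h0 : S.xt g v = 0
  · left
    rw [hρ.int_eq v ⟨hv, h0⟩]
    have := ix_le_ic ⟨hv, h0⟩
    have := one_le_ix h hg ⟨hv, h0⟩
    have := ic_le_sz h hg
    omega
  · exact .inr ⟨v, h0, rfl⟩

/-- A subderivation knows old nodes only through its external nodes. In the induction, an external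
node of the child is a node of `g`, hence itself either created here or external to `g`. -/
theorem Edge.range {g ρ n x y} (he : S.Edge g ρ n x y) (hg : g ≤ S.last)
    (hρ : S.Numbering g ρ n) :
    ((n < x ∧ x ≤ n + S.sz g) ∨ ∃ u, S.xt g u ≠ 0 ∧ x = ρ u) ∧
      ((n < y ∧ y ≤ n + S.sz g) ∨ ∃ u, S.xt g u ≠ 0 ∧ y = ρ u) := by
  induction he with
  | ter ht =>
    obtain ⟨hu, hv⟩ := h.node_of_tt _ hg _ _ ht
    exact ⟨hρ.range h hg hu, hρ.range h hg hv⟩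
  | @sub g ρ n s x y hs he ih =>
    have key : ∀ z, ((n + S.pre g s < z ∧ z ≤ n + S.pre g s + S.sz (S.ch g s)) ∨
        ∃ u, S.xt (S.ch g s) u ≠ 0 ∧ z = S.childMap g s ρ n u) →
        ((n < z ∧ z ≤ n + S.sz g) ∨ ∃ u, S.xt g u ≠ 0 ∧ z = ρ u) := by
      rintro z (hz | ⟨u, hu, rfl⟩)
      · have := pre_add_le h hg hs
        exact .inl (by omega)
      · rw [childMap, if_pos hu]
        exact hρ.range h hg (h.node_up g hg s hs u hu)
    obtain ⟨hx, hy⟩ := ih (h.ch_le g hg s hs) (hρ.child h hg hs)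
    exact ⟨key x hx, key y hy⟩

/-- A node of `g` that occurs in the graph derived from the nonterminal edge `s` is attached to it. -/
theorem Numbering.eq_up {g ρ n s u} (hg : g ≤ S.last) (hs : s < S.ns g) (hρ : S.Numbering g ρ n)
    (hu : S.IsNode g u)
    (hr : (n + S.pre g s < ρ u ∧ ρ u ≤ n + S.pre g s + S.sz (S.ch g s)) ∨
      ∃ x, S.xt (S.ch g s) x ≠ 0 ∧ ρ u = S.childMap g s ρ n x) :
    S.dn g s u ≠ 0 := by
  rcases hr with hr | ⟨x, hx, he⟩
  · have := hρ.le hu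
    have := S.ic_le_pre g s
    omega
  · rw [childMap, if_pos hx] at he
    rw [hρ.inj _ _ hu (h.node_up g hg s hs x hx) he, h.dn_up g hg s hs x hx]
    have := (h.node_of_xt _ (h.ch_le g hg s hs) x hx).1
    omega

theorem childMap_dn {g ρ n s u} (hg : g ≤ S.last) (hs : s < S.ns g) (hu : S.dn g s u ≠ 0) :
    S.childMap g s ρ n (S.dn g s u) = ρ u := by
  rw [childMap, if_pos (h.xt_dn g hg s hs u hu), h.up_dn g hg s hs u hu]

/-- An edge between two nodes of `g` is a terminal edge of `g` or comes from below a nonterminal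
edge. In the second case both nodes occur in that subderivation without being created there, so both
are attached to the edge, which is the condition under which `cn` recurses. -/
theorem edge_nodes_iff {g ρ n u v} (hg : g ≤ S.last) (hρ : S.Numbering g ρ n) (hu : S.IsNode g u)
    (hv : S.IsNode g v) : S.Edge g ρ n (ρ u) (ρ v) ↔ S.cn g u v ≠ 0 := by
  induction hd : S.dp g using Nat.strong_induction_on generalizing g ρ n u v with
  | _ d ih =>
    have ih' : ∀ s < S.ns g, S.dn g s u ≠ 0 → S.dn g s v ≠ 0 →
        (S.Edge (S.ch g s) (S.childMap g s ρ n) (n + S.pre g s) (ρ u) (ρ v) ↔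
          S.cn (S.ch g s) (S.dn g s u) (S.dn g s v) ≠ 0) := by
      intro s hs hdu hdv
      have hc := h.ch_le g hg s hs
      rw [← ih _ (hd ▸ h.dp_lt g hg s hs) hc (hρ.child h hg hs)
        (h.node_of_xt _ hc _ (h.xt_dn g hg s hs u hdu))
        (h.node_of_xt _ hc _ (h.xt_dn g hg s hs v hdv)) rfl, childMap_dn h hg hs hdu,
        childMap_dn h hg hs hdv]
    rw [edge_iff, cn_eq h hg]
    constructor
    · rintro (⟨u', v', ht, hu', hv'⟩ | ⟨s, hs, he⟩)
      · obtain ⟨nu, nv⟩ := h.node_of_tt g hg _ _ ht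
        rw [hρ.inj _ _ hu nu hu', hρ.inj _ _ hv nv hv']
        omega
      · obtain ⟨hx, hy⟩ := he.range h (h.ch_le g hg s hs) (hρ.child h hg hs)
        have hdu := hρ.eq_up h hg hs hu hx
        have hdv := hρ.eq_up h hg hs hv hy
        have h0 := (ih' s hs hdu hdv).1 he
        have := Finset.single_le_sum (f := fun s => if S.dn g s u ≠ 0 ∧ S.dn g s v ≠ 0 then
          S.cn (S.ch g s) (S.dn g s u) (S.dn g s v) else 0) (fun _ _ => Nat.zero_le _)
          (Finset.mem_range.2 hs)
        beta_reduce at this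
        rw [if_pos ⟨hdu, hdv⟩] at this
        omega
    · intro h0
      by_cases ht : S.tt g u v = 0
      · rw [ht, zero_add] at h0
        obtain ⟨s, hs, h1⟩ := Finset.exists_ne_zero_of_sum_ne_zero h0
        have hs := Finset.mem_range.1 hs
        split_ifs at h1 with hdd
        · exact .inr ⟨s, hs, (ih' s hs hdd.1 hdd.2).2 h1⟩
        · exact absurd rfl h1
      · exact .inl ⟨u, v, ht, rfl, rfl⟩

/-- `out` enters only `branches`, whereas `ne` sums over all nonterminal edges attached to `v`; the
edges left out contribute zero. -/
theorem length_out {g : ℕ} (hg : g ≤ S.last) (v n : ℕ) : (S.out g v n).length = S.ne g v := by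
  induction hd : S.dp g using Nat.strong_induction_on generalizing g v n with
  | _ d ih =>
    rw [out_eq h hg, ne_eq' h hg, List.length_append, List.length_map, List.length_flatMap]
    congr 1
    have e1 : (S.branches g v).map (fun s => (S.out (S.ch g s) (S.dn g s v) (n + S.pre g s)).length) =
        (S.branches g v).map (fun s => S.ne (S.ch g s) (S.dn g s v)) := by
      refine List.map_congr_left fun s hs => ?_
      have hs := (mem_branches.1 hs).2.1
      exact ih _ (hd ▸ h.dp_lt g hg s hs) (h.ch_le g hg s hs) _ _ rfl
    rw [e1, branches, ← List.sum_toFinset _ (List.nodup_range.filter _)]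
    rw [List.toFinset_filter, Finset.sum_filter]
    have hns := h.ns_le g hg
    rw [show (List.range S.bound).toFinset = Finset.range S.bound by ext; simp]
    rw [← Finset.sum_subset (Finset.range_mono hns)]
    · refine Finset.sum_congr rfl fun s hs => ?_
      have hs := Finset.mem_range.1 hs
      by_cases h1 : S.dn g s v = 0 <;> by_cases h2 : S.ne (S.ch g s) (S.dn g s v) = 0 <;>
        simp [hs, h1, h2]
    · intro s _ hs
      rw [Finset.mem_range] at hs
      simp [hs]

/-- For membership the pruning to `branches` can be forgotten: an entry found below an edge shows by
`length_out` that `ne` is nonzero there. -/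
theorem mem_out {g v n x : ℕ} (hg : g ≤ S.last) : x ∈ S.out g v n ↔
    (∃ u, S.IsInt g u ∧ S.cn g u v ≠ 0 ∧ x = n + S.ix g u) ∨
      ∃ s < S.ns g, S.dn g s v ≠ 0 ∧ x ∈ S.out (S.ch g s) (S.dn g s v) (n + S.pre g s) := by
  rw [out_eq h hg, List.mem_append, List.mem_map, List.mem_flatMap]
  have hnn := h.nn_lt g hg
  have hns := h.ns_le g hg
  refine or_congr ⟨?_, ?_⟩ ⟨?_, ?_⟩
  · rintro ⟨u, hu, rfl⟩
    simp only [intNbrs, List.mem_filter, decide_eq_true_eq] at hu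
    exact ⟨u, hu.2.1, hu.2.2, rfl⟩
  · rintro ⟨u, hu, hc, rfl⟩
    refine ⟨u, ?_, rfl⟩
    have := hu.1.2
    simp only [intNbrs, List.mem_filter, decide_eq_true_eq, List.mem_range]
    exact ⟨by omega, hu, hc⟩
  · rintro ⟨s, hs, hx⟩
    have := mem_branches.1 hs
    exact ⟨s, this.2.1, this.2.2.1, hx⟩
  · rintro ⟨s, hs, hd, hx⟩
    refine ⟨s, mem_branches.2 ⟨by omega, hs, hd, ?_⟩, hx⟩
    rw [← length_out h (h.ch_le g hg s hs) _ (n + S.pre g s)]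
    exact (List.length_pos_of_mem hx).ne'

/-- A number in the range of `g` is either at most `n + ic g`, thus an internal node of `g` for
which `cn` decides, or it was created below some nonterminal edge. In the latter case the edge to
`v` also arises below that nonterminal edge, so `v` is attached to it and induction applies. -/
theorem mem_out_iff {g ρ n v x} (hg : g ≤ S.last) (hρ : S.Numbering g ρ n) (hv : S.IsNode g v) :
    x ∈ S.out g v n ↔ S.Edge g ρ n x (ρ v) ∧ n < x ∧ x ≤ n + S.sz g := by
  induction hd : S.dp g using Nat.strong_induction_on generalizing g ρ n v x with
  | _ d ih =>
    have ih' : ∀ s < S.ns g, S.dn g s v ≠ 0 → (x ∈ S.out (S.ch g s) (S.dn g s v) (n + S.pre g s) ↔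
        S.Edge (S.ch g s) (S.childMap g s ρ n) (n + S.pre g s) x (ρ v) ∧
          n + S.pre g s < x ∧ x ≤ n + S.pre g s + S.sz (S.ch g s)) := by
      intro s hs hdv
      have hc := h.ch_le g hg s hs
      rw [ih _ (hd ▸ h.dp_lt g hg s hs) hc (hρ.child h hg hs)
        (h.node_of_xt _ hc _ (h.xt_dn g hg s hs v hdv)) rfl, childMap_dn h hg hs hdv]
    rw [mem_out h hg]
    have hle := hρ.le hv
    constructor
    · rintro (⟨u, hu, hc, rfl⟩ | ⟨s, hs, hdv, hx⟩)
      · have e := (edge_nodes_iff h hg hρ hu.1 hv).2 hc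
        rw [hρ.int_eq u hu] at e
        have := one_le_ix h hg hu
        have := ix_le_ic hu
        have := ic_le_sz h hg
        exact ⟨e, by omega, by omega⟩
      · obtain ⟨e, h1, h2⟩ := (ih' s hs hdv).1 hx
        have := pre_add_le h hg hs
        exact ⟨.sub hs e, by omega, by omega⟩
    · rintro ⟨e, h1, h2⟩
      by_cases hx : x ≤ n + S.ic g
      · obtain ⟨u, hu, hi⟩ := exists_ix_eq h hg (x := x - n) (by omega) (by omega)
        have hxu : x = n + S.ix g u := by omega
        refine .inl ⟨u, hu, ?_, hxu⟩
        rw [hxu, ← hρ.int_eq u hu] at e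
        exact (edge_nodes_iff h hg hρ hu.1 hv).1 e
      · rcases edge_iff.1 e with ⟨u, v', ht, rfl, _⟩ | ⟨s, hs, e'⟩
        · have := hρ.le (h.node_of_tt g hg _ _ ht).1
          omega
        · obtain ⟨hxr, hyr⟩ := e'.range h (h.ch_le g hg s hs) (hρ.child h hg hs)
          have hdv := hρ.eq_up h hg hs hv hyr
          refine .inr ⟨s, hs, hdv, (ih' s hs hdv).2 ⟨e', ?_⟩⟩
          -- The alternative, an external node of the child, would be a node of `g` and so have
          -- number at most `n + ic g`, against `hx`.
          rcases hxr with hxr | ⟨x', hx', rfl⟩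
          · exact hxr
          · rw [childMap, if_pos hx'] at hx
            have := hρ.le (h.node_up g hg s hs x' hx')
            omega

/-- Internal nodes of `g` are numbered up to `n + ic g`, and distinct branches use disjoint
intervals above that. -/
theorem nodup_out {g ρ n v} (hg : g ≤ S.last) (hρ : S.Numbering g ρ n) (hv : S.IsNode g v) :
    (S.out g v n).Nodup := by
  induction hd : S.dp g using Nat.strong_induction_on generalizing g ρ n v with
  | _ d ih =>
    have hchild : ∀ s < S.ns g, S.dn g s v ≠ 0 →
        S.IsNode (S.ch g s) (S.dn g s v) := fun s hs hdv =>
      h.node_of_xt _ (h.ch_le g hg s hs) _ (h.xt_dn g hg s hs v hdv)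
    have hr : ∀ s ∈ S.branches g v, ∀ x ∈ S.out (S.ch g s) (S.dn g s v) (n + S.pre g s),
        n + S.pre g s < x ∧ x ≤ n + S.pre g (s + 1) := by
      intro s hs x hx
      obtain ⟨_, hs, hdv, _⟩ := mem_branches.1 hs
      have := ((mem_out_iff h (h.ch_le g hg s hs) (hρ.child h hg hs) (hchild s hs hdv)).1 hx).2
      rw [pre_succ]
      omega
    rw [out_eq h hg, List.nodup_append', List.nodup_flatMap]
    refine ⟨?_, ⟨fun s hs => ?_, ?_⟩, ?_⟩
    · refine List.Nodup.map_on (fun a ha b hb hab => ?_) (List.nodup_range.filter _)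
      simp only [intNbrs, List.mem_filter, decide_eq_true_eq] at ha hb
      exact ix_inj h hg ha.2.1 hb.2.1 (by omega)
    · obtain ⟨_, hs, hdv, _⟩ := mem_branches.1 hs
      exact ih _ (hd ▸ h.dp_lt g hg s hs) (h.ch_le g hg s hs) (hρ.child h hg hs) (hchild s hs hdv) rfl
    · have hnd : (S.branches g v).Nodup := List.nodup_range.filter _
      refine List.Pairwise.imp_of_mem (fun {a b} ha hb hab => ?_) hnd
      intro x hxa hxb
      have h1 := hr a ha x hxa
      have h2 := hr b hb x hxb
      rcases Nat.lt_or_gt_of_ne hab with hlt | hlt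
      · have := S.pre_mono g (show a + 1 ≤ b by omega)
        omega
      · have := S.pre_mono g (show b + 1 ≤ a by omega)
        omega
    · intro x hx hx'
      obtain ⟨u, hu, rfl⟩ := List.mem_map.1 hx
      obtain ⟨s, hs, hx'⟩ := List.mem_flatMap.1 hx'
      have := hr s hs _ hx'
      simp only [intNbrs, List.mem_filter, decide_eq_true_eq] at hu
      have := ix_le_ic hu.2.1
      have := S.ic_le_pre g s
      omega

/-- A node created below `s` is invisible elsewhere: terminal edges of `g` touch only nodes of `g`,
and another nonterminal edge yields its own interval or nodes of `g`. -/
theorem edge_child_iff {g ρ n s x k} (hg : g ≤ S.last) (hρ : S.Numbering g ρ n) (hs : s < S.ns g)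
    (hk : n + S.pre g s < k) (hk' : k ≤ n + S.pre g (s + 1)) :
    S.Edge g ρ n x k ↔ S.Edge (S.ch g s) (S.childMap g s ρ n) (n + S.pre g s) x k := by
  refine ⟨fun e => ?_, fun e => .sub hs e⟩
  have hic := S.ic_le_pre g s
  rcases edge_iff.1 e with ⟨u, v, ht, rfl, rfl⟩ | ⟨s', hs', e'⟩
  · have := hρ.le (h.node_of_tt g hg _ _ ht).2
    omega
  · rcases (e'.range h (h.ch_le g hg s' hs') (hρ.child h hg hs')).2 with hr | ⟨y, hy, rfl⟩
    · rw [add_assoc, ← pre_succ] at hr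
      rcases lt_trichotomy s s' with hlt | rfl | hlt
      · have := S.pre_mono g (show s + 1 ≤ s' by omega)
        omega
      · exact e'
      · have := S.pre_mono g (show s' + 1 ≤ s by omega)
        omega
    · rw [childMap, if_pos hy] at hk
      have := hρ.le (h.node_up g hg s' hs' y hy)
      omega

/-! ### Paths in the derivation tree -/

variable (S) in
omit h in
/-- The graph reached after `q` steps of the path `w`. -/
def pathGraph (w : ℕ → ℕ) : ℕ → ℕ
  | 0 => 0
  | q + 1 => S.ch (pathGraph w q) (w q)

variable (S) in
omit h in
/-- The number of nodes created before those of the graph reached after `q` steps of the path. -/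
def pathBase (w : ℕ → ℕ) : ℕ → ℕ
  | 0 => 0
  | q + 1 => pathBase w q + S.pre (S.pathGraph w q) (w q)

variable (S) in
omit h in
/-- The numbering of the nodes of the graph reached after `q` steps of the path. -/
def pathMap (w : ℕ → ℕ) : ℕ → ℕ → ℕ
  | 0 => S.ix 0
  | q + 1 => S.childMap (S.pathGraph w q) (w q) (pathMap w q) (S.pathBase w q)

variable (S) in
omit h in
/-- The first `r` steps of `w` are a path in the derivation tree. -/
def IsPath (w : ℕ → ℕ) (r : ℕ) : Prop := ∀ q < r, w q < S.ns (S.pathGraph w q)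

theorem pathGraph_le {w r} (hw : S.IsPath w r) : ∀ q ≤ r, S.pathGraph w q ≤ S.last := by
  intro q
  induction q with
  | zero => intro _; exact Nat.zero_le _
  | succ q ih => exact fun hq => h.ch_le _ (ih (by omega)) _ (hw q (by omega))

/-- Used twice: a path has at most `dp 0` steps, and after the first step the depth is below `dp 0`,
where the bound of two nonterminal edges applies. -/
theorem dp_pathGraph {w r} (hw : S.IsPath w r) : ∀ q ≤ r, S.dp (S.pathGraph w q) + q ≤ S.dp 0 := by
  intro q
  induction q with
  | zero => intro _; exact le_rfl
  | succ q ih =>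
    intro hq
    have := h.dp_lt _ (pathGraph_le h hw q (by omega)) _ (hw q (by omega))
    have := ih (by omega)
    rw [pathGraph]
    omega

theorem numbering_pathMap {w r} (hw : S.IsPath w r) :
    ∀ q ≤ r, S.Numbering (S.pathGraph w q) (S.pathMap w q) (S.pathBase w q) := by
  intro q
  induction q with
  | zero =>
    intro _
    refine ⟨fun u v hu hv huv => ?_, fun x hx => absurd (h.xt_zero x) hx, fun x _ => ?_⟩
    · exact ix_inj h (Nat.zero_le _) ⟨hu, h.xt_zero u⟩ ⟨hv, h.xt_zero v⟩ huv
    · simp [pathMap, pathBase, pathGraph]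
  | succ q ih =>
    exact fun hq => (ih (by omega)).child h (pathGraph_le h hw q (by omega)) (hw q (by omega))

/-- Iterating `edge_child_iff` down the path: the subderivation that creates a node also creates all
edges leading to it. -/
theorem edge_path_iff {w r x k} (hw : S.IsPath w r) (hk : S.pathBase w r < k)
    (hk' : k ≤ S.pathBase w r + S.sz (S.pathGraph w r)) :
    S.Edge 0 (S.ix 0) 0 x k ↔
      S.Edge (S.pathGraph w r) (S.pathMap w r) (S.pathBase w r) x k := by
  induction r with
  | zero => rfl
  | succ r ih =>
    have hw' : S.IsPath w r := fun q hq => hw q (by omega)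
    have hg := pathGraph_le h hw' r le_rfl
    have hs := hw r (by omega)
    have := pre_add_le h hg hs
    rw [pathBase, pathGraph] at hk'
    rw [pathBase] at hk
    rw [ih hw' (by omega) (by omega), edge_child_iff h hg (numbering_pathMap h hw' r le_rfl) hs hk
      (by rw [pre_succ]; omega)]
    rfl

/-- Neighbors are split by age. Those numbered at most `pathBase w r` can occur in this
subderivation only as external nodes of its graph; the younger ones form `out`. The same threshold
makes the two lists disjoint. -/
theorem inNeighbors_list {w r v} (hw : S.IsPath w r) (hv : S.IsInt (S.pathGraph w r) v) :
    ((S.extNbrs (S.pathGraph w r) v).map (S.pathMap w r) ++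
      S.out (S.pathGraph w r) v (S.pathBase w r)).Nodup ∧
    ∀ x, x ∈ (S.extNbrs (S.pathGraph w r) v).map (S.pathMap w r) ++
        S.out (S.pathGraph w r) v (S.pathBase w r) ↔
      S.Edge 0 (S.ix 0) 0 x (S.pathBase w r + S.ix (S.pathGraph w r) v) := by
  have hg := pathGraph_le h hw r le_rfl
  have hρ := numbering_pathMap h hw r le_rfl
  have hi1 := one_le_ix h hg hv
  have hi2 := ix_le_ic hv
  have hi3 := ic_le_sz h hg
  have hnn := h.nn_lt _ hg
  constructor
  · rw [List.nodup_append']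
    refine ⟨?_, nodup_out h hg hρ hv.1, ?_⟩
    · refine List.Nodup.map_on (fun a ha b hb hab => ?_) (List.nodup_range.filter _)
      simp only [extNbrs, List.mem_filter, decide_eq_true_eq] at ha hb
      exact hρ.inj a b (h.node_of_xt _ hg _ ha.2.1) (h.node_of_xt _ hg _ hb.2.1) hab
    · intro x hx hx'
      obtain ⟨u, hu, rfl⟩ := List.mem_map.1 hx
      simp only [extNbrs, List.mem_filter, decide_eq_true_eq] at hu
      have := hρ.ext_le u hu.2.1
      have := ((mem_out_iff h hg hρ hv.1).1 hx').2
      omega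
  · intro x
    rw [edge_path_iff h hw (by omega) (by omega), List.mem_append, mem_out_iff h hg hρ hv.1,
      ← hρ.int_eq v hv, List.mem_map]
    constructor
    · rintro (⟨u, hu, rfl⟩ | hx)
      · simp only [extNbrs, List.mem_filter, decide_eq_true_eq] at hu
        exact (edge_nodes_iff h hg hρ (h.node_of_xt _ hg _ hu.2.1) hv.1).2 hu.2.2
      · exact hx.1
    · intro e
      rcases (e.range h hg hρ).1 with hr | ⟨u, hu, rfl⟩
      · exact .inr ⟨e, hr⟩
      · have hun := h.node_of_xt _ hg _ hu
        refine .inl ⟨u, ?_, rfl⟩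
        simp only [extNbrs, List.mem_filter, decide_eq_true_eq, List.mem_range]
        exact ⟨by have := hun.2; omega, hu, (edge_nodes_iff h hg hρ hun hv.1).1 e⟩

end RuleSystem

/-! ## The query programs -/

namespace RuleSystem

variable {S : RuleSystem}

theorem path_congr {w w' : ℕ → ℕ} {r : ℕ} (h : ∀ q < r, w q = w' q) :
    ∀ q ≤ r, S.pathGraph w q = S.pathGraph w' q ∧ S.pathBase w q = S.pathBase w' q := by
  intro q
  induction q with
  | zero => exact fun _ => ⟨rfl, rfl⟩
  | succ q ih =>
    intro hq
    obtain ⟨h1, h2⟩ := ih (by omega)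
    simp [pathGraph, pathBase, h1, h2, h q (by omega)]

/-- The arrays hold the tables of a rule system: array `10` holds the starts of the rows of tables
with more than one index, the arrays from `11` on the tables themselves. -/
structure InTables (S : RuleSystem) (A : ℕ → ℕ → ℕ) : Prop where
  ns : ∀ g ≤ S.last, A 11 g = S.ns g
  ch : ∀ g ≤ S.last, ∀ s < S.ns g, A 12 (A 10 g + s) = S.ch g s
  xt : ∀ g ≤ S.last, ∀ v, S.IsNode g v → A 13 (A 10 g + v) = S.xt g v
  ix : ∀ g ≤ S.last, ∀ v, S.IsNode g v → A 14 (A 10 g + v) = S.ix g v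
  inode : ∀ g ≤ S.last, ∀ x, 1 ≤ x → x ≤ S.ic g → A 15 (A 10 g + x) = S.inode g x
  ic : ∀ g ≤ S.last, A 16 g = S.ic g
  up : ∀ g ≤ S.last, ∀ s < S.ns g, ∀ x, S.xt (S.ch g s) x ≠ 0 →
    A 17 (A 10 (A 10 g + s) + x) = S.up g s x
  dn : ∀ g ≤ S.last, ∀ s < S.ns g, ∀ v, S.IsNode g v →
    A 18 (A 10 (A 10 g + s) + v) = S.dn g s v
  pre : ∀ g ≤ S.last, ∀ s < S.ns g, A 19 (A 10 g + s) = S.pre g s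

/-- The arrays from `o` on hold the lists of neighbors and of branches of a rule system. -/
structure InLists (S : RuleSystem) (o : ℕ) (A : ℕ → ℕ → ℕ) : Prop where
  int_length : ∀ g ≤ S.last, ∀ v, S.IsNode g v → A o (A 10 g + v) = (S.intNbrs g v).length
  int_get : ∀ g ≤ S.last, ∀ v, S.IsNode g v → ∀ (i : ℕ) (hi : i < (S.intNbrs g v).length),
    A (o + 1) (A 10 (A 10 g + v) + i) = S.ix g (S.intNbrs g v)[i]
  ext_length : ∀ g ≤ S.last, ∀ v, S.IsNode g v → A (o + 2) (A 10 g + v) = (S.extNbrs g v).length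
  ext_get : ∀ g ≤ S.last, ∀ v, S.IsNode g v → ∀ (i : ℕ) (hi : i < (S.extNbrs g v).length),
    A (o + 3) (A 10 (A 10 g + v) + i) = (S.extNbrs g v)[i]
  branch_length : ∀ g ≤ S.last, ∀ v, S.IsNode g v →
    A (o + 4) (A 10 g + v) = (S.branches g v).length
  branch_get : ∀ g ≤ S.last, ∀ v, S.IsNode g v → ∀ (i : ℕ) (hi : i < (S.branches g v).length),
    A (o + 5) (A 10 (A 10 g + v) + i) = (S.branches g v)[i]

end RuleSystem

namespace RAM

/-- The entry of a table with two indices. -/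
def get2 (a : ℕ) (g s : Expr) : Expr := .get a (.add (.get 10 g) s)

/-- The entry of a table with three indices. -/
def get3 (a : ℕ) (g s x : Expr) : Expr := .get a (.add (.get 10 (.add (.get 10 g) s)) x)

/-- The memory holds the tables in `A`. -/
def Keeps (A : ℕ → ℕ → ℕ) (M : Memory) : Prop := ∀ a, 10 ≤ a → a < 100 → M.arr a = A a

/-- Find by binary search the last of the nonterminal edges of the graph in register `1` that has at
most the number of the node sought (in register `0`, relative to the base in register `2`). -/
def searchProg : Prog :=
  .loop (.lt (.add (.reg 4) (.const 1)) (.reg 5)) <|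
    .seq (.setReg 6 (.half (.add (.reg 4) (.reg 5)))) <|
    .ite (.lt (get2 19 (.reg 1) (.reg 6)) (.sub (.reg 0) (.reg 2)))
      (.setReg 4 (.reg 6)) (.setReg 5 (.reg 6))

/-- Record the present level of the path, and go to the child in register `4`. -/
def descendProg : Prog :=
  .seq (.setArr 0 (.reg 3) (.reg 4)) <| .seq (.setArr 101 (.reg 3) (.reg 1)) <|
  .seq (.setArr 102 (.reg 3) (.reg 4)) <| .seq (.setArr 103 (.reg 3) (.reg 2)) <|
  .seq (.setReg 2 (.add (.reg 2) (get2 19 (.reg 1) (.reg 4)))) <|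
  .seq (.setReg 1 (get2 12 (.reg 1) (.reg 4))) (.setReg 3 (.add (.reg 3) (.const 1)))

/-- Find the path in the derivation tree that creates the node in register `0`. -/
def locateProg : Prog :=
  .seq (.seq (.setReg 1 (.const 0)) <| .seq (.setReg 2 (.const 0)) (.setReg 3 (.const 0))) <|
  .seq (.loop (.lt (.get 16 (.reg 1)) (.sub (.reg 0) (.reg 2))) <|
      .seq (.seq (.setReg 4 (.const 0)) (.setReg 5 (.get 11 (.reg 1)))) <|
      .seq searchProg descendProg) <|
  .seq (.setArr 101 (.reg 3) (.reg 1)) <| .seq (.setArr 103 (.reg 3) (.reg 2)) <|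
  .setReg 4 (get2 15 (.reg 1) (.sub (.reg 0) (.reg 2)))

/-- Output the representation of the node in register `0`. -/
def repProg : Prog :=
  .seq locateProg <| .seq (.setArr 0 (.reg 3) (.reg 4)) <|
    .setReg 0 (.add (.reg 3) (.const 1))

open RuleSystem

variable {S : RuleSystem} {A : ℕ → ℕ → ℕ}

/-- The invariant is `pre g lo < k - b ≤ pre g hi`, and `t` bounds the number of halvings left.
Midpoints are strictly below `hi ≤ ns g`, so no entry of the table beyond the last nonterminal edge
is read. -/
theorem searchProg_spec (hA : S.InTables A) {g b k : ℕ} (hg : g ≤ S.last) (t : ℕ) :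
    ∀ M lo hi, Keeps A M → M.reg 0 = k → M.reg 1 = g → M.reg 2 = b → M.reg 4 = lo → M.reg 5 = hi →
    lo < hi → hi ≤ S.ns g → hi ≤ lo + 2 ^ t → S.pre g lo < k - b → k - b ≤ S.pre g hi →
    HaltsIn searchProg M (t * 30 + 10) fun M' => M'.arr = M.arr ∧
      (∀ y, y < 4 → M'.reg y = M.reg y) ∧ M'.reg 4 < S.ns g ∧ S.pre g (M'.reg 4) < k - b ∧
        k - b ≤ S.pre g (M'.reg 4 + 1) := by
  intro M lo hi hM h0 h1 h2 h4 h5 hlt hns ht hlo hhi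
  refine HaltsIn.loop (fun φ M' => M'.arr = M.arr ∧ (∀ y, y < 4 → M'.reg y = M.reg y) ∧
    ∃ t lo hi, φ = t * 30 + 10 ∧ M'.reg 4 = lo ∧ M'.reg 5 = hi ∧ lo < hi ∧ hi ≤ S.ns g ∧
      hi ≤ lo + 2 ^ t ∧ S.pre g lo < k - b ∧ k - b ≤ S.pre g hi) ?_ _ M
    ⟨rfl, fun _ _ => rfl, t, lo, hi, rfl, h4, h5, hlt, hns, ht, hlo, hhi⟩
  rintro φ M' ⟨hA', hf, t, lo, hi, rfl, h4, h5, hlt, hns, ht, hlo, hhi⟩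
  by_cases hc : lo + 1 < hi
  · right
    have ht0 : t ≠ 0 := by rintro rfl; omega
    obtain ⟨t, rfl⟩ : ∃ t', t = t' + 1 := ⟨t - 1, by omega⟩
    rw [pow_succ] at ht
    have e0 := (hf 0 (by omega)).trans h0
    have e1 := (hf 1 (by omega)).trans h1
    have e2 := (hf 2 (by omega)).trans h2
    have epre : M'.arr 19 (M'.arr 10 g + (lo + hi) / 2) = S.pre g ((lo + hi) / 2) := by
      rw [hA', hM 19 (by omega) (by omega), hM 10 (by omega) (by omega)]
      exact hA.pre g hg _ (by omega)
    refine ⟨by simp [Expr.eval, h4, h5, hc], 22, t * 30 + 10, by simp [Expr.cost]; omega,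
      (HaltsIn.exec rfl ?_).mono (by simp [Prog.time, Expr.cost, get2]) fun _ h => h⟩
    by_cases hp : S.pre g ((lo + hi) / 2) < k - b
    · simp only [Prog.exec, Expr.eval, get2, Memory.setReg_reg, Memory.setReg_arr, h4, h5, e0, e1, e2,
        reduceIte, OfNat.one_ne_ofNat, OfNat.zero_ne_ofNat, epre, hp, ne_eq,
        one_ne_zero, not_false_eq_true, Nat.reduceEqDiff]
      refine ⟨hA', fun y hy => ?_, t, (lo + hi) / 2, hi, rfl, ?_, ?_, by omega, hns, by omega, hp, hhi⟩
      · simp [hf y hy, show y ≠ 4 by omega, show y ≠ 6 by omega]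
      · simp
      · simp
    · simp only [Prog.exec, Expr.eval, get2, Memory.setReg_reg, Memory.setReg_arr, h4, h5, e0, e1, e2,
        reduceIte, OfNat.one_ne_ofNat, OfNat.zero_ne_ofNat, epre, hp, ne_eq,
        not_true, Nat.reduceEqDiff]
      refine ⟨hA', fun y hy => ?_, t, lo, (lo + hi) / 2, rfl, ?_, ?_, by omega, by omega, by omega,
        hlo, by omega⟩
      · simp [hf y hy, show y ≠ 5 by omega, show y ≠ 6 by omega]
      · simp
      · simp
  · left
    have : hi = lo + 1 := by omega
    subst this
    exact ⟨by simp [Expr.eval, h4, h5], ⟨hA', hf, by omega, by rw [h4]; exact hlo,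
      by rw [h4]; exact hhi⟩, by simp [Expr.cost]⟩

/-- The memory describes the first `r` steps of a path that leads to the node `v`. -/
structure Located (S : RuleSystem) (A : ℕ → ℕ → ℕ) (w : ℕ → ℕ) (r v : ℕ) (M : Memory) : Prop where
  keeps : Keeps A M
  isPath : S.IsPath w r
  isInt : S.IsInt (S.pathGraph w r) v
  graph : M.reg 1 = S.pathGraph w r
  base : M.reg 2 = S.pathBase w r
  depth : M.reg 3 = r
  node : M.reg 4 = v
  output : ∀ q < r, M.arr 0 q = w q
  graphs : ∀ q ≤ r, M.arr 101 q = S.pathGraph w q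
  steps : ∀ q < r, M.arr 102 q = w q
  bases : ∀ q ≤ r, M.arr 103 q = S.pathBase w q

/-- The search among the nonterminal edges is logarithmic in the start graph only. On every later
level at most two edges remain, one halving suffices, and the number of levels is bounded by `dp 0`.
-/
theorem locateProg_spec (h : S.WF) (hA : S.InTables A)
    (hns : ∀ g ≤ S.last, S.dp g < S.dp 0 → S.ns g ≤ 2) {k : ℕ} (hk1 : 1 ≤ k) (hk : k ≤ S.sz 0)
    (M : Memory) (hM : Keeps A M) (h0 : M.reg 0 = k) :
    HaltsIn locateProg M (200 * (1 + Nat.log 2 (S.ns 0) + S.dp 0)) fun M' =>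
      ∃ w r v, Located S A w r v M' ∧ S.pathBase w r + S.ix (S.pathGraph w r) v = k := by
  -- The remaining time pays a constant for each unit of remaining depth, and the long search in the
  -- start graph once, as long as `r = 0`. The final `20` is for the last test of the loop.
  let I : ℕ → Memory → Prop := fun φ M' => Keeps A M' ∧ M'.reg 0 = k ∧ ∃ w r,
    S.dp (S.pathGraph w r) * 140 + (if r = 0 then 30 * (Nat.log 2 (S.ns 0) + 1) else 0) + 20 ≤ φ ∧
    S.IsPath w r ∧ S.pathBase w r < k ∧ k ≤ S.pathBase w r + S.sz (S.pathGraph w r) ∧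
    M'.reg 1 = S.pathGraph w r ∧ M'.reg 2 = S.pathBase w r ∧ M'.reg 3 = r ∧
    (∀ q < r, M'.arr 0 q = w q) ∧ (∀ q < r, M'.arr 101 q = S.pathGraph w q) ∧
    (∀ q < r, M'.arr 102 q = w q) ∧ ∀ q < r, M'.arr 103 q = S.pathBase w q
  refine HaltsIn.seq' (Q := I (S.dp 0 * 140 + 30 * (Nat.log 2 (S.ns 0) + 1) + 20)) 10
    (S.dp 0 * 140 + 30 * (Nat.log 2 (S.ns 0) + 1) + 20 + 60) (by omega)
    ((HaltsIn.exec rfl ?_).mono (by decide) fun _ h => h) fun M₁ h₁ => ?_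
  · refine ⟨fun a h1 h2 => hM a h1 h2, by simp [Prog.exec, Memory.setReg_reg, h0], fun _ => 0, 0,
      by simp [pathGraph], fun q hq => by omega, by simp [pathBase]; omega,
      by simpa [pathBase, pathGraph] using hk, ?_⟩
    simp [Prog.exec, Memory.setReg_reg, Expr.eval, pathGraph, pathBase]
  refine HaltsIn.seq' (Q := fun M' => M'.reg 0 = k ∧ Keeps A M' ∧ ∃ w r, S.IsPath w r ∧
    S.pathBase w r < k ∧ k ≤ S.pathBase w r + S.ic (S.pathGraph w r) ∧
    M'.reg 1 = S.pathGraph w r ∧ M'.reg 2 = S.pathBase w r ∧ M'.reg 3 = r ∧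
    (∀ q < r, M'.arr 0 q = w q) ∧ (∀ q < r, M'.arr 101 q = S.pathGraph w q) ∧
    (∀ q < r, M'.arr 102 q = w q) ∧ ∀ q < r, M'.arr 103 q = S.pathBase w q) _ 60 le_rfl
    (HaltsIn.loop I ?_ _ M₁ h₁) fun M₂ h₂ => ?_
  · rintro φ M' ⟨hK, h0, w, r, hφ0, hw, hk1, hk2, h1, h2, h3, o0, o1, o2, o3⟩
    have hg := pathGraph_le h hw r le_rfl
    have eic : M'.arr 16 (S.pathGraph w r) = S.ic (S.pathGraph w r) := by
      rw [hK 16 (by omega) (by omega)]; exact hA.ic _ hg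
    by_cases hc : S.ic (S.pathGraph w r) < k - S.pathBase w r
    · right
      refine ⟨by simp [Expr.eval, h0, h1, h2, eic, hc], ?_⟩
      generalize hgg : S.pathGraph w r = g at *
      generalize hbb : S.pathBase w r = b at *
      have hnpos : 0 < S.ns g := by
        by_contra hn
        rw [← pre_ns h hg, show S.ns g = 0 by omega, pre_zero] at hk2
        omega
      -- The number of halvings: logarithmic in the start graph, one everywhere below.
      obtain ⟨t, ht, hφ⟩ : ∃ t, S.ns g ≤ 2 ^ t ∧ t * 30 ≤
          30 + (if r = 0 then 30 * (Nat.log 2 (S.ns 0) + 1) else 0) := by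
        rcases Nat.eq_zero_or_pos r with rfl | hr
        · refine ⟨Nat.log 2 (S.ns 0) + 1, ?_, by simp; omega⟩
          rw [← hgg]
          exact (Nat.lt_pow_succ_log_self (by omega) _).le
        · refine ⟨1, ?_, by omega⟩
          have := dp_pathGraph h hw r le_rfl
          rw [hgg] at this
          exact hns g hg (by omega)
      have ens : M'.arr 11 g = S.ns g := by
        rw [hK 11 (by omega) (by omega)]; exact hA.ns g hg
      have hgd : 0 < S.dp g := (Nat.zero_le _).trans_lt (h.dp_lt g hg 0 hnpos)
      refine ⟨5 + (t * 30 + 10 + 50), (S.dp g - 1) * 140 + 20, by simp [Expr.cost]; omega, ?_⟩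
      refine HaltsIn.seq (Q := fun M₂ => M₂.arr = M'.arr ∧ (∀ y < 4, M₂.reg y = M'.reg y) ∧
        M₂.reg 4 = 0 ∧ M₂.reg 5 = S.ns g) ((HaltsIn.exec rfl ?_).mono (by decide) fun _ h => h) ?_
      · refine ⟨rfl, fun y hy => ?_, ?_, ?_⟩
        · simp [Prog.exec, Memory.setReg_reg, show y ≠ 4 by omega, show y ≠ 5 by omega]
        · simp [Prog.exec, Memory.setReg_reg, Expr.eval]
        · simp [Prog.exec, Memory.setReg_reg, Expr.eval, h1, ens]
      rintro M₂ ⟨a2, f2, r4, r5⟩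
      have hK2 : Keeps A M₂ := fun a ha hb => by rw [a2]; exact hK a ha hb
      refine (searchProg_spec hA hg t M₂ 0 (S.ns g) hK2 ((f2 0 (by omega)).trans h0)
        ((f2 1 (by omega)).trans h1) ((f2 2 (by omega)).trans h2) r4 r5 hnpos le_rfl (by omega)
        (by rw [pre_zero]; exact hc) (by rw [pre_ns h hg]; omega)).seq ?_
      rintro M₃ ⟨a3, f3, hs, hp1, hp2⟩
      have q0 := (f3 0 (by omega)).trans ((f2 0 (by omega)).trans h0)
      have q1 := (f3 1 (by omega)).trans ((f2 1 (by omega)).trans h1)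
      have q2 := (f3 2 (by omega)).trans ((f2 2 (by omega)).trans h2)
      have q3 := (f3 3 (by omega)).trans ((f2 3 (by omega)).trans h3)
      have a3' := a3.trans a2
      generalize hss : M₃.reg 4 = s at *
      have epre : M₃.arr 19 (M₃.arr 10 g + s) = S.pre g s := by
        rw [a3', hK 19 (by omega) (by omega), hK 10 (by omega) (by omega)]
        exact hA.pre g hg _ hs
      have ech : M₃.arr 12 (M₃.arr 10 g + s) = S.ch g s := by
        rw [a3', hK 12 (by omega) (by omega), hK 10 (by omega) (by omega)]
        exact hA.ch g hg _ hs
      refine (HaltsIn.exec rfl ?_).mono (by decide) fun _ h => h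
      -- The path is extended by setting `w r := s`; graphs and bases up to step `r` depend only on
      -- earlier values of `w`.
      have hcongr := path_congr (S := S) (w := Function.update w r s) (w' := w) (r := r)
        (fun q hq => Function.update_of_ne (by omega) _ _)
      have hg' : S.pathGraph (Function.update w r s) (r + 1) = S.ch g s := by
        simp [pathGraph, (hcongr r le_rfl).1, hgg]
      have hb' : S.pathBase (Function.update w r s) (r + 1) = b + S.pre g s := by
        simp [pathBase, (hcongr r le_rfl).1, (hcongr r le_rfl).2, hgg, hbb]
      have hdlt := h.dp_lt g hg s hs
      rw [pre_succ] at hp2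
      refine ⟨fun a h1 h2 => ?_, ?_, Function.update w r s, r + 1, ?_, ?_, ?_, ?_, ?_, ?_, ?_, ?_, ?_, ?_, ?_⟩
      · simp only [descendProg, Prog.exec, Memory.setReg_arr, Memory.setArr_arr,
          show a ≠ 0 by omega, show a ≠ 101 by omega, show a ≠ 102 by omega, show a ≠ 103 by omega,
          if_false]
        rw [a3', hK a h1 h2]
      · simp [descendProg, Prog.exec, Memory.setReg_reg, q0]
      · rw [hg', if_neg (by omega)]; omega
      · intro q hq
        rcases Nat.lt_succ_iff_lt_or_eq.1 hq with hq | rfl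
        · rw [Function.update_of_ne (by omega), (hcongr q (by omega)).1]
          exact hw q hq
        · rw [Function.update_self, (hcongr q le_rfl).1, hgg]; exact hs
      · rw [hb']; omega
      · rw [hb', hg']; omega
      · simp [descendProg, Prog.exec, Memory.setReg_reg, Memory.setArr_arr, Expr.eval, get2, q1, hss,
          ech, hg']
      · simp [descendProg, Prog.exec, Memory.setReg_reg, Memory.setArr_arr, Expr.eval, get2, q1, q2,
          hss, epre, hb']
      · simp [descendProg, Prog.exec, Memory.setReg_reg, Expr.eval, q3]
      all_goals
        intro q hq
        simp only [descendProg, Prog.exec, Memory.setReg_arr, Memory.setArr_arr_apply, Expr.eval,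
          Memory.setArr_reg, q1, q2, q3, hss, a3']
        rcases Nat.lt_succ_iff_lt_or_eq.1 hq with hq | rfl
        · simp [hq.ne, o0 q hq, o1 q hq, o2 q hq, o3 q hq, hcongr q hq.le]
        · simp [hcongr q le_rfl, hgg, hbb]
    · exact .inl ⟨by simp [Expr.eval, h0, h1, h2, eic, hc],
        ⟨h0, hK, w, r, hw, hk1, by omega, h1, h2, h3, o0, o1, o2, o3⟩, by simp [Expr.cost]; omega⟩
  · obtain ⟨h0, hK, w, r, hw, hk1, hk2, h1, h2, h3, o0, o1, o2, o3⟩ := h₂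
    have hg := pathGraph_le h hw r le_rfl
    obtain ⟨hv, hix⟩ := inode_spec h hg (x := k - S.pathBase w r) (by omega) (by omega)
    have ev : M₂.arr 15 (M₂.arr 10 (S.pathGraph w r) + (k - S.pathBase w r)) =
        S.inode (S.pathGraph w r) (k - S.pathBase w r) := by
      rw [hK 15 (by omega) (by omega), hK 10 (by omega) (by omega)]
      exact hA.inode _ hg _ (by omega) (by omega)
    refine (HaltsIn.exec rfl ?_).mono (by decide) fun _ h => h
    refine ⟨w, r, S.inode (S.pathGraph w r) (k - S.pathBase w r), ?_, by omega⟩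
    refine ⟨fun a h1 h2 => ?_, hw, hv, ?_, ?_, ?_, ?_, ?_, ?_, ?_, ?_⟩
    · simp only [Prog.exec, Memory.setReg_arr, Memory.setArr_arr, show a ≠ 101 by omega,
        show a ≠ 103 by omega, if_false]
      exact hK a h1 h2
    · simp [Prog.exec, Memory.setReg_reg, h1]
    · simp [Prog.exec, Memory.setReg_reg, h2]
    · simp [Prog.exec, Memory.setReg_reg, h3]
    · simp [Prog.exec, Memory.setReg_reg, Memory.setArr_arr, Expr.eval, get2, h0, h1, h2, ev]
    · intro q hq
      simp [Prog.exec, Memory.setArr_arr, o0 q hq]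
    · intro q hq
      simp only [Prog.exec, Memory.setReg_arr, Memory.setArr_arr_apply, Expr.eval,
          Memory.setArr_reg, h1, h2, h3]
      rcases hq.lt_or_eq with hq | rfl
      · simp [hq.ne, o1 q hq]
      · simp
    · intro q hq
      simp [Prog.exec, Memory.setArr_arr, o2 q hq]
    · intro q hq
      simp only [Prog.exec, Memory.setReg_arr, Memory.setArr_arr_apply, Expr.eval,
          Memory.setArr_reg, h1, h2, h3]
      rcases hq.lt_or_eq with hq | rfl
      · simp [hq.ne, o3 q hq]
      · simp

theorem repProg_spec (h : S.WF) (hA : S.InTables A)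
    (hns : ∀ g ≤ S.last, S.dp g < S.dp 0 → S.ns g ≤ 2) {k : ℕ} (hk1 : 1 ≤ k) (hk : k ≤ S.sz 0)
    (M : Memory) (hM : Keeps A M) :
    ∃ w r v, S.IsPath w r ∧ S.IsInt (S.pathGraph w r) v ∧
      S.pathBase w r + S.ix (S.pathGraph w r) v = k ∧
      Answers repProg M k (300 * (1 + Nat.log 2 (S.ns 0) + S.dp 0)) ((List.range r).map w ++ [v]) := by
  obtain ⟨t, ht, M', hr, ⟨w, r, v, hloc, hkv⟩⟩ : HaltsIn repProg (M.setReg 0 k) _ _ :=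
    HaltsIn.seq' (R := fun M' => ∃ w r v, (S.IsPath w r ∧ S.IsInt (S.pathGraph w r) v ∧
        S.pathBase w r + S.ix (S.pathGraph w r) v = k) ∧ M'.reg 0 = r + 1 ∧
        (∀ q < r, M'.arr 0 q = w q) ∧ M'.arr 0 r = v) _ 10
      (by show _ ≤ 300 * (1 + Nat.log 2 (S.ns 0) + S.dp 0); omega)
      (locateProg_spec h hA hns hk1 hk (M.setReg 0 k) (fun a ha hb => hM a ha hb)
        (by simp [Memory.setReg_reg])) (by
        rintro M' ⟨w, r, v, hl, hkv⟩
        refine (HaltsIn.exec rfl ?_).mono (by decide) fun _ h => h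
        refine ⟨w, r, v, ⟨hl.isPath, hl.isInt, hkv⟩, ?_, fun q hq => ?_, ?_⟩
        · simp [Prog.exec, Memory.setReg_reg, Expr.eval, hl.depth]
        · simp [Prog.exec, Expr.eval, Memory.setArr_arr_apply, hl.depth, hq.ne, hl.output q hq]
        · simp [Prog.exec, Expr.eval, Memory.setArr_arr_apply, hl.depth, hl.node])
  refine ⟨w, r, v, hloc.1, hloc.2.1, hloc.2.2, t, ht, M', hr, by simp [hkv.1], fun i hi => ?_⟩
  simp only [List.length_append, List.length_map, List.length_range, List.length_singleton] at hi
  rcases Nat.lt_succ_iff_lt_or_eq.1 hi with hi | rfl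
  · rw [hkv.2.1 i hi, List.getElem_append_left (by simpa using hi)]
    simp
  · rw [hkv.2.2, List.getElem_append_right (by simp)]
    simp

end RAM

/-! ### Neighbor queries: climbing the path, and searching below it with a stack. -/

namespace RAM

open RuleSystem

/-- Compute the number of the node in register `7` of the graph at the level in register `8` of the
path, and store it in register `9`. -/
def resolveProg : Prog :=
  .seq (.loop (get2 13 (.get 101 (.reg 8)) (.reg 7)) <|
      .seq (.setReg 8 (.sub (.reg 8) (.const 1)))
        (.setReg 7 (get3 17 (.get 101 (.reg 8)) (.get 102 (.reg 8)) (.reg 7))))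
    (.setReg 9 (.add (.get 103 (.reg 8)) (get2 14 (.get 101 (.reg 8)) (.reg 7))))

/-- Append the value of register `9` to the output; register `10` holds the length of the output. -/
def emitProg : Prog :=
  .seq (.setArr 0 (.reg 10) (.reg 9)) (.setReg 10 (.add (.reg 10) (.const 1)))

/-- Output the external neighbors of the node in register `4` of the graph in register `1`. -/
def extProg (o : ℕ) : Prog :=
  .loop (.lt (.reg 11) (get2 (o + 2) (.reg 1) (.reg 4))) <|
    .seq (.seq (.setReg 7 (get3 (o + 3) (.reg 1) (.reg 4) (.reg 11))) (.setReg 8 (.reg 3))) <|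
    .seq resolveProg <| .seq emitProg (.setReg 11 (.add (.reg 11) (.const 1)))

/-- Output the internal neighbors of the node in register `4` of the graph in register `1`. -/
def intProg (o : ℕ) : Prog :=
  .loop (.lt (.reg 11) (get2 o (.reg 1) (.reg 4))) <|
    .seq (.setReg 9 (.add (.reg 2) (get3 (o + 1) (.reg 1) (.reg 4) (.reg 11)))) <|
    .seq emitProg (.setReg 11 (.add (.reg 11) (.const 1)))

/-- Push the branches at the node in register `4` of the graph in register `1` onto the stack;
register `12` holds the height of the stack. -/
def pushProg (o : ℕ) : Prog :=
  .loop (.lt (.reg 11) (get2 (o + 4) (.reg 1) (.reg 4))) <|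
    .seq (.setReg 5 (get3 (o + 5) (.reg 1) (.reg 4) (.reg 11))) <|
    .seq (.setArr 104 (.reg 12) (get2 12 (.reg 1) (.reg 5))) <|
    .seq (.setArr 105 (.reg 12) (get3 18 (.reg 1) (.reg 5) (.reg 4))) <|
    .seq (.setArr 106 (.reg 12) (.add (.reg 2) (get2 19 (.reg 1) (.reg 5)))) <|
    .seq (.setReg 12 (.add (.reg 12) (.const 1))) (.setReg 11 (.add (.reg 11) (.const 1)))

/-- Output the neighbors created by the derivations on the stack. -/
def workProg (o : ℕ) : Prog :=
  .loop (.reg 12) <|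
    .seq (.seq (.setReg 12 (.sub (.reg 12) (.const 1))) <| .seq (.setReg 1 (.get 104 (.reg 12))) <|
      .seq (.setReg 4 (.get 105 (.reg 12))) <| .seq (.setReg 2 (.get 106 (.reg 12)))
        (.setReg 11 (.const 0))) <|
    .seq (intProg o) <| .seq (.setReg 11 (.const 0)) (pushProg o)

/-- Output the neighbors of the node in register `0`, with the lists in the arrays from `o` on. -/
def nbrProg (o : ℕ) : Prog :=
  .seq locateProg <| .seq (.seq (.setReg 10 (.const 0)) (.setReg 11 (.const 0))) <|
  .seq (extProg o) <|
  .seq (.seq (.setArr 104 (.const 0) (.reg 1)) <| .seq (.setArr 105 (.const 0) (.reg 4)) <|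
    .seq (.setArr 106 (.const 0) (.reg 2)) (.setReg 12 (.const 1))) <|
  .seq (workProg o) (.setReg 0 (.reg 10))

variable {S : RuleSystem} {A : ℕ → ℕ → ℕ}

/-- The memory holds the output `L`. -/
def Outputs (M : Memory) (L : List ℕ) : Prop :=
  M.reg 10 = L.length ∧ ∀ (i : ℕ) (hi : i < L.length), M.arr 0 i = L[i]

/-- The memory holds the stack `L`. -/
def Stacked (M : Memory) (L : List (ℕ × ℕ × ℕ)) : Prop :=
  M.reg 12 = L.length ∧ ∀ (i : ℕ) (hi : i < L.length),
    M.arr 104 i = L[i].1 ∧ M.arr 105 i = L[i].2.1 ∧ M.arr 106 i = L[i].2.2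

/-- An external node of a graph on the path is the same node of `val(G)` as its image under `up` one
level higher, so climbing leaves `pathMap` unchanged. At the first level where the node is internal
its number is the base plus `ix`. The start graph has no external nodes, so at most `q` rounds are
needed. -/
theorem resolveProg_spec (h : S.WF) (hA : S.InTables A) {w : ℕ → ℕ} {r q x : ℕ} (hw : S.IsPath w r)
    (hq : q ≤ r) (hx : S.IsNode (S.pathGraph w q) x) (M : Memory) (hK : Keeps A M)
    (h7 : M.reg 7 = x) (h8 : M.reg 8 = q) (hg : ∀ q ≤ r, M.arr 101 q = S.pathGraph w q)
    (hs : ∀ q < r, M.arr 102 q = w q) (hb : ∀ q ≤ r, M.arr 103 q = S.pathBase w q) :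
    HaltsIn resolveProg M (q * 40 + 30) fun M' => M'.arr = M.arr ∧
      M'.reg 9 = S.pathMap w q x ∧ ∀ y, y < 7 ∨ 9 < y → M'.reg y = M.reg y := by
  let I : ℕ → Memory → Prop := fun φ M' => M'.arr = M.arr ∧ (∀ y, y < 7 ∨ 9 < y → M'.reg y = M.reg y) ∧
    ∃ p z, φ = p * 40 + 10 ∧ p ≤ r ∧ M'.reg 8 = p ∧ M'.reg 7 = z ∧ S.IsNode (S.pathGraph w p) z ∧
      S.pathMap w p z = S.pathMap w q x
  have exv : ∀ p ≤ r, ∀ z, S.IsNode (S.pathGraph w p) z →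
      M.arr 13 (M.arr 10 (S.pathGraph w p) + z) = S.xt (S.pathGraph w p) z := by
    intro p hp z hz
    rw [hK 13 (by omega) (by omega), hK 10 (by omega) (by omega)]
    exact hA.xt _ (pathGraph_le h hw p hp) z hz
  refine HaltsIn.seq' (Q := fun M' => M'.arr = M.arr ∧ (∀ y, y < 7 ∨ 9 < y → M'.reg y = M.reg y) ∧
    ∃ p z, p ≤ r ∧ M'.reg 8 = p ∧ M'.reg 7 = z ∧ S.IsInt (S.pathGraph w p) z ∧
      S.pathMap w p z = S.pathMap w q x) (q * 40 + 10) 20 (by omega)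
    (HaltsIn.loop I ?_ _ M ⟨rfl, fun _ _ => rfl, q, x, rfl, hq, h8, h7, hx, rfl⟩)
    fun M' ⟨ha, hf, p, z, hp, h8, h7, hz, hpz⟩ => ?_
  · rintro φ M' ⟨ha, hf, p, z, rfl, hp, h8, h7, hz, hpz⟩
    have e1 := exv p hp z hz
    by_cases hc : S.xt (S.pathGraph w p) z = 0
    · exact .inl ⟨by simp [Expr.eval, get2, h7, h8, ha, hg p hp, e1, hc],
        ⟨ha, hf, p, z, hp, h8, h7, ⟨hz, hc⟩, hpz⟩, by simp [Expr.cost, get2]⟩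
    · right
      obtain ⟨p, rfl⟩ : ∃ p', p = p' + 1 := by
        refine ⟨p - 1, ?_⟩
        rcases Nat.eq_zero_or_pos p with rfl | h0
        · exact absurd (h.xt_zero z) hc
        · omega
      have hgp := pathGraph_le h hw p (by omega)
      have hwp := hw p (by omega)
      refine ⟨by simp [Expr.eval, get2, h7, h8, ha, hg _ hp, e1, hc], 20, p * 40 + 10, by
        simp [Expr.cost, get2]; omega, (HaltsIn.exec rfl ?_).mono (by decide) fun _ h => h⟩
      have eup : M.arr 17 (M.arr 10 (M.arr 10 (S.pathGraph w p) + w p) + z) =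
          S.up (S.pathGraph w p) (w p) z := by
        rw [hK 17 (by omega) (by omega), hK 10 (by omega) (by omega)]
        exact hA.up _ hgp _ hwp z hc
      refine ⟨ha, fun y hy => ?_, p, S.up (S.pathGraph w p) (w p) z, rfl, by omega, ?_, ?_, ?_, ?_⟩
      · simp [Prog.exec, Memory.setReg_reg, show y ≠ 7 by omega, show y ≠ 8 by omega, hf y hy]
      · simp [Prog.exec, Memory.setReg_reg, Expr.eval, h8]
      · simp [Prog.exec, Memory.setReg_reg, Expr.eval, h8, h7, get3, ha, hg p (by omega),
          hs p (by omega), eup]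
      · exact h.node_up _ hgp _ hwp z hc
      · rw [← hpz]
        conv_rhs => rw [pathMap, childMap]
        rw [if_pos (show S.xt (S.ch (S.pathGraph w p) (w p)) z ≠ 0 from hc)]
  · have eix : M.arr 14 (M.arr 10 (S.pathGraph w p) + z) = S.ix (S.pathGraph w p) z := by
      rw [hK 14 (by omega) (by omega), hK 10 (by omega) (by omega)]
      exact hA.ix _ (pathGraph_le h hw p hp) z hz.1
    refine (HaltsIn.exec rfl ?_).mono (by decide) fun _ h => h
    refine ⟨ha, ?_, fun y hy => ?_⟩
    · rw [← hpz, (numbering_pathMap h hw p hp).int_eq z hz]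
      simp [Prog.exec, Memory.setReg_reg, Expr.eval, h8, h7, get2, ha, hg p hp, hb p hp, eix]
    · simp [Prog.exec, Memory.setReg_reg, show y ≠ 9 by omega, hf y hy]

theorem Outputs.emit {M : Memory} {L : List ℕ} {x : ℕ} (hL : Outputs M L) (h9 : M.reg 9 = x) :
    Outputs (emitProg.exec M) (L ++ [x]) := by
  refine ⟨by simp [emitProg, Prog.exec, Memory.setReg_reg, Expr.eval, hL.1], fun i hi => ?_⟩
  rw [List.length_append, List.length_singleton] at hi
  rcases Nat.lt_succ_iff_lt_or_eq.1 hi with hi | rfl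
  · simp [emitProg, Prog.exec, Memory.setArr_arr_apply, Expr.eval, hL.1, hi.ne, hL.2 i hi,
      List.getElem_append_left hi]
  · simp [emitProg, Prog.exec, Memory.setArr_arr_apply, Expr.eval, hL.1, h9]

theorem Outputs.congr {M M' : Memory} {L : List ℕ} (hL : Outputs M L) (h10 : M'.reg 10 = M.reg 10)
    (h0 : M'.arr 0 = M.arr 0) : Outputs M' L :=
  ⟨h10.trans hL.1, fun i hi => by rw [h0]; exact hL.2 i hi⟩

theorem extProg_spec (h : S.WF) (hA : S.InTables A) {o : ℕ} (ho : 20 ≤ o) (ho' : o < 90)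
    (hL : S.InLists o A) {w : ℕ → ℕ} {r v : ℕ} (M : Memory) (hM : Located S A w r v M)
    (hO : Outputs M []) (h11 : M.reg 11 = 0) :
    HaltsIn (extProg o) M ((S.extNbrs (S.pathGraph w r) v).length * (r * 40 + 100) + 20) fun M' =>
      Keeps A M' ∧ (∀ y, y < 7 → M'.reg y = M.reg y) ∧
      Outputs M' ((S.extNbrs (S.pathGraph w r) v).map (S.pathMap w r)) := by
  have hg := pathGraph_le h hM.isPath r le_rfl
  have hv := hM.isInt.1
  set X := S.extNbrs (S.pathGraph w r) v with hX
  let I : ℕ → Memory → Prop := fun i M' => (∀ a, a ≠ 0 → M'.arr a = M.arr a) ∧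
    (∀ y, y < 7 → M'.reg y = M.reg y) ∧ M'.reg 11 = i ∧
    Outputs M' ((X.take i).map (S.pathMap w r))
  have hlen := hL.ext_length _ hg v hv
  refine (HaltsIn.for X.length (r * 40 + 80) I ⟨fun _ _ => rfl, fun _ _ => rfl, h11, by simpa⟩
    ?_ ?_).mono ?_ fun M' ⟨ha, hf, _, hO⟩ => ⟨?_, hf, by simpa using hO⟩
  · rintro M' ⟨ha, hf, h11, -⟩
    simp [Expr.eval, get2, h11, hf 1, hf 4, ha, hM.graph, hM.node, hM.keeps (o + 2) (by omega) (by omega),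
      hM.keeps 10 (by omega) (by omega), hlen, hX]
  · rintro i hi M' ⟨ha, hf, h11, hO⟩
    have hK : Keeps A M' := fun a h1 h2 => by rw [ha a (by omega)]; exact hM.keeps a h1 h2
    have h1 := (hf 1 (by omega)).trans hM.graph
    have h4 := (hf 4 (by omega)).trans hM.node
    have h3 := (hf 3 (by omega)).trans hM.depth
    have hget := hL.ext_get _ hg v hv i hi
    refine ⟨by simp [Expr.eval, get2, h11, h1, h4, hK (o + 2) (by omega) (by omega),
      hK 10 (by omega) (by omega), hlen, ← hX, hi], ?_⟩
    have hmem : X[i] ∈ X := List.getElem_mem _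
    have hxi : S.IsNode (S.pathGraph w r) X[i] := by
      simp only [hX, extNbrs, List.mem_filter, decide_eq_true_eq] at hmem
      exact h.node_of_xt _ hg _ hmem.2.1
    refine HaltsIn.seq' (Q := fun M₂ => M₂.arr = M'.arr ∧ M₂.reg 7 = X[i] ∧ M₂.reg 8 = r ∧
      ∀ y, y ≠ 7 ∧ y ≠ 8 → M₂.reg y = M'.reg y) 20 (r * 40 + 50) (by omega)
      ((HaltsIn.exec rfl ⟨rfl, ?_, ?_, fun y hy => ?_⟩).mono (by simp [Prog.time, Expr.cost, get3]) fun _ h => h)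
      fun M₂ ⟨a2, b7, b8, f2⟩ => ?_
    · simpa [Prog.exec, Memory.setReg_reg, Expr.eval, get3, h11, h1, h4, hK (o + 3) (by omega) (by omega),
        hK 10 (by omega) (by omega)] using hget
    · simp [Prog.exec, Memory.setReg_reg, Expr.eval, h3]
    · simp [Prog.exec, Memory.setReg_reg, hy]
    refine HaltsIn.seq' _ 20 (by omega) (resolveProg_spec h hA hM.isPath le_rfl hxi M₂
      (fun a p1 p2 => by rw [a2]; exact hK a p1 p2) b7 b8
      (fun q hq => by rw [a2, ha _ (by omega)]; exact hM.graphs q hq)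
      (fun q hq => by rw [a2, ha _ (by omega)]; exact hM.steps q hq)
      (fun q hq => by rw [a2, ha _ (by omega)]; exact hM.bases q hq)) fun M₃ ⟨a3, b9, f3⟩ => ?_
    have hO3 : Outputs M₃ ((X.take i).map (S.pathMap w r)) :=
      hO.congr ((f3 10 (by omega)).trans (f2 10 (by omega))) (by rw [a3, a2])
    have c11 : M₃.reg 11 = i := ((f3 11 (by omega)).trans (f2 11 (by omega))).trans h11
    refine (HaltsIn.exec rfl ?_).mono (by decide) fun _ h => h
    refine ⟨fun a h0 => ?_, fun y hy => ?_, ?_, ?_⟩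
    · simp [emitProg, Prog.exec, Memory.setArr_arr, h0, a3, a2, ha a h0]
    · simp [emitProg, Prog.exec, Memory.setReg_reg, show y ≠ 11 by omega, show y ≠ 10 by omega,
        f3 y (.inl hy), f2 y (by omega), hf y hy]
    · simp [emitProg, Prog.exec, Memory.setReg_reg, Expr.eval, c11]
    · have := hO3.emit b9
      rw [show (X.take i).map (S.pathMap w r) ++ [S.pathMap w r X[i]] =
        (X.take (i + 1)).map (S.pathMap w r) by
          rw [List.take_succ_eq_append_getElem hi, List.map_append]; rfl] at this
      refine this.congr ?_ rfl
      simp [Prog.exec, Memory.setReg_reg]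
  · simp only [Expr.cost, get2]
    have : r * 40 + 80 + (1 + (1 + 1 + 1 + 1 + 1) + 1) + 1 ≤ r * 40 + 100 := by omega
    have := Nat.mul_le_mul_left X.length this
    omega
  · exact fun a h1 h2 => by rw [ha a (by omega)]; exact hM.keeps a h1 h2

theorem intProg_spec {o : ℕ} (ho : 20 ≤ o) (ho' : o < 90)
    (hL : S.InLists o A) {g v b : ℕ} (hg : g ≤ S.last) (hv : S.IsNode g v) (M : Memory)
    (hK : Keeps A M) (h1 : M.reg 1 = g) (h4 : M.reg 4 = v) (h2 : M.reg 2 = b) (h11 : M.reg 11 = 0)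
    {O : List ℕ} (hO : Outputs M O) :
    HaltsIn (intProg o) M ((S.intNbrs g v).length * 40 + 20) fun M' =>
      (∀ a, a ≠ 0 → M'.arr a = M.arr a) ∧ (∀ y, y < 9 ∨ 11 < y → M'.reg y = M.reg y) ∧
      Outputs M' (O ++ (S.intNbrs g v).map fun u => b + S.ix g u) := by
  set X := S.intNbrs g v with hX
  let I : ℕ → Memory → Prop := fun i M' => (∀ a, a ≠ 0 → M'.arr a = M.arr a) ∧
    (∀ y, y < 9 ∨ 11 < y → M'.reg y = M.reg y) ∧ M'.reg 11 = i ∧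
    Outputs M' (O ++ (X.take i).map fun u => b + S.ix g u)
  have hlen := hL.int_length _ hg v hv
  refine (HaltsIn.for X.length 30 I ⟨fun _ _ => rfl, fun _ _ => rfl, h11, by simpa⟩
    ?_ ?_).mono ?_ fun M' ⟨ha, hf, _, hO⟩ => ⟨ha, hf, by simpa using hO⟩
  · rintro M' ⟨ha, hf, h11, -⟩
    simp [Expr.eval, get2, h11, hf 1, hf 4, ha, h1, h4, show o ≠ 0 by omega, hK o (by omega) (by omega),
      hK 10 (by omega) (by omega), hlen, hX]
  · rintro i hi M' ⟨ha, hf, h11, hO⟩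
    have e1 := (hf 1 (by omega)).trans h1
    have e2 := (hf 2 (by omega)).trans h2
    have e4 := (hf 4 (by omega)).trans h4
    have hget := hL.int_get _ hg v hv i hi
    refine ⟨by simp [Expr.eval, get2, h11, e1, e4, ha, show o ≠ 0 by omega, hK o (by omega) (by omega),
      hK 10 (by omega) (by omega), hlen, ← hX, hi], ?_⟩
    refine HaltsIn.seq' (Q := fun M₂ => M₂.arr = M'.arr ∧ M₂.reg 9 = b + S.ix g X[i] ∧
      ∀ y, y ≠ 9 → M₂.reg y = M'.reg y) 15 15 (by omega)
      ((HaltsIn.exec (P := .setReg _ (.add _ _)) rfl ⟨rfl, ?_, fun y hy => ?_⟩).mono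
        (by simp [Prog.time, Expr.cost, get3]) fun _ h => h)
      fun M₂ ⟨a2, b9, f2⟩ => ?_
    · simpa [Prog.exec, Memory.setReg_reg, Expr.eval, get3, h11, e1, e2, e4, ha, 
        hK (o + 1) (by omega) (by omega), hK 10 (by omega) (by omega)] using hget
    · simp [Prog.exec, Memory.setReg_reg, hy]
    have hO2 := hO.congr (f2 10 (by omega)) (by rw [a2])
    refine (HaltsIn.exec rfl ?_).mono (by decide) fun _ h => h
    refine ⟨fun a h0 => ?_, fun y hy => ?_, ?_, ?_⟩
    · simp [emitProg, Prog.exec, Memory.setArr_arr, h0, a2, ha a h0]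
    · simp [emitProg, Prog.exec, Memory.setReg_reg, show y ≠ 11 by omega, show y ≠ 10 by omega,
        f2 y (by omega), hf y hy]
    · simp [emitProg, Prog.exec, Memory.setReg_reg, Expr.eval, f2, h11]
    · have := hO2.emit b9
      rw [List.append_assoc, show ((X.take i).map fun u => b + S.ix g u) ++ [b + S.ix g X[i]] =
        (X.take (i + 1)).map (fun u => b + S.ix g u) by
          rw [List.take_succ_eq_append_getElem hi, List.map_append]; rfl] at this
      refine this.congr ?_ rfl
      simp [Prog.exec, Memory.setReg_reg]
  · simp only [Expr.cost, get2]
    omega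

theorem Stacked.congr {M M' : Memory} {L} (hL : Stacked M L) (h12 : M'.reg 12 = M.reg 12)
    (h104 : M'.arr 104 = M.arr 104) (h105 : M'.arr 105 = M.arr 105)
    (h106 : M'.arr 106 = M.arr 106) : Stacked M' L :=
  ⟨h12.trans hL.1, fun i hi => by rw [h104, h105, h106]; exact hL.2 i hi⟩

theorem pushProg_spec (hA : S.InTables A) {o : ℕ} (ho : 20 ≤ o) (ho' : o < 90)
    (hL : S.InLists o A) {g v b : ℕ} (hg : g ≤ S.last) (hv : S.IsNode g v) (M : Memory)
    (hK : Keeps A M) (h1 : M.reg 1 = g) (h4 : M.reg 4 = v) (h2 : M.reg 2 = b) (h11 : M.reg 11 = 0)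
    {L} (hSt : Stacked M L) :
    HaltsIn (pushProg o) M ((S.branches g v).length * 80 + 20) fun M' =>
      Keeps A M' ∧ M'.arr 0 = M.arr 0 ∧ M'.reg 10 = M.reg 10 ∧
      Stacked M' (L ++ (S.branches g v).map fun s => (S.ch g s, S.dn g s v, b + S.pre g s)) := by
  set X := S.branches g v with hX
  let I : ℕ → Memory → Prop := fun i M' => (∀ a, a < 104 → M'.arr a = M.arr a) ∧
    (∀ y, y = 1 ∨ y = 2 ∨ y = 4 ∨ y = 10 → M'.reg y = M.reg y) ∧ M'.reg 11 = i ∧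
    Stacked M' (L ++ (X.take i).map fun s => (S.ch g s, S.dn g s v, b + S.pre g s))
  have hlen := hL.branch_length _ hg v hv
  refine (HaltsIn.for X.length 60 I ⟨fun _ _ => rfl, fun _ _ => rfl, h11, by simpa⟩
    ?_ ?_).mono ?_ fun M' ⟨ha, hf, _, hO⟩ =>
      ⟨fun a p1 p2 => by rw [ha a (by omega)]; exact hK a p1 p2, ha 0 (by omega), hf 10 (by omega),
        by simpa using hO⟩
  · rintro M' ⟨ha, hf, h11, -⟩
    simp [Expr.eval, get2, h11, hf 1, hf 4, ha, h1, h4, ha (o + 4) (by omega), hK (o + 4) (by omega) (by omega),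
      hK 10 (by omega) (by omega), hlen, hX]
  · rintro i hi M' ⟨ha, hf, h11, hO⟩
    have e1 := (hf 1 (by omega)).trans h1
    have e2 := (hf 2 (by omega)).trans h2
    have e4 := (hf 4 (by omega)).trans h4
    have hget := hL.branch_get _ hg v hv i hi
    have hK' : Keeps A M' := fun a p1 p2 => by rw [ha a (by omega)]; exact hK a p1 p2
    refine ⟨by simp [Expr.eval, get2, h11, e1, e4, hK' (o + 4) (by omega) (by omega),
      hK' 10 (by omega) (by omega), hlen, ← hX, hi], ?_⟩
    have hmem : X[i] ∈ X := List.getElem_mem _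
    obtain ⟨_, hs, -⟩ := mem_branches.1 hmem
    have k5 : A (o + 5) (A 10 (A 10 g + v) + i) = X[i] := hget
    have kch := hA.ch g hg _ hs
    have kdn := hA.dn g hg _ hs v hv
    have kpre := hA.pre g hg _ hs
    have K10 := hK' 10 (by omega) (by omega)
    have K12 := hK' 12 (by omega) (by omega)
    have K18 := hK' 18 (by omega) (by omega)
    have K19 := hK' 19 (by omega) (by omega)
    have Ko := hK' (o + 5) (by omega) (by omega)
    have hsp := hO.1
    refine (HaltsIn.exec rfl ?_).mono (by simp [Prog.time, Expr.cost, get3, get2]) fun _ h => h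
    have eval5 : Expr.eval M' (get3 (o + 5) (.reg 1) (.reg 4) (.reg 11)) = X[i] := by
      simp [get3, Expr.eval, h11, e1, e4, K10, Ko, k5]
    simp only [Prog.exec, eval5]
    generalize hgs : X[i] = s at *
    have hLL : (L ++ (X.take (i + 1)).map fun s => (S.ch g s, S.dn g s v, b + S.pre g s)) =
        (L ++ (X.take i).map fun s => (S.ch g s, S.dn g s v, b + S.pre g s)) ++
        [(S.ch g s, S.dn g s v, b + S.pre g s)] := by
      rw [List.take_succ_eq_append_getElem hi, List.map_append, ← List.append_assoc, hgs]
      rfl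
    refine ⟨fun a h0 => ?_, fun y hy => ?_, ?_, ?_⟩
    · simp [Memory.setArr_arr, show a ≠ 104 by omega, show a ≠ 105 by omega,
        show a ≠ 106 by omega, ha a h0]
    · have hy' : y ≠ 11 ∧ y ≠ 12 ∧ y ≠ 5 := by omega
      simp [Memory.setReg_reg, hy'.1, hy'.2.1, hy'.2.2, hf y hy]
    · simp [Memory.setReg_reg, Expr.eval, h11]
    · rw [hLL]
      generalize (L ++ (X.take i).map fun s => (S.ch g s, S.dn g s v, b + S.pre g s)) = P at *
      refine ⟨by simp [Memory.setReg_reg, Expr.eval, hsp], fun j hj => ?_⟩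
      have hj' := hj
      rw [List.length_append, List.length_singleton] at hj'
      rcases Nat.lt_succ_iff_lt_or_eq.1 hj' with hj2 | rfl
      · rw [List.getElem_append_left hj2]
        obtain ⟨p1, p2, p3⟩ := hO.2 j hj2
        rw [← p1, ← p2, ← p3]
        simp [Memory.setReg_reg, Memory.setArr_arr_apply, Expr.eval, hsp, hj2.ne]
      · rw [List.getElem_append_right le_rfl]
        simp [Memory.setReg_reg, Memory.setArr_arr_apply, Expr.eval, hsp, get2, get3, e1, e2, e4,
          K10, K12, K18, K19, kch, kdn, kpre]
  · simp only [Expr.cost, get2]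
    omega

/-- The part of the output that an entry of the stack stands for. -/
def workOut (S : RuleSystem) (x : ℕ × ℕ × ℕ) : List ℕ := S.out x.1 x.2.1 x.2.2

/-- A bound on the time for an entry of the stack. -/
def workCost (S : RuleSystem) (x : ℕ × ℕ × ℕ) : ℕ :=
  (1 + S.dp x.1) * max 1 (S.ne x.1 x.2.1)

/-- The amortization. Every branch has nonzero `ne`, so there are at most as many branches as
neighbors below them, and the cost of a branch is its `ne` times a factor `1 + dp` that is at most
`dp g`. The unit of depth gained pays for the present entry. An entry without neighbors has no
branches, and its constant cost is covered by the `max 1`. -/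
theorem workCost_branches (h : S.WF) {g v b : ℕ} (hg : g ≤ S.last) :
    (S.intNbrs g v).length + (S.branches g v).length + 1 +
      2 * (((S.branches g v).map fun s => (S.ch g s, S.dn g s v, b + S.pre g s)).map
        (workCost S)).sum ≤ 2 * workCost S (g, v, b) := by
  have hlen : S.ne g v = (S.intNbrs g v).length +
      ((S.branches g v).map fun s => S.ne (S.ch g s) (S.dn g s v)).sum := by
    rw [← length_out h hg v 0, out_eq h hg, List.length_append, List.length_map,
      List.length_flatMap]
    congr 2
    refine List.map_congr_left fun s hs => ?_
    exact length_out h (h.ch_le g hg s (mem_branches.1 hs).2.1) _ _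
  have hbr : (S.branches g v).length ≤
      ((S.branches g v).map fun s => S.ne (S.ch g s) (S.dn g s v)).sum := by
    have := List.card_nsmul_le_sum ((S.branches g v).map fun s => S.ne (S.ch g s) (S.dn g s v)) 1
      (fun x hx => by
        obtain ⟨s, hs, rfl⟩ := List.mem_map.1 hx
        have := (mem_branches.1 hs).2.2.2
        omega)
    simpa using this
  have hcost : (((S.branches g v).map fun s => (S.ch g s, S.dn g s v, b + S.pre g s)).map
        (workCost S)).sum ≤ S.dp g *
      ((S.branches g v).map fun s => S.ne (S.ch g s) (S.dn g s v)).sum := by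
    rw [List.map_map, ← List.sum_map_mul_left]
    refine List.sum_le_sum fun s hs => ?_
    obtain ⟨_, hs, _, h0⟩ := mem_branches.1 hs
    have := h.dp_lt g hg s hs
    simp only [Function.comp, workCost]
    exact Nat.mul_le_mul (by omega) (by omega)
  generalize (((S.branches g v).map fun s => (S.ch g s, S.dn g s v, b + S.pre g s)).map
        (workCost S)).sum = c at *
  generalize ((S.branches g v).map fun s => S.ne (S.ch g s) (S.dn g s v)).sum = m at *
  simp only [workCost]
  rcases Nat.eq_zero_or_pos (S.ne g v) with h0 | h0
  · have : m = 0 := by omega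
    subst this
    rw [h0]
    simp at hcost ⊢
    omega
  · rw [max_eq_right (by omega), hlen]
    nlinarith [Nat.zero_le (S.dp g * (S.intNbrs g v).length)]

/-- The potential is the total `workCost` of the stack: replacing the top entry by its branches
lowers it enough to pay for the round. The last branch is treated first, so the output is determined
only up to permutation. -/
theorem workProg_spec (h : S.WF) (hA : S.InTables A) {o : ℕ} (ho : 20 ≤ o) (ho' : o < 90)
    (hL : S.InLists o A) (M : Memory) (hK : Keeps A M) {O St}
    (hSt : ∀ x ∈ St, x.1 ≤ S.last ∧ S.IsNode x.1 x.2.1) (hS : Stacked M St) (hO : Outputs M O) :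
    HaltsIn (workProg o) M (200 * (St.map (workCost S)).sum + 10) fun M' =>
      ∃ O', O'.Perm (O ++ St.flatMap (workOut S)) ∧ Outputs M' O' := by
  let I : ℕ → Memory → Prop := fun φ M' => Keeps A M' ∧ ∃ O' St',
    φ = 200 * (St'.map (workCost S)).sum + 10 ∧ (∀ x ∈ St', x.1 ≤ S.last ∧ S.IsNode x.1 x.2.1) ∧
    Stacked M' St' ∧ Outputs M' O' ∧
    (O' ++ St'.flatMap (workOut S)).Perm (O ++ St.flatMap (workOut S))
  refine HaltsIn.loop I ?_ _ M ⟨hK, O, St, rfl, hSt, hS, hO, .refl _⟩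
  rintro φ M' ⟨hK, O', St', rfl, hSt, hS, hO, hperm⟩
  rcases List.eq_nil_or_concat St' with rfl | ⟨St', ⟨g, v, b⟩, rfl⟩
  · exact .inl ⟨by simp [Expr.eval, hS.1], ⟨O', by simpa using hperm, hO⟩, by simp [Expr.cost]⟩
  · right
    rw [List.concat_eq_append] at *
    obtain ⟨hg, hv⟩ := hSt (g, v, b) (by simp)
    simp only at hg hv
    obtain ⟨t1, t2, t3⟩ := hS.2 St'.length (by simp)
    simp only [List.getElem_concat_length] at t1 t2 t3
    have h12 : M'.reg 12 = St'.length + 1 := by simpa using hS.1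
    refine ⟨by simp [Expr.eval, h12],
      30 + ((S.intNbrs g v).length * 40 + 20 + (2 + ((S.branches g v).length * 80 + 20))),
      200 * ((St' ++ (S.branches g v).map fun s =>
        (S.ch g s, S.dn g s v, b + S.pre g s)).map (workCost S)).sum + 10, ?_, ?_⟩
    · have := workCost_branches (v := v) (b := b) h hg
      simp only [List.map_append, List.sum_append, Expr.cost, List.map_singleton,
        List.sum_singleton]
      omega
    refine HaltsIn.seq (Q := fun M₁ => M₁.arr = M'.arr ∧ M₁.reg 1 = g ∧ M₁.reg 4 = v ∧
      M₁.reg 2 = b ∧ M₁.reg 11 = 0 ∧ M₁.reg 12 = St'.length ∧ M₁.reg 10 = M'.reg 10)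
      ((HaltsIn.exec rfl ?_).mono (by decide) fun _ h => h)
      fun M₁ ⟨a1, r1, r4, r2, r11, r12, r10⟩ => ?_
    · simp [Prog.exec, Memory.setReg_reg, Expr.eval, h12, t1, t2, t3]
    have hK1 : Keeps A M₁ := fun a p1 p2 => by rw [a1]; exact hK a p1 p2
    have hS1 : Stacked M₁ St' := by
      refine ⟨r12, fun i hi => ?_⟩
      have := hS.2 i (by simp; omega)
      rw [List.getElem_append_left hi] at this
      rw [a1]
      exact this
    refine (intProg_spec ho ho' hL hg hv M₁ hK1 r1 r4 r2 r11 (hO.congr r10 (by rw [a1]))).seq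
      fun M₂ ⟨a2, f2, hO2⟩ => ?_
    refine HaltsIn.seq (Q := fun M₃ => M₃.arr = M₂.arr ∧ M₃.reg 11 = 0 ∧
      ∀ y, y ≠ 11 → M₃.reg y = M₂.reg y) ((HaltsIn.exec (P := .setReg 11 (.const 0)) rfl ?_).mono
        (by decide) fun _ h => h) fun M₃ ⟨a3, r11', f3⟩ => ?_
    · exact ⟨rfl, by simp [Prog.exec, Memory.setReg_reg, Expr.eval],
        fun y hy => by simp [Prog.exec, Memory.setReg_reg, hy]⟩
    refine (pushProg_spec (b := b) hA ho ho' hL hg hv M₃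
      (fun a p1 p2 => by rw [a3, a2 a (by omega)]; exact hK1 a p1 p2)
      (by rw [f3 1 (by omega), f2 1 (by omega), r1]) (by rw [f3 4 (by omega), f2 4 (by omega), r4])
      (by rw [f3 2 (by omega), f2 2 (by omega), r2]) r11'
      (hS1.congr (by rw [f3 12 (by omega), f2 12 (by omega)]) (by rw [a3, a2 104 (by omega)])
        (by rw [a3, a2 105 (by omega)]) (by rw [a3, a2 106 (by omega)]))).mono le_rfl
      fun M₄ ⟨hK4, a4, r10', hS4⟩ => ?_
    refine ⟨hK4, _, _, rfl, ?_, hS4, hO2.congr (by rw [r10', f3 10 (by omega)]) (by rw [a4, a3]), ?_⟩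
    · intro x hx
      rcases List.mem_append.1 hx with hx | hx
      · exact hSt x (by simp [hx])
      · obtain ⟨s, hs, rfl⟩ := List.mem_map.1 hx
        obtain ⟨_, hs, hd, _⟩ := mem_branches.1 hs
        have hc := h.ch_le g hg s hs
        exact ⟨hc, h.node_of_xt _ hc _ (h.xt_dn g hg s hs v hd)⟩
    · refine List.Perm.trans ?_ hperm
      have e : workOut S (g, v, b) = (S.intNbrs g v).map (fun u => b + S.ix g u) ++
          ((S.branches g v).map fun s => (S.ch g s, S.dn g s v, b + S.pre g s)).flatMap
            (workOut S) := by
        rw [workOut, out_eq h hg, List.flatMap_map]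
        rfl
      rw [List.flatMap_append, List.flatMap_append, List.flatMap_singleton, e, List.append_assoc]
      refine List.Perm.append_left _ ?_
      rw [← List.append_assoc, ← List.append_assoc]
      exact List.Perm.append_right _ List.perm_append_comm

/-- External neighbors cost a climb of at most `dp 0` levels each, the younger ones are charged by
`workCost` of the single initial entry. The output has one entry for each neighbor of either kind,
so both costs are within the product of the depth bound and `max 1 L.length`. -/
theorem nbrProg_spec (h : S.WF) (hA : S.InTables A) {o : ℕ} (ho : 20 ≤ o) (ho' : o < 90)
    (hL : S.InLists o A)
    (hns : ∀ g ≤ S.last, S.dp g < S.dp 0 → S.ns g ≤ 2) {k : ℕ} (hk1 : 1 ≤ k) (hk : k ≤ S.sz 0)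
    (M : Memory) (hM : Keeps A M) :
    ∃ L : List ℕ, L.Nodup ∧ (∀ x, x ∈ L ↔ S.Edge 0 (S.ix 0) 0 x k) ∧
      Answers (nbrProg o) M k
        (700 * ((1 + Nat.log 2 (S.ns 0) + S.dp 0) * max 1 L.length)) L := by
  obtain ⟨t₁, ht₁, M₁, hr₁, w, r, v, hl, hkv⟩ := locateProg_spec h hA hns hk1 hk (M.setReg 0 k)
    (fun a ha hb => hM a ha hb) (by simp [Memory.setReg_reg])
  have hw := hl.isPath
  have hg := pathGraph_le h hw r le_rfl
  obtain ⟨hnd, hmem⟩ := inNeighbors_list h hw hl.isInt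
  rw [hkv] at hmem
  set g := S.pathGraph w r with hgg
  set b := S.pathBase w r with hbb
  set X := (S.extNbrs g v).map (S.pathMap w r) with hX
  obtain ⟨t₂, ht₂, M₂, hr₂, hl₂, h10, h11⟩ :
      HaltsIn (.seq (.setReg 10 (.const 0)) (.setReg 11 (.const 0))) M₁ 4 fun M' =>
        Located S A w r v M' ∧ M'.reg 10 = 0 ∧ M'.reg 11 = 0 := by
    refine HaltsIn.exec rfl ⟨⟨hl.keeps, hw, hl.isInt, ?_, ?_, ?_, ?_, hl.output, hl.graphs, hl.steps,
      hl.bases⟩, ?_, ?_⟩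
    · simp [Prog.exec, Memory.setReg_reg, hl.graph]
    · simp [Prog.exec, Memory.setReg_reg, hl.base]
    · simp [Prog.exec, Memory.setReg_reg, hl.depth]
    · simp [Prog.exec, Memory.setReg_reg, hl.node]
    · simp [Prog.exec, Memory.setReg_reg, Expr.eval]
    · simp [Prog.exec, Memory.setReg_reg, Expr.eval]
  obtain ⟨t₃, ht₃, M₃, hr₃, hK₃, f₃, hO₃⟩ := extProg_spec h hA ho ho' hL M₂ hl₂
    ⟨by simp [h10], by simp⟩ h11
  obtain ⟨t₄, ht₄, M₄, hr₄, hK₄, hS₄, hO₄⟩ :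
      HaltsIn (.seq (.setArr 104 (.const 0) (.reg 1)) <| .seq (.setArr 105 (.const 0) (.reg 4)) <|
        .seq (.setArr 106 (.const 0) (.reg 2)) (.setReg 12 (.const 1))) M₃ 20 fun M' =>
        Keeps A M' ∧ Stacked M' [(g, v, b)] ∧ Outputs M' X := by
    refine (HaltsIn.exec rfl ⟨fun a p1 p2 => ?_, ⟨?_, fun i hi => ?_⟩, hO₃.congr ?_ ?_⟩).mono
      (by decide) fun _ h => h
    · simp [Prog.exec, Memory.setArr_arr, show a ≠ 104 by omega, show a ≠ 105 by omega,
        show a ≠ 106 by omega, hK₃ a p1 p2]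
    · simp [Prog.exec, Memory.setReg_reg, Expr.eval]
    · obtain rfl : i = 0 := by simpa using hi
      simp [Prog.exec, Memory.setArr_arr, Expr.eval, f₃, hl₂.graph, hl₂.node, hl₂.base, hgg, hbb]
    · simp [Prog.exec, Memory.setReg_reg]
    · simp [Prog.exec, Memory.setArr_arr]
  obtain ⟨t₅, ht₅, M₅, hr₅, L, hL₅, hO₅⟩ := workProg_spec h hA ho ho' hL M₄ hK₄
    (by simpa using ⟨hg, hl.isInt.1⟩) hS₄ hO₄
  rw [List.flatMap_singleton, workOut] at hL₅
  refine ⟨L, hL₅.nodup_iff.2 hnd, fun x => hL₅.mem_iff.trans (hmem x), _, ?_, _,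
    .seq hr₁ (.seq hr₂ (.seq hr₃ (.seq hr₄ (.seq hr₅ (.setReg M₅ 0 (.reg 10)))))), ?_, hO₅.2⟩
  · have hlen : L.length = (S.extNbrs g v).length + S.ne g v := by
      rw [hL₅.length_eq, List.length_append, length_out h hg, hX, List.length_map]
    have hx1 : 1 ≤ 1 + Nat.log 2 (S.ns 0) + S.dp 0 := by omega
    have hdp := dp_pathGraph h hw r le_rfl
    rw [← hgg] at hdp ht₃
    simp only [List.map_singleton, List.sum_singleton, workCost] at ht₅
    generalize hx : 1 + Nat.log 2 (S.ns 0) + S.dp 0 = x at *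
    have e1 : (S.extNbrs g v).length * (r * 40 + 100) ≤ x * L.length * 100 := by
      rw [hlen]
      calc _ ≤ (S.extNbrs g v).length * (x * 100) := Nat.mul_le_mul_left _ (by omega)
        _ = x * (S.extNbrs g v).length * 100 := by ring
        _ ≤ _ := Nat.mul_le_mul_right _ (Nat.mul_le_mul_left _ (by omega))
    have e2 : (1 + S.dp g) * max 1 (S.ne g v) ≤ x * max 1 L.length :=
      Nat.mul_le_mul (by omega) (by omega)
    have e3 : x * L.length ≤ x * max 1 L.length := Nat.mul_le_mul_left _ (by omega)
    have e4 : x ≤ x * max 1 L.length := Nat.le_mul_of_pos_right _ (by omega)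
    simp only [Expr.cost]
    omega
  · simp [Memory.setReg_reg, Expr.eval, hO₅.1]

end RAM

/-! ## The rule system of a grammar -/

namespace SLHRGrammar

variable (G : SLHRGrammar)

/-! ### Heights -/

/-- By acyclicity a chain repeats no nonterminal. This bounds the sets whose suprema define the
heights; without it `sSup` would be a meaningless default value. -/
theorem length_le_card_of_isChain {p : List ℕ} (hp : ∀ A ∈ p, A ∈ G.N) (hc : p.IsChain G.Dep) :
    p.length ≤ G.N.card := by
  have h1 : p.IsChain (Relation.TransGen G.Dep) := hc.imp fun _ _ h => .single h
  have h2 : p.Nodup := h1.pairwise.imp fun {a b} hab => by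
    rintro rfl
    exact G.acyclic a hab
  rw [← List.toFinset_card_of_nodup h2]
  exact Finset.card_le_card fun A hA => hp A (List.mem_toFinset.1 hA)

/-- The number of steps in a longest chain of nonterminals that starts with `A`. -/
noncomputable def heightFrom (A : ℕ) : ℕ :=
  sSup {m | ∃ p : List ℕ, p.length = m ∧ (∀ B ∈ A :: p, B ∈ G.N) ∧ (A :: p).IsChain G.Dep}

theorem exists_chain {A : ℕ} (hA : A ∈ G.N) : ∃ p : List ℕ, p.length = G.heightFrom A ∧
    (∀ B ∈ A :: p, B ∈ G.N) ∧ (A :: p).IsChain G.Dep := by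
  refine Nat.sSup_mem (s := {m | ∃ p : List ℕ, p.length = m ∧ (∀ B ∈ A :: p, B ∈ G.N) ∧
    (A :: p).IsChain G.Dep}) ⟨0, [], rfl, by simpa using hA, by simp⟩ ⟨G.N.card, ?_⟩
  rintro m ⟨p, rfl, hp, hc⟩
  have := G.length_le_card_of_isChain hp hc
  rw [List.length_cons] at this
  omega

theorem le_heightFrom {A : ℕ} {p : List ℕ} (hp : ∀ B ∈ A :: p, B ∈ G.N)
    (hc : (A :: p).IsChain G.Dep) : p.length ≤ G.heightFrom A := by
  refine le_csSup ⟨G.N.card, ?_⟩ ⟨p, rfl, hp, hc⟩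
  rintro m ⟨p, rfl, hp, hc⟩
  have := G.length_le_card_of_isChain hp hc
  rw [List.length_cons] at this
  omega

theorem bddAbove_height :
    BddAbove {m | ∃ p : List ℕ, p.length = m + 1 ∧ (∀ A ∈ p, A ∈ G.N) ∧ p.IsChain G.Dep} := by
  refine ⟨G.N.card, ?_⟩
  rintro m ⟨p, hm, hp, hc⟩
  have := G.length_le_card_of_isChain hp hc
  omega

theorem heightFrom_le {A : ℕ} (hA : A ∈ G.N) : G.heightFrom A ≤ G.height := by
  obtain ⟨p, hl, hp, hc⟩ := G.exists_chain hA
  exact le_csSup G.bddAbove_height ⟨A :: p, by simp [hl], hp, hc⟩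

theorem heightFrom_lt {A B : ℕ} (h : G.Dep A B) : G.heightFrom B < G.heightFrom A := by
  obtain ⟨p, hl, hp, hc⟩ := G.exists_chain h.2.1
  have := G.le_heightFrom (A := A) (p := B :: p)
    (by
      intro C hC
      rcases List.mem_cons.1 hC with rfl | hC
      · exact h.1
      · exact hp C hC) (List.isChain_cons_cons.2 ⟨h, hc⟩)
  rw [List.length_cons] at this
  omega

theorem height_le_card : G.height ≤ G.N.card := by
  rw [height]
  rcases Set.eq_empty_or_nonempty
    {m | ∃ p : List ℕ, p.length = m + 1 ∧ (∀ A ∈ p, A ∈ G.N) ∧ p.IsChain G.Dep} with h | h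
  · rw [h]; simp
  · obtain ⟨p, hm, hp, hc⟩ := Nat.sSup_mem h G.bddAbove_height
    have := G.length_le_card_of_isChain hp hc
    omega

theorem heightFrom_lt_card {A : ℕ} (hA : A ∈ G.N) : G.heightFrom A < G.N.card := by
  obtain ⟨p, hl, hp, hc⟩ := G.exists_chain hA
  have := G.length_le_card_of_isChain hp hc
  rw [List.length_cons] at this
  omega

/-! ### The graphs of a grammar -/

/-- The graphs of the grammar: the start graph (all nodes of which count as internal) and the
right-hand sides. -/
def graph : ℕ → HyperGraph
  | 0 => { G.start with ext := [] }
  | g + 1 => G.rhs (G.N.sort.getD g 0)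

/-- The number of the right-hand side for the label of an edge. -/
def childOf (e : HREdge) : ℕ := G.N.sort.idxOf e.lab + 1

/-- The nonterminal edge `s` of the graph `g`. -/
def ntEdge (g s : ℕ) : HREdge := (G.sib (G.graph g)).getD s (toLex ([], 0))

/-- The string `u v`, or `v u` if `fl` holds. -/
def pairString (fl : Bool) (u v : ℕ) : List ℕ := if fl then [v, u] else [u, v]

/-- The rule system of a grammar.  If `fl` holds, all edges between two nodes are reversed. -/
noncomputable def ruleSystem (B : ℕ) (fl : Bool) : RuleSystem where
  last := G.N.card
  bound := B
  nn g := (G.graph g).numNodes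
  ns g := (G.sib (G.graph g)).length
  ch g s := G.childOf (G.ntEdge g s)
  xt g v := if v ∈ (G.graph g).ext then 1 else 0
  up g s x := (G.ntEdge g s).att.getD ((G.graph (G.childOf (G.ntEdge g s))).ext.idxOf x) 0
  dn g s v := if v ∈ (G.ntEdge g s).att then
    (G.graph (G.childOf (G.ntEdge g s))).ext.getD ((G.ntEdge g s).att.idxOf v) 0 else 0
  tt g u v := (G.terminals (G.graph g)).countP fun e => e.att = pairString fl u v
  dp g := if g = 0 then G.height + 1 else G.heightFrom (G.N.sort.getD (g - 1) 0)

variable {G}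

theorem sort_getD_mem {g : ℕ} (hg : g < G.N.card) : G.N.sort.getD g 0 ∈ G.N := by
  have : g < G.N.sort.length := by rwa [Finset.length_sort]
  rw [List.getD_eq_getElem _ _ this]
  exact (Finset.mem_sort _).1 (List.getElem_mem _)

theorem graph_isOver {g : ℕ} (hg : g ≤ G.N.card) :
    (G.graph g).IsOver (Set.Icc 1 G.σ ∪ G.N) G.rank := by
  cases g with
  | zero =>
    have h := G.start_isOver
    exact ⟨h.1, h.2, h.3, h.4, h.5, h.6, by simp [graph], by simp [graph]⟩
  | succ g => exact G.rhs_isOver _ (sort_getD_mem hg)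

theorem ntEdge_mem {g s : ℕ} (hs : s < (G.sib (G.graph g)).length) :
    G.ntEdge g s ∈ (G.graph g).edges ∧ (G.ntEdge g s).lab ∈ G.N := by
  have : G.ntEdge g s ∈ G.sib (G.graph g) := by
    rw [ntEdge, List.getD_eq_getElem _ _ hs]
    exact List.getElem_mem _
  simpa [sib] using this

theorem childOf_le {e : HREdge} (he : e.lab ∈ G.N) : G.childOf e ≤ G.N.card := by
  have := List.idxOf_lt_length_iff.2 ((Finset.mem_sort (· ≤ ·)).2 he)
  rw [Finset.length_sort] at this
  exact this

theorem sort_getD_idxOf {A : ℕ} (hA : A ∈ G.N) : G.N.sort.getD (G.N.sort.idxOf A) 0 = A := by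
  have := List.idxOf_lt_length_iff.2 ((Finset.mem_sort (· ≤ ·)).2 hA)
  rw [List.getD_eq_getElem _ _ this]
  exact List.getElem_idxOf this

theorem graph_childOf {e : HREdge} (he : e.lab ∈ G.N) : G.graph (G.childOf e) = G.rhs e.lab := by
  rw [childOf, graph, sort_getD_idxOf he]

/-- Attachment string and external string are free of repetitions and of equal length, the rank, so
matching their positions makes `up` and `dn` mutually inverse. Nodes are positive, which makes zero
available as the value of `dn` off its domain. The depth of the start graph, `height + 1`, exceeds
that of every right-hand side. -/
theorem ruleSystem_wf {B : ℕ} (hB : G.N.card + 2 ≤ B)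
    (hnn : ∀ g ≤ G.N.card, (G.graph g).numNodes < B)
    (hns : ∀ g ≤ G.N.card, (G.sib (G.graph g)).length ≤ B) (fl : Bool) :
    (G.ruleSystem B fl).WF := by
  have hlen : ∀ g ≤ G.N.card, ∀ s < (G.sib (G.graph g)).length,
      (G.graph (G.childOf (G.ntEdge g s))).ext.length = (G.ntEdge g s).att.length := by
    intro g hg s hs
    obtain ⟨h1, h2⟩ := ntEdge_mem hs
    rw [graph_childOf h2, G.rank_rhs _ h2, (graph_isOver hg).length_att _ h1]
  have hxt : ∀ g x, (G.ruleSystem B fl).xt g x ≠ 0 ↔ x ∈ (G.graph g).ext := by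
    intro g x
    simp [ruleSystem]
  have hdn : ∀ g s v, (G.ruleSystem B fl).dn g s v ≠ 0 → v ∈ (G.ntEdge g s).att := by
    intro g s v h
    by_contra hv
    simp [ruleSystem, hv] at h
  refine ⟨hnn, hns, ?_, ?_, ?_, ?_, ?_, ?_, ?_, ?_, ?_, ?_⟩
  · intro g hg
    have hg' : g ≤ G.N.card := hg
    show (if g = 0 then _ else _) < B
    have := G.height_le_card
    split_ifs with h0
    · omega
    · have := G.heightFrom_lt_card (sort_getD_mem (G := G) (g := g - 1) (by omega))
      omega
  · exact fun g hg s hs => childOf_le (ntEdge_mem hs).2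
  · intro g hg s hs
    have hg' : g ≤ G.N.card := hg
    obtain ⟨h1, h2⟩ := ntEdge_mem hs
    show (if G.childOf (G.ntEdge g s) = 0 then G.height + 1 else
      G.heightFrom (G.N.sort.getD (G.childOf (G.ntEdge g s) - 1) 0)) <
        (if g = 0 then G.height + 1 else G.heightFrom (G.N.sort.getD (g - 1) 0))
    rw [if_neg (by simp [childOf]), childOf, Nat.add_sub_cancel, sort_getD_idxOf h2]
    split_ifs with h0
    · have := G.heightFrom_le h2
      omega
    · obtain ⟨g, rfl⟩ : ∃ g', g = g' + 1 := ⟨g - 1, by omega⟩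
      exact G.heightFrom_lt ⟨sort_getD_mem (by omega), h2, _, h1, rfl⟩
  · exact fun g hg x hx => (graph_isOver hg).ext_mem x ((hxt g x).1 hx)
  · exact fun x => by simp [ruleSystem, graph]
  · intro g hg s hs x hx
    rw [hxt] at hx
    have hi := List.idxOf_lt_length_iff.2 hx
    refine (graph_isOver hg).att_mem _ (ntEdge_mem hs).1 _ ?_
    show List.getD _ _ _ ∈ _
    rw [List.getD_eq_getElem _ _ (by rw [← hlen g hg s hs]; exact hi)]
    exact List.getElem_mem _
  · intro g hg s hs x hx
    rw [hxt] at hx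
    have hi := List.idxOf_lt_length_iff.2 hx
    have hi' := hi
    erw [hlen g hg s hs] at hi'
    have hnd := (graph_isOver hg).att_nodup _ (ntEdge_mem hs).1
    have hup : (G.ruleSystem B fl).up g s x = (G.ntEdge g s).att[_]'hi' :=
      List.getD_eq_getElem _ _ hi'
    show (if (G.ruleSystem B fl).up g s x ∈ _ then _ else _) = x
    rw [hup, if_pos (List.getElem_mem _), hnd.idxOf_getElem]
    exact (List.getD_eq_getElem _ _ hi).trans (List.getElem_idxOf hi)
  · intro g hg s hs v hv
    rw [hxt]
    have hv' := hdn g s v hv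
    show (if v ∈ (G.ntEdge g s).att then _ else _) ∈ _
    have hi := List.idxOf_lt_length_iff.2 hv'
    rw [if_pos hv', List.getD_eq_getElem _ _ (by rw [hlen g hg s hs]; exact hi)]
    exact List.getElem_mem _
  · intro g hg s hs v hv
    have hv' := hdn g s v hv
    have hi := List.idxOf_lt_length_iff.2 hv'
    have hi' := hi
    rw [← hlen g hg s hs] at hi'
    have hnd := (graph_isOver (childOf_le (ntEdge_mem hs).2)).ext_nodup
    have hd : (G.ruleSystem B fl).dn g s v = (G.graph (G.childOf (G.ntEdge g s))).ext[_]'hi' :=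
      (if_pos hv').trans (List.getD_eq_getElem _ _ hi')
    show List.getD _ (List.idxOf ((G.ruleSystem B fl).dn g s v) _) 0 = v
    rw [hd, hnd.idxOf_getElem, List.getD_eq_getElem _ _ hi]
    exact List.getElem_idxOf hi
  · intro g hg u v h
    obtain ⟨e, he, hatt⟩ := List.countP_pos_iff.1 (Nat.pos_of_ne_zero h)
    have he' : e ∈ (G.graph g).edges := by
      have := List.mem_filter.1 he
      simpa using this.1
    have := (graph_isOver hg).att_mem e he'
    rw [decide_eq_true_eq] at hatt
    rw [hatt] at this
    cases fl
    · exact ⟨this u (by simp [pairString]), this v (by simp [pairString])⟩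
    · exact ⟨this u (by simp [pairString]), this v (by simp [pairString])⟩

end SLHRGrammar

/-! ### The nodes of the derived graph -/

namespace RuleSystem

variable {S : RuleSystem}

/-- The internal nodes in increasing order. -/
theorem filter_eq_map_inode (h : S.WF) {g : ℕ} (hg : g ≤ S.last) {m : ℕ} (hm : m ≤ S.nn g) :
    ((List.range m).map (· + 1)).filter (fun v => S.xt g v = 0) =
      (List.range (S.ix g m)).map fun i => S.inode g (i + 1) := by
  induction m with
  | zero => simp [ix_zero]
  | succ m ih =>
    have := h.nn_lt g hg
    rw [List.range_succ, List.map_append, List.filter_append, ih (by omega), ix_succ (by omega)]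
    by_cases h0 : S.xt g (m + 1) = 0
    · have hi := inode_ix h hg (v := m + 1) ⟨⟨by omega, hm⟩, h0⟩
      rw [ix_succ (by omega), if_pos h0] at hi
      simp [h0, List.range_succ, hi]
    · simp [h0]

variable (S) in
/-- The recursive equation for `created`. -/
def createdStep (f : ℕ → List ℕ → List (List ℕ × ℕ)) (g : ℕ) (p : List ℕ) : List (List ℕ × ℕ) :=
  ((List.range (S.ic g)).map fun i => (p, S.inode g (i + 1))) ++
    (List.range (S.ns g)).flatMap fun s => f (S.ch g s) (p ++ [s])

variable (S) in
/-- The nodes that are created by deriving from the graph `g`, which is reached by the path `p`. -/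
def created : ℕ → List ℕ → List (List ℕ × ℕ) := S.createdStep^[S.bound] fun _ _ => []

theorem created_eq (h : S.WF) {g : ℕ} (hg : g ≤ S.last) (p : List ℕ) :
    S.created g p = ((List.range (S.ic g)).map fun i => (p, S.inode g (i + 1))) ++
      (List.range (S.ns g)).flatMap fun s => S.created (S.ch g s) (p ++ [s]) := by
  have hd := h.dp_lt_bound g hg
  refine (congrFun (iterate_stable (V := fun g => g ≤ S.last) (dp := S.dp) (step := S.createdStep)
    (fun g hg f f' hff => ?_) S.bound (S.bound + 1) _ (fun _ _ => []) g hg hd (by omega)) p).trans ?_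
  · funext p
    unfold createdStep
    congr 1
    refine List.flatMap_congr fun s hs => ?_
    have hs := List.mem_range.1 hs
    rw [hff _ (h.ch_le g hg s hs) (h.dp_lt g hg s hs)]
  · rw [Function.iterate_succ_apply']
    rfl

theorem length_flatMap_range {α : Type*} (f : ℕ → List α) (n : ℕ) :
    ((List.range n).flatMap f).length = ∑ i ∈ Finset.range n, (f i).length := by
  induction n with
  | zero => simp
  | succ n ih => simp [List.range_succ, Finset.sum_range_succ, ih]

theorem getElem?_flatMap_range {α : Type*} (f : ℕ → List α) {n s i : ℕ} (hs : s < n)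
    (hi : i < (f s).length) :
    ((List.range n).flatMap f)[(∑ j ∈ Finset.range s, (f j).length) + i]? = (f s)[i]? := by
  induction n with
  | zero => omega
  | succ n ih =>
    rw [List.range_succ, List.flatMap_append, List.flatMap_singleton]
    rcases Nat.lt_succ_iff_lt_or_eq.1 hs with hs | rfl
    · rw [List.getElem?_append_left, ih hs]
      rw [length_flatMap_range]
      have : ∑ j ∈ Finset.range (s + 1), (f j).length ≤ ∑ j ∈ Finset.range n, (f j).length :=
        Finset.sum_le_sum_of_subset (Finset.range_mono hs)
      rw [Finset.sum_range_succ] at this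
      omega
    · rw [List.getElem?_append_right (by rw [length_flatMap_range]; omega), length_flatMap_range]
      congr 1
      omega

theorem length_created (h : S.WF) {g : ℕ} (hg : g ≤ S.last) (p : List ℕ) :
    (S.created g p).length = S.sz g := by
  induction hd : S.dp g using Nat.strong_induction_on generalizing g p with
  | _ d ih =>
    rw [created_eq h hg, sz_eq h hg, List.length_append, List.length_map, List.length_range,
      length_flatMap_range]
    congr 1
    refine Finset.sum_congr rfl fun s hs => ?_
    have hs := Finset.mem_range.1 hs
    exact ih _ (hd ▸ h.dp_lt g hg s hs) (h.ch_le g hg s hs) _ rfl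

theorem getElem?_created_child (h : S.WF) {g s i : ℕ} (hg : g ≤ S.last) (hs : s < S.ns g)
    (p : List ℕ) (hi : i < S.sz (S.ch g s)) :
    (S.created g p)[S.pre g s + i]? = (S.created (S.ch g s) (p ++ [s]))[i]? := by
  have hlen : ∀ j < S.ns g, (S.created (S.ch g j) (p ++ [j])).length = S.sz (S.ch g j) :=
    fun j hj => length_created h (h.ch_le g hg j hj) _
  rw [created_eq h hg, pre, List.getElem?_append_right (by simp; omega)]
  rw [← getElem?_flatMap_range (fun s => S.created (S.ch g s) (p ++ [s])) hs
    (by rw [hlen s hs]; exact hi)]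
  congr 1
  rw [Finset.sum_congr rfl fun j hj => hlen j ((Finset.mem_range.1 hj).trans hs)]
  simp
  omega

/-- In the pre-order list the subderivation reached by a path is a contiguous segment that starts
after `pathBase` entries, and the internal nodes of its graph come first. The `- 1` reconciles IDs
from one with list positions from zero. -/
theorem getElem?_created (h : S.WF) {w r v} (hw : S.IsPath w r) (hv : S.IsInt (S.pathGraph w r) v) :
    (S.created 0 [])[S.pathBase w r + S.ix (S.pathGraph w r) v - 1]? =
      some ((List.range r).map w, v) := by
  have seg : ∀ q ≤ r, ∀ i < S.sz (S.pathGraph w q),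
      (S.created 0 [])[S.pathBase w q + i]? =
        (S.created (S.pathGraph w q) ((List.range q).map w))[i]? := by
    intro q
    induction q with
    | zero => intro _ i _; simp [pathBase, pathGraph]
    | succ q ih =>
      intro hq i hi
      have hg := pathGraph_le h hw q (by omega)
      have := pre_add_le h hg (hw q (by omega))
      rw [pathGraph] at hi ⊢
      rw [pathBase, add_assoc, ih (by omega) _ (by omega),
        getElem?_created_child h hg (hw q (by omega)) _ hi, List.range_succ, List.map_append]
      rfl
  have hg := pathGraph_le h hw r le_rfl
  have h1 := one_le_ix h hg hv
  have h2 := ix_le_ic hv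
  have h3 := ic_le_sz h hg
  rw [Nat.add_sub_assoc h1, seg r le_rfl _ (by omega), created_eq h hg,
    List.getElem?_append_left (by simp; omega), List.getElem?_map, List.getElem?_range (by omega)]
  simp [Nat.sub_add_cancel h1, inode_ix h hg hv]

end RuleSystem

namespace RuleSystem

variable {S : RuleSystem}

/-- Applied to the start graph, where no node counts as external: its numbering `ix 0` is the
identity on nodes. -/
theorem ix_eq_self (h : S.WF) {g v : ℕ} (hg : g ≤ S.last) (hx : ∀ x, S.xt g x = 0)
    (hv : v ≤ S.nn g) : S.ix g v = v := by
  have := h.nn_lt g hg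
  induction v with
  | zero => exact ix_zero g
  | succ v ih => rw [ix_succ (by omega), ih (by omega), if_pos (hx _)]

end RuleSystem

/-! ### The canonical derivation agrees with the derivation of the rule system. -/

namespace SLHRGrammar

open RuleSystem

variable {G : SLHRGrammar} {B : ℕ} {fl : Bool}

theorem ruleSystem_xt_eq_zero (g x : ℕ) :
    (G.ruleSystem B fl).xt g x = 0 ↔ x ∉ (G.graph g).ext := by
  simp [ruleSystem]

theorem internal_eq (h : (G.ruleSystem B fl).WF) {g : ℕ} (hg : g ≤ G.N.card) :
    (G.graph g).internal = (List.range ((G.ruleSystem B fl).ic g)).map fun i =>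
      (G.ruleSystem B fl).inode g (i + 1) := by
  rw [ic, ← filter_eq_map_inode h hg le_rfl, HyperGraph.internal]
  refine List.filter_congr fun x _ => ?_
  simp [ruleSystem_xt_eq_zero]

theorem idxOf_internal (h : (G.ruleSystem B fl).WF) {g v : ℕ} (hg : g ≤ G.N.card)
    (hv : (G.ruleSystem B fl).IsInt g v) :
    (G.graph g).internal.idxOf v + 1 = (G.ruleSystem B fl).ix g v := by
  have hnd : (G.graph g).internal.Nodup :=
    (List.nodup_range.map (fun a b hab => by simpa using hab)).filter _
  have h1 := one_le_ix h hg hv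
  have h2 := ix_le_ic hv
  have hl : (G.ruleSystem B fl).ix g v - 1 < (G.graph g).internal.length := by
    rw [internal_eq h hg]; simp; omega
  have he : (G.graph g).internal[(G.ruleSystem B fl).ix g v - 1] = v := by
    simp only [internal_eq h hg, List.getElem_map, List.getElem_range]
    rw [Nat.sub_add_cancel h1, inode_ix h hg hv]
  conv_lhs => rw [← he]
  rw [hnd.idxOf_getElem]
  omega

/-- There is an edge from `x` to `y` (or from `y` to `x`, if `fl` holds). -/
def HasEdge (fl : Bool) (L : List HREdge) (x y : ℕ) : Prop :=
  ∃ e ∈ L, e.att = pairString fl x y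

theorem map_eq_pairString {l : List ℕ} {ρ : ℕ → ℕ} {x y : ℕ} :
    l.map ρ = pairString fl x y ↔ ∃ u v, l = pairString fl u v ∧ x = ρ u ∧ y = ρ v := by
  cases fl
  · simp only [pairString, Bool.false_eq_true, if_false, List.map_eq_cons_iff, List.map_eq_nil_iff]
    constructor
    · rintro ⟨u, _, rfl, rfl, v, _, rfl, rfl, rfl⟩
      exact ⟨u, v, rfl, rfl, rfl⟩
    · rintro ⟨u, v, rfl, rfl, rfl⟩
      exact ⟨u, _, rfl, rfl, v, _, rfl, rfl, rfl⟩
  · simp only [pairString, if_true, List.map_eq_cons_iff, List.map_eq_nil_iff]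
    constructor
    · rintro ⟨u, _, rfl, rfl, v, _, rfl, rfl, rfl⟩
      exact ⟨v, u, rfl, rfl, rfl⟩
    · rintro ⟨u, v, rfl, rfl, rfl⟩
      exact ⟨v, _, rfl, rfl, u, _, rfl, rfl, rfl⟩

theorem hasEdge_append {L L' : List HREdge} {x y : ℕ} :
    HasEdge fl (L ++ L') x y ↔ HasEdge fl L x y ∨ HasEdge fl L' x y := by
  simp [HasEdge, or_and_right, exists_or]

theorem tt_ne_zero_iff {g u v : ℕ} : (G.ruleSystem B fl).tt g u v ≠ 0 ↔
    ∃ e ∈ G.terminals (G.graph g), e.att = pairString fl u v := by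
  rw [← Nat.pos_iff_ne_zero]
  simp only [ruleSystem, List.countP_pos_iff, decide_eq_true_eq]

/-- The renaming used by the derivation and the abstract numbering agree on nodes only, elsewhere
both have arbitrary values. This is enough because terminal edges are attached to nodes. -/
theorem hasEdge_terminals (h : (G.ruleSystem B fl).WF) {g : ℕ} (hg : g ≤ G.N.card)
    {ρ ρ' : ℕ → ℕ} (hρ : ∀ v, (G.ruleSystem B fl).IsNode g v → ρ' v = ρ v) {x y : ℕ} :
    HasEdge fl ((G.terminals (G.graph g)).map (HREdge.rename ρ')) x y ↔
      ∃ u v, (G.ruleSystem B fl).tt g u v ≠ 0 ∧ x = ρ u ∧ y = ρ v := by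
  have hatt : ∀ e : HREdge, (e.rename ρ').att = e.att.map ρ' := fun e => rfl
  constructor
  · rintro ⟨e', he', hxy⟩
    obtain ⟨e, he, rfl⟩ := List.mem_map.1 he'
    rw [hatt, map_eq_pairString] at hxy
    obtain ⟨u, v, hl, rfl, rfl⟩ := hxy
    have ht := tt_ne_zero_iff (B := B).2 ⟨e, he, hl⟩
    obtain ⟨hu, hv⟩ := h.node_of_tt g hg u v ht
    exact ⟨u, v, ht, hρ u hu, hρ v hv⟩
  · rintro ⟨u, v, ht, rfl, rfl⟩
    obtain ⟨hu, hv⟩ := h.node_of_tt g hg u v ht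
    obtain ⟨e, he, hl⟩ := tt_ne_zero_iff.1 ht
    refine ⟨_, List.mem_map_of_mem he, ?_⟩
    rw [hatt, map_eq_pairString]
    exact ⟨u, v, hl, (hρ u hu).symm, (hρ v hv).symm⟩

/-- The renaming performed when an edge is replaced is the abstract `childMap`: external nodes
correspond by position in strings of equal length, and the position of an internal node in
`internal`, plus one, is its `ix`. -/
theorem nodeMap_child (h : (G.ruleSystem B fl).WF) {g s : ℕ} (hg : g ≤ G.N.card)
    (hs : s < (G.ruleSystem B fl).ns g) {ρ ρ' : ℕ → ℕ}
    (hρ : ∀ v, (G.ruleSystem B fl).IsNode g v → ρ' v = ρ v) {n : ℕ} {v : ℕ}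
    (hv : (G.ruleSystem B fl).IsNode ((G.ruleSystem B fl).ch g s) v) :
    (G.graph ((G.ruleSystem B fl).ch g s)).nodeMap ((G.ntEdge g s).att.map ρ')
      (n + (G.ruleSystem B fl).pre g s) v = (G.ruleSystem B fl).childMap g s ρ n v := by
  have hc := h.ch_le g hg s hs
  unfold HyperGraph.nodeMap childMap
  by_cases hx : (G.ruleSystem B fl).xt ((G.ruleSystem B fl).ch g s) v = 0
  · rw [if_neg ((ruleSystem_xt_eq_zero _ _).1 hx), if_neg (not_not.2 hx), add_assoc,
      idxOf_internal h hc ⟨hv, hx⟩]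
  · have hx' : v ∈ (G.graph ((G.ruleSystem B fl).ch g s)).ext := by
      by_contra hn
      exact hx ((ruleSystem_xt_eq_zero _ _).2 hn)
    rw [if_pos hx', if_pos hx, ← hρ _ (h.node_up g hg s hs v hx)]
    have hi := List.idxOf_lt_length_iff.2 hx'
    have hl : (G.graph ((G.ruleSystem B fl).ch g s)).ext.length = (G.ntEdge g s).att.length := by
      obtain ⟨h1, h2⟩ := ntEdge_mem hs
      show (G.graph (G.childOf (G.ntEdge g s))).ext.length = _
      rw [graph_childOf h2, G.rank_rhs _ h2, (graph_isOver hg).length_att _ h1]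
    rw [hl] at hi
    rw [List.getD_eq_getElem _ _ (by simpa using hi), List.getElem_map]
    congr 1
    exact (List.getD_eq_getElem _ _ hi).symm

theorem foldl_zipIdx_induction {α β : Type*} (F : β → α × ℕ → β) (L : List α) (b : β)
    (I : ℕ → β → Prop) (h0 : I 0 b)
    (step : ∀ (i : ℕ) (hi : i < L.length) b, I i b → I (i + 1) (F b (L[i], i))) :
    I L.length (L.zipIdx.foldl F b) := by
  induction L using List.reverseRecOn with
  | nil => exact h0
  | append_singleton l a ih =>
    rw [List.zipIdx_append, List.foldl_append]
    have := step l.length (by simp) _ (ih fun i hi b hb => by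
      have := step i (by simp; omega) b hb
      rwa [List.getElem_append_left hi] at this)
    simpa using this

/-- What a derivation that has processed the terminal edges and the first `j` nonterminal edges of
the graph `g` has produced. -/
def Produced (G : SLHRGrammar) (B : ℕ) (fl : Bool) (g : ℕ) (p : List ℕ) (ρ : ℕ → ℕ)
    (d : Derivation) (j : ℕ) (d' : Derivation) : Prop :=
  d'.nodes = d.nodes ++ ((List.range ((G.ruleSystem B fl).ic g)).map fun i =>
      (p, (G.ruleSystem B fl).inode g (i + 1))) ++
      (List.range j).flatMap (fun s =>
        (G.ruleSystem B fl).created ((G.ruleSystem B fl).ch g s) (p ++ [s])) ∧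
  ∀ x y, HasEdge fl d'.edges x y ↔ HasEdge fl d.edges x y ∨
    (∃ u v, (G.ruleSystem B fl).tt g u v ≠ 0 ∧ x = ρ u ∧ y = ρ v) ∨
    ∃ s < j, (G.ruleSystem B fl).Edge ((G.ruleSystem B fl).ch g s)
      ((G.ruleSystem B fl).childMap g s ρ d.nodes.length)
      (d.nodes.length + (G.ruleSystem B fl).pre g s) x y

theorem Produced.length (h : (G.ruleSystem B fl).WF) {g : ℕ} (hg : g ≤ G.N.card) {p ρ d j d'}
    (hp : Produced G B fl g p ρ d j d') (hj : j ≤ (G.ruleSystem B fl).ns g) :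
    d'.nodes.length = d.nodes.length + (G.ruleSystem B fl).pre g j := by
  rw [hp.1, List.length_append, List.length_append, length_flatMap_range, pre,
    Finset.sum_congr rfl fun s hs => length_created h (h.ch_le g hg s
      ((Finset.mem_range.1 hs).trans_le hj)) (p ++ [s])]
  simp [add_assoc]

theorem Produced.all (h : (G.ruleSystem B fl).WF) {g : ℕ} (hg : g ≤ G.N.card) {p ρ d d'}
    (hp : Produced G B fl g p ρ d ((G.ruleSystem B fl).ns g) d') :
    d'.nodes = d.nodes ++ (G.ruleSystem B fl).created g p ∧
    ∀ x y, HasEdge fl d'.edges x y ↔ HasEdge fl d.edges x y ∨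
      (G.ruleSystem B fl).Edge g ρ d.nodes.length x y := by
  refine ⟨?_, fun x y => ?_⟩
  · rw [hp.1, created_eq h hg, List.append_assoc]
  · rw [hp.2 x y, edge_iff]

theorem Produced.succ {g : ℕ} {p ρ d j d' d''}
    (hp : Produced G B fl g p ρ d j d')
    (hn : d''.nodes = d'.nodes ++
      (G.ruleSystem B fl).created ((G.ruleSystem B fl).ch g j) (p ++ [j]))
    (he : ∀ x y, HasEdge fl d''.edges x y ↔ HasEdge fl d'.edges x y ∨
      (G.ruleSystem B fl).Edge ((G.ruleSystem B fl).ch g j)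
        ((G.ruleSystem B fl).childMap g j ρ d.nodes.length)
        (d.nodes.length + (G.ruleSystem B fl).pre g j) x y) :
    Produced G B fl g p ρ d (j + 1) d'' := by
  refine ⟨?_, fun x y => ?_⟩
  · rw [hn, hp.1, List.range_succ, List.flatMap_append, List.flatMap_singleton, List.append_assoc]
  · rw [he, hp.2 x y, or_assoc, or_assoc]
    refine or_congr_right (or_congr_right ?_)
    simp only [Nat.lt_succ_iff_lt_or_eq, or_and_right, exists_or, exists_eq_left]

/-- Induction on the recursion bound, which suffices as long as it exceeds the depth. After the
first `j` siblings exactly `pre g j` nodes have been added, so the next free number is the base that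
`childMap` and `Edge` assume for sibling `j`. -/
theorem derive_spec (h : (G.ruleSystem B fl).WF) : ∀ (f g : ℕ) (e : HREdge) (p : List ℕ)
    (ρ : ℕ → ℕ) (d : Derivation), g ≤ G.N.card → (G.ruleSystem B fl).dp g < f →
    G.graph g = G.rhs e.lab → (∀ v, (G.ruleSystem B fl).IsNode g v →
      (G.graph g).nodeMap e.att d.nodes.length v = ρ v) →
    (G.derive f p e d).nodes = d.nodes ++ (G.ruleSystem B fl).created g p ∧
    ∀ x y, HasEdge fl (G.derive f p e d).edges x y ↔ HasEdge fl d.edges x y ∨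
      (G.ruleSystem B fl).Edge g ρ d.nodes.length x y := by
  intro f
  induction f with
  | zero => intro g e p ρ d _ h0; omega
  | succ f ih =>
    intro g e p ρ d hg hf hge hρ
    refine Produced.all h hg (?_ : Produced G B fl g p ρ d (G.sib (G.graph g)).length _)
    rw [derive, ← hge]
    refine foldl_zipIdx_induction _ _ _ (Produced G B fl g p ρ d) ?_ fun j hj d' hd' => ?_
    · refine ⟨?_, fun x y => ?_⟩
      · simp [internal_eq h hg]
      · rw [hasEdge_append, hasEdge_terminals h hg hρ]
        simp
    · have hlab := (ntEdge_mem hj).2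
      have hent : (G.sib (G.graph g))[j] = G.ntEdge g j := (List.getD_eq_getElem _ _ hj).symm
      have hlen := hd'.length h hg hj.le
      have hdp := h.dp_lt g hg j hj
      obtain ⟨hn, he⟩ := ih ((G.ruleSystem B fl).ch g j)
        ((G.ntEdge g j).rename ((G.graph g).nodeMap e.att d.nodes.length)) (p ++ [j])
        ((G.ruleSystem B fl).childMap g j ρ d.nodes.length) d' (h.ch_le g hg j hj)
        (by omega) (graph_childOf hlab) (fun v hv => by
          rw [hlen]
          exact nodeMap_child h hg hj hρ hv)
      rw [hlen] at he
      simp only [hent]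
      exact hd'.succ hn he

/-- The start graph is treated like a right-hand side without external nodes that is put into an
empty derivation. The recursion bound `|N|` is large enough because a chain starting at a
nonterminal has fewer than `|N|` steps. -/
theorem derivation_spec (h : (G.ruleSystem B fl).WF) :
    G.derivation.nodes = (G.ruleSystem B fl).created 0 [] ∧
    ∀ x y, HasEdge fl G.derivation.edges x y ↔
      (G.ruleSystem B fl).Edge 0 ((G.ruleSystem B fl).ix 0) 0 x y := by
  have h0 : 0 ≤ G.N.card := Nat.zero_le _
  have hix : ∀ v, (G.ruleSystem B fl).IsNode 0 v → v = (G.ruleSystem B fl).ix 0 v :=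
    fun v hv => (ix_eq_self h h0 h.xt_zero hv.2).symm
  have hp : Produced G B fl 0 [] ((G.ruleSystem B fl).ix 0) ⟨[], []⟩
      ((G.ruleSystem B fl).ns 0) G.derivation := by
    refine foldl_zipIdx_induction _ (G.sib (G.graph 0)) _
      (Produced G B fl 0 [] ((G.ruleSystem B fl).ix 0) ⟨[], []⟩) ?_ fun j hj d' hd' => ?_
    · refine ⟨?_, fun x y => ?_⟩
      · have : (G.graph 0).internal = (List.range G.start.numNodes).map (· + 1) := by
          simp [HyperGraph.internal, graph]
        rw [internal_eq h h0] at this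
        have := congrArg (List.map fun v => (([] : List ℕ), v)) this
        simpa [Function.comp_def] using this.symm
      · have := hasEdge_terminals h h0 hix (x := x) (y := y)
        rw [← this]
        have hid : (G.terminals (G.graph 0)).map (HREdge.rename fun v => v) = G.terminals G.start := by
          have : (HREdge.rename fun v => v) = id := by
            funext e
            simp only [HREdge.rename, List.map_id', id]
            rfl
          rw [this, List.map_id]
          rfl
        rw [hid]
        simp [HasEdge]
    · have hlab := (ntEdge_mem hj).2
      have hent : (G.sib (G.graph 0))[j] = G.ntEdge 0 j := (List.getD_eq_getElem _ _ hj).symm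
      have hlen := hd'.length h h0 hj.le
      have hdp : (G.ruleSystem B fl).dp ((G.ruleSystem B fl).ch 0 j) < G.N.card := by
        show (if G.childOf (G.ntEdge 0 j) = 0 then G.height + 1 else
          G.heightFrom (G.N.sort.getD (G.childOf (G.ntEdge 0 j) - 1) 0)) < _
        rw [if_neg (by simp [childOf]), childOf, Nat.add_sub_cancel, sort_getD_idxOf hlab]
        exact G.heightFrom_lt_card hlab
      obtain ⟨hn, he⟩ := derive_spec h G.N.card ((G.ruleSystem B fl).ch 0 j) (G.ntEdge 0 j) [j]
        ((G.ruleSystem B fl).childMap 0 j ((G.ruleSystem B fl).ix 0) 0) d' (h.ch_le 0 h0 j hj)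
        hdp (graph_childOf hlab) (fun v hv => by
          rw [hlen]
          have := nodeMap_child h h0 hj hix (n := 0) hv
          rwa [List.map_id'] at this)
      rw [hlen] at he
      simp only [hent]
      exact hd'.succ hn he
  obtain ⟨h1, h2⟩ := hp.all h h0
  refine ⟨by simpa using h1, fun x y => (h2 x y).trans ?_⟩
  simp [HasEdge]

theorem val_numNodes (h : (G.ruleSystem B fl).WF) :
    G.val.numNodes = (G.ruleSystem B fl).sz 0 := by
  show G.derivation.nodes.length = _
  rw [(derivation_spec h).1, length_created h (Nat.zero_le _)]

theorem gRep_eq (h : (G.ruleSystem B fl).WF) {w r v k} (hw : (G.ruleSystem B fl).IsPath w r)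
    (hv : (G.ruleSystem B fl).IsInt ((G.ruleSystem B fl).pathGraph w r) v)
    (hk : (G.ruleSystem B fl).pathBase w r +
      (G.ruleSystem B fl).ix ((G.ruleSystem B fl).pathGraph w r) v = k) :
    G.gRep k = (List.range r).map w ++ [v] := by
  have := getElem?_created h hw hv
  rw [hk, ← (derivation_spec h).1] at this
  rw [gRep, List.getD_eq_getElem?_getD, this]
  rfl

theorem mem_inNeighbors (h : (G.ruleSystem B false).WF) {x k : ℕ} : x ∈ G.val.inNeighbors k ↔
    (G.ruleSystem B false).Edge 0 ((G.ruleSystem B false).ix 0) 0 x k := by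
  rw [← (derivation_spec h).2]
  simp [HyperGraph.inNeighbors, HasEdge, pairString, val]

theorem mem_outNeighbors (h : (G.ruleSystem B true).WF) {x k : ℕ} : x ∈ G.val.outNeighbors k ↔
    (G.ruleSystem B true).Edge 0 ((G.ruleSystem B true).ix 0) 0 x k := by
  rw [← (derivation_spec h).2]
  simp [HyperGraph.outNeighbors, HasEdge, pairString, val]

end SLHRGrammar

namespace RAM

/-! ## The input -/

theorem ofList_offsets (L : List ℕ) {r : ℕ} (hr : r ≤ L.length) :
    ofList (offsets L) r = (L.take r).sum := by
  rw [ofList, offsets, List.getD_eq_getElem _ _ (by simp; omega)]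
  simp

theorem sum_range_getD (L : List ℕ) : ∑ i ∈ Finset.range L.length, L.getD i 0 = L.sum := by
  induction L with
  | nil => simp
  | cons a L ih =>
    rw [List.length_cons, Finset.sum_range_succ', List.sum_cons, ← ih, add_comm]
    simp

theorem sum_map_flatMap {α β : Type*} (f : α → List β) (h : β → ℕ) (R : List α) :
    ((R.flatMap f).map h).sum = (R.map fun r => ((f r).map h).sum).sum := by
  induction R with
  | nil => rfl
  | cons a R ih => simp [ih]

theorem getD_flatMap {α β : Type*} (f : α → List β) (d : β) (R : List α) {r i : ℕ}
    (hr : r < R.length) (hi : i < (f R[r]).length) :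
    (R.flatMap f).getD (((R.map fun a => (f a).length).take r).sum + i) d = (f R[r]).getD i d := by
  induction R generalizing r with
  | nil => simp at hr
  | cons a R ih =>
    cases r with
    | zero =>
      simp only [List.getElem_cons_zero] at hi ⊢
      simp [List.getD_eq_getElem?_getD, List.getElem?_append_left hi]
    | succ r =>
      simp only [List.getElem_cons_succ, List.length_cons] at hi hr ⊢
      rw [← ih (by omega) hi]
      simp only [List.map_cons, List.take_succ_cons, List.sum_cons, List.flatMap_cons,
        List.getD_eq_getElem?_getD]
      rw [add_assoc, List.getElem?_append_right (by omega)]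
      simp

theorem sum_take_le (L : List ℕ) (r : ℕ) : (L.take r).sum ≤ L.sum := by
  conv_rhs => rw [← List.take_append_drop r L, List.sum_append]
  omega

end RAM

/-! ### Reading the grammar from the input arrays, and bounding the indices by its size. -/

namespace SLHRGrammar

open RAM

/-- The edges of the graph `g` in order. -/
def edgeList (G : SLHRGrammar) (g : ℕ) : List HREdge := (G.graph g).edges.sort

/-- The edge `i` of the graph `g`. -/
def edgeAt (G : SLHRGrammar) (g i : ℕ) : HREdge := (G.edgeList g).getD i (toLex ([], 0))

/-- The arrays from `1` to `7` describe the grammar. -/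
structure InputArrays (G : SLHRGrammar) (A : ℕ → ℕ → ℕ) : Prop where
  nn : ∀ g ≤ G.N.card, A 1 g = (G.graph g).numNodes
  ext_length : ∀ g ≤ G.N.card, g ≠ 0 → A 2 (g + 1) - A 2 g = (G.graph g).ext.length
  ext_get : ∀ g ≤ G.N.card, g ≠ 0 → ∀ j < (G.graph g).ext.length,
    A 3 (A 2 g + j) = (G.graph g).ext.getD j 0
  edge_length : ∀ g ≤ G.N.card, A 4 (g + 1) - A 4 g = (G.edgeList g).length
  lab : ∀ g ≤ G.N.card, ∀ i < (G.edgeList g).length, A 5 (A 4 g + i) = G.labCode (G.edgeAt g i).lab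
  att_length : ∀ g ≤ G.N.card, ∀ i < (G.edgeList g).length,
    A 6 (A 4 g + i + 1) - A 6 (A 4 g + i) = (G.edgeAt g i).att.length
  att_get : ∀ g ≤ G.N.card, ∀ i < (G.edgeList g).length, ∀ p < (G.edgeAt g i).att.length,
    A 7 (A 6 (A 4 g + i) + p) = (G.edgeAt g i).att.getD p 0

variable {G : SLHRGrammar}

theorem length_rules : G.rules.length = G.N.card + 1 := by
  simp [rules, Finset.length_sort]

theorem rules_getElem {g : ℕ} (hg : g < G.rules.length) :
    G.rules[g].numNodes = (G.graph g).numNodes ∧ G.rules[g].edges = (G.graph g).edges ∧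
      (g ≠ 0 → G.rules[g].ext = (G.graph g).ext) := by
  cases g with
  | zero => exact ⟨rfl, rfl, fun h => absurd rfl h⟩
  | succ g =>
    have hg' : g < G.N.sort.length := by
      rw [length_rules] at hg
      rw [Finset.length_sort]
      omega
    have : G.rules[g + 1] = G.graph (g + 1) := by
      simp only [rules, List.getElem_cons_succ, List.getElem_map, graph]
      rw [List.getD_eq_getElem _ _ hg']
    rw [this]
    exact ⟨rfl, rfl, fun _ => rfl⟩

theorem card_eq_length_sort (g : HyperGraph) : g.edges.card = g.edges.sort.length := by
  rw [Multiset.length_sort]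

theorem sum_take_rules {g : ℕ} (hg : g < G.rules.length) :
    ((G.rules.map (·.edges.card)).take (g + 1)).sum =
      ((G.rules.map (·.edges.card)).take g).sum + (G.edgeList g).length := by
  rw [List.sum_take_succ _ _ (by simpa using hg), List.getElem_map, card_eq_length_sort,
    (rules_getElem hg).2.1, edgeList]

theorem length_allEdges : G.allEdges.length = (G.rules.map (·.edges.card)).sum := by
  rw [allEdges, List.length_flatMap]
  simp

theorem allEdges_getD {g i : ℕ} (hg : g < G.rules.length) (hi : i < (G.edgeList g).length) :
    ((G.rules.map (·.edges.card)).take g).sum + i < G.allEdges.length ∧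
    G.allEdges.getD (((G.rules.map (·.edges.card)).take g).sum + i) (toLex ([], 0)) =
      G.edgeAt g i := by
  constructor
  · have := sum_take_rules hg
    have := sum_take_le (G.rules.map (·.edges.card)) (g + 1)
    rw [length_allEdges]
    omega
  · have he : G.rules[g].edges.sort = G.edgeList g := by rw [(rules_getElem hg).2.1, edgeList]
    have := getD_flatMap (fun g : HyperGraph => g.edges.sort) (toLex ([], 0)) G.rules hg
      (i := i) (by rw [he]; exact hi)
    rw [he] at this
    simpa [allEdges, edgeAt] using this

/-- The input also stores the external nodes of the start graph, whereas `graph 0` has none. Hence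
the facts about external strings are restricted to `g ≠ 0`, and `extLengthTerm` makes the
corresponding case distinction. -/
theorem inputArrays_input : G.InputArrays G.input.arr := by
  have hlt : ∀ {g}, g ≤ G.N.card → g < G.rules.length := by
    intro g hg
    rw [length_rules]
    omega
  have h4 : ∀ {g}, g ≤ G.rules.length → G.input.arr 4 g = ((G.rules.map (·.edges.card)).take g).sum :=
    fun {g} hg => ofList_offsets _ (by simpa using hg)
  have h2 : ∀ {g}, g ≤ G.rules.length → G.input.arr 2 g = ((G.rules.map (·.ext.length)).take g).sum :=
    fun {g} hg => ofList_offsets _ (by simpa using hg)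
  have h6 : ∀ {e}, e ≤ G.allEdges.length →
      G.input.arr 6 e = ((G.allEdges.map (·.att.length)).take e).sum :=
    fun {g} hg => ofList_offsets _ (by simpa using hg)
  have hatt : ∀ g (hg : g ≤ G.N.card) i (hi : i < (G.edgeList g).length),
      G.input.arr 6 (G.input.arr 4 g + i + 1) =
        G.input.arr 6 (G.input.arr 4 g + i) + (G.edgeAt g i).att.length := by
    intro g hg i hi
    obtain ⟨h, he⟩ := allEdges_getD (hlt hg) hi
    rw [h4 (hlt hg).le, h6 (by omega), h6 (by omega), List.sum_take_succ _ _ (by simpa using h),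
      List.getElem_map, ← List.getD_eq_getElem G.allEdges (toLex ([], 0)) h, he]
  refine ⟨?_, ?_, ?_, ?_, ?_, ?_, ?_⟩
  · intro g hg
    show (G.rules.map (·.numNodes)).getD g 0 = _
    rw [List.getD_eq_getElem _ _ (by simpa using hlt hg), List.getElem_map, (rules_getElem (hlt hg)).1]
  · intro g hg h0
    rw [h2 (hlt hg).le, h2 (hlt hg), List.sum_take_succ _ _ (by simpa using hlt hg), List.getElem_map,
      (rules_getElem (hlt hg)).2.2 h0]
    omega
  · intro g hg h0 j hj
    rw [h2 (hlt hg).le]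
    have he := (rules_getElem (hlt hg)).2.2 h0
    rw [← he] at hj ⊢
    exact getD_flatMap (fun g : HyperGraph => g.ext) 0 G.rules (hlt hg) hj
  · intro g hg
    rw [h4 (hlt hg).le, h4 (hlt hg), sum_take_rules (hlt hg)]
    omega
  · intro g hg i hi
    obtain ⟨h, he⟩ := allEdges_getD (hlt hg) hi
    rw [h4 (hlt hg).le]
    show (G.allEdges.map fun e => G.labCode e.lab).getD _ 0 = _
    rw [List.getD_eq_getElem _ _ (by simpa using h), List.getElem_map,
      ← List.getD_eq_getElem G.allEdges (toLex ([], 0)) h, he]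
  · intro g hg i hi
    rw [hatt g hg i hi]
    omega
  · intro g hg i hi p hp
    obtain ⟨h, he⟩ := allEdges_getD (hlt hg) hi
    rw [h4 (hlt hg).le, h6 h.le]
    rw [List.getD_eq_getElem G.allEdges _ h] at he
    rw [← he] at hp ⊢
    exact getD_flatMap (fun e : HREdge => e.att) 0 G.allEdges h hp

/-- A bound on all indices into the arrays. -/
def indexBound (G : SLHRGrammar) : ℕ :=
  2 + G.N.card + (∑ g ∈ Finset.range (G.N.card + 1), G.input.arr 1 g) +
    G.input.arr 2 (G.N.card + 1) + G.input.arr 4 (G.N.card + 1) +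
    G.input.arr 6 (G.input.arr 4 (G.N.card + 1))

theorem input_totals : ∑ g ∈ Finset.range (G.N.card + 1), G.input.arr 1 g =
      (G.rules.map (·.numNodes)).sum ∧
    G.input.arr 2 (G.N.card + 1) = (G.rules.map (·.ext.length)).sum ∧
    G.input.arr 4 (G.N.card + 1) = G.allEdges.length ∧
    G.input.arr 6 (G.input.arr 4 (G.N.card + 1)) = (G.allEdges.map (·.att.length)).sum := by
  have h4 : G.input.arr 4 (G.N.card + 1) = G.allEdges.length := by
    refine (ofList_offsets _ (by simp [length_rules])).trans ?_
    rw [List.take_of_length_le (by simp [length_rules]), length_allEdges]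
  refine ⟨?_, ?_, h4, ?_⟩
  · rw [← sum_range_getD]
    simp only [List.length_map, length_rules]
    rfl
  · refine (ofList_offsets _ (by simp [length_rules])).trans ?_
    rw [List.take_of_length_le (by simp [length_rules])]
  · rw [h4]
    refine (ofList_offsets _ (by simp)).trans ?_
    rw [List.take_of_length_le (by simp)]

/-- The bound adds up the totals of all node numbers and string lengths, so it dominates each of
them. The summand `2` makes the inequality for nodes strict. -/
theorem le_indexBound : G.N.card + 2 ≤ G.indexBound ∧
    ∀ g ≤ G.N.card, (G.graph g).numNodes < G.indexBound ∧
      (G.graph g).ext.length ≤ G.indexBound ∧ (G.edgeList g).length ≤ G.indexBound ∧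
      ∀ i < (G.edgeList g).length, (G.edgeAt g i).att.length ≤ G.indexBound := by
  obtain ⟨h1, h2, h3, h4⟩ := G.input_totals
  have hB : G.indexBound = 2 + G.N.card + (G.rules.map (·.numNodes)).sum +
    (G.rules.map (·.ext.length)).sum + G.allEdges.length +
      (G.allEdges.map (·.att.length)).sum := by rw [indexBound, h1, h2, h4, h3]
  refine ⟨by omega, fun g hg => ?_⟩
  have hlt : g < G.rules.length := by rw [length_rules]; omega
  obtain ⟨r1, r2, r3⟩ := rules_getElem hlt
  have hmem : G.rules[g] ∈ G.rules := List.getElem_mem _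
  have a1 := List.single_le_sum (fun _ _ => Nat.zero_le _) _
    (List.mem_map_of_mem (f := fun g : HyperGraph => g.numNodes) hmem)
  have a2 := List.single_le_sum (fun _ _ => Nat.zero_le _) _
    (List.mem_map_of_mem (f := fun g : HyperGraph => g.ext.length) hmem)
  have a3 := List.single_le_sum (fun _ _ => Nat.zero_le _) _
    (List.mem_map_of_mem (f := fun g : HyperGraph => g.edges.card) hmem)
  rw [← length_allEdges, card_eq_length_sort, r2] at a3
  refine ⟨by omega, ?_, by rw [edgeList]; omega, fun i hi => ?_⟩
  · by_cases h0 : g = 0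
    · subst h0
      simp [graph]
    · rw [← r3 h0]
      omega
  · obtain ⟨h, he⟩ := allEdges_getD hlt hi
    rw [List.getD_eq_getElem _ _ h] at he
    have := List.single_le_sum (fun _ _ => Nat.zero_le _) _
      (List.mem_map_of_mem (f := fun e : HREdge => e.att.length) (List.getElem_mem h))
    rw [he] at this
    omega

theorem isOver_of_mem_rules {g : HyperGraph} (hg : g ∈ G.rules) :
    g.IsOver (Set.Icc 1 G.σ ∪ G.N) G.rank := by
  rcases List.mem_cons.1 hg with rfl | hg
  · exact G.start_isOver
  · obtain ⟨A, hA, rfl⟩ := List.mem_map.1 hg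
    exact G.rhs_isOver A ((Finset.mem_sort _).1 hA)

theorem length_ext_le {g : HyperGraph} {l r} (hg : g.IsOver l r) : g.ext.length ≤ g.numNodes := by
  rw [← List.toFinset_card_of_nodup hg.ext_nodup]
  calc _ ≤ (Finset.Icc 1 g.numNodes).card := Finset.card_le_card fun v hv => by
        rw [Finset.mem_Icc]; exact hg.ext_mem v (List.mem_toFinset.1 hv)
    _ = g.numNodes := by simp

/-- Each graph has a node, so `|N| + 1` is at most the number of nodes; external nodes are distinct
nodes; every edge contributes at least one to the size. An edge of rank two contributes one but has
two attachments, which doubles the last total. With `2 + |N|` at most twice the size, this adds up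
to seven. -/
theorem indexBound_le : G.indexBound ≤ 7 * G.size ∧ 1 ≤ G.size := by
  obtain ⟨h1, h2, h3, h4⟩ := G.input_totals
  have hB : G.indexBound = 2 + G.N.card + (G.rules.map (·.numNodes)).sum +
    (G.rules.map (·.ext.length)).sum + G.allEdges.length +
      (G.allEdges.map (·.att.length)).sum := by rw [indexBound, h1, h2, h4, h3]
  have b1 : (G.rules.map (·.numNodes)).sum ≤ G.size :=
    List.sum_le_sum fun g _ => Nat.le_add_right _ _
  have b2 : (G.rules.map (·.ext.length)).sum ≤ (G.rules.map (·.numNodes)).sum :=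
    List.sum_le_sum fun g hg => length_ext_le (isOver_of_mem_rules hg)
  have b3 : G.rules.length ≤ (G.rules.map (·.numNodes)).sum := by
    have := List.card_nsmul_le_sum (G.rules.map (·.numNodes)) 1 (fun x hx => by
      obtain ⟨g, hg, rfl⟩ := List.mem_map.1 hx
      exact (isOver_of_mem_rules hg).numNodes_pos)
    simpa using this
  have hsort : ∀ (g : HyperGraph) (f : HREdge → ℕ),
      (g.edges.map f).sum = (g.edges.sort.map f).sum := by
    intro g f
    rw [← Multiset.sum_coe, ← Multiset.map_coe, Multiset.sort_eq]
  have b4 : G.allEdges.length ≤ G.size := by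
    rw [length_allEdges]
    refine List.sum_le_sum fun g _ => ?_
    have : g.edges.card • 1 ≤ (g.edges.map fun e => if e.att.length ≤ 2 then 1 else e.att.length).sum := by
      have := Multiset.card_nsmul_le_sum
        (s := g.edges.map fun e => if e.att.length ≤ 2 then 1 else e.att.length) (a := 1)
        (fun x hx => by
          obtain ⟨e, _, rfl⟩ := Multiset.mem_map.1 hx
          split_ifs <;> omega)
      simpa using this
    simp only [HyperGraph.size]
    simp at this
    omega
  have b5 : (G.allEdges.map (·.att.length)).sum ≤ 2 * G.size := by
    rw [allEdges, sum_map_flatMap, size, ← List.sum_map_mul_left]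
    refine List.sum_le_sum fun g _ => ?_
    rw [HyperGraph.size, hsort]
    have : (g.edges.sort.map (·.att.length)).sum ≤
        (g.edges.sort.map fun e => 2 * if e.att.length ≤ 2 then 1 else e.att.length).sum :=
      List.sum_le_sum fun e _ => by split_ifs <;> omega
    rw [List.sum_map_mul_left] at this
    omega
  rw [length_rules] at b3
  omega

end SLHRGrammar

/-! ## The terms for the tables -/

/-- Sums in terms always run up to `B`; a shorter sum is expressed by a guard. -/
theorem sum_range_guard {m B : ℕ} (hm : m ≤ B) (f : ℕ → ℕ) :
    (∑ i ∈ Finset.range B, if i < m then f i else 0) = ∑ i ∈ Finset.range m, f i := by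
  rw [← Finset.sum_subset (Finset.range_mono hm)]
  · exact Finset.sum_congr rfl fun i hi => if_pos (Finset.mem_range.1 hi)
  · exact fun i _ hi => if_neg fun h => hi (Finset.mem_range.2 h)

theorem sum_ite_eq_length_filter (B : ℕ) (P : ℕ → Prop) [DecidablePred P] :
    (∑ i ∈ Finset.range B, if P i then 1 else 0) = ((List.range B).filter fun i => P i).length := by
  induction B with
  | zero => rfl
  | succ B ih =>
    rw [Finset.sum_range_succ, List.range_succ, List.filter_append, List.length_append, ih]
    by_cases h : P B <;> simp [h]

theorem getElem?_filter_range {B i : ℕ} (P : ℕ → Prop) [DecidablePred P] (hi : i < B) (h : P i) :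
    ((List.range B).filter fun i => P i)[((List.range i).filter fun i => P i).length]? = some i := by
  induction B with
  | zero => omega
  | succ B ih =>
    rw [List.range_succ, List.filter_append]
    rcases Nat.lt_succ_iff_lt_or_eq.1 hi with hi | rfl
    · have := ih hi
      rw [List.getElem?_append_left]
      · exact this
      · exact (List.getElem?_eq_some_iff.1 this).1
    · rw [List.getElem?_append_right le_rfl]
      simp [h]

/-- The entry at position `s` of the filtered range is the only element of it with exactly `s`
predecessors satisfying `P`. This is how the term `nth` selects it by a double sum, without any
search. -/
theorem sum_ite_rank_eq {B s : ℕ} (P : ℕ → Prop) [DecidablePred P] (f : ℕ → ℕ)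
    (hs : s < ((List.range B).filter fun i => P i).length) :
    (∑ i ∈ Finset.range B,
      if P i ∧ (∑ u ∈ Finset.range B, if u < i ∧ P u then 1 else 0) = s then f i else 0) =
      f (((List.range B).filter fun i => P i)[s]) := by
  have hmem : ((List.range B).filter fun i => P i)[s] ∈ (List.range B).filter fun i => P i :=
    List.getElem_mem _
  have hnd : ((List.range B).filter fun i => P i).Nodup := List.nodup_range.filter _
  have hrank : ∀ i < B, P i → (∑ u ∈ Finset.range B, if u < i ∧ P u then 1 else 0) =
      ((List.range i).filter fun i => P i).length := by
    intro i hi _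
    rw [← sum_ite_eq_length_filter, ← sum_range_guard hi.le]
    refine Finset.sum_congr rfl fun u _ => ?_
    by_cases h1 : u < i <;> by_cases h2 : P u <;> simp [h1, h2]
  simp only [List.mem_filter, List.mem_range, decide_eq_true_eq] at hmem
  rw [Finset.sum_eq_single (((List.range B).filter fun i => P i)[s])]
  · rw [if_pos]
    refine ⟨hmem.2, ?_⟩
    rw [hrank _ hmem.1 hmem.2]
    have := getElem?_filter_range P hmem.1 hmem.2
    obtain ⟨h1, h2⟩ := List.getElem?_eq_some_iff.1 this
    exact (hnd.getElem_inj_iff).1 h2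
  · intro i hi hne
    refine if_neg fun h => hne ?_
    have hi := Finset.mem_range.1 hi
    rw [hrank i hi h.1] at h
    obtain ⟨h1, h2⟩ := List.getElem?_eq_some_iff.1 (getElem?_filter_range P hi h.1)
    rw [← h2]
    simp only [h.2]
  · intro h
    exact absurd (Finset.mem_range.2 hmem.1) h

/-- Replaces filtering edges by filtering their positions, which is what counting terms can express.
-/
theorem filter_eq_map_filter_range {α : Type*} (L : List α) (d : α) (p : α → Bool) {B : ℕ}
    (hB : L.length ≤ B) :
    L.filter p = ((List.range B).filter fun i => i < L.length ∧ p (L.getD i d) = true).map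
      fun i => L.getD i d := by
  have h1 : (List.range B).filter (fun i => i < L.length ∧ p (L.getD i d) = true) =
      (List.range L.length).filter fun i => p (L.getD i d) := by
    obtain ⟨m, rfl⟩ : ∃ m, B = L.length + m := ⟨B - L.length, by omega⟩
    rw [List.range_add, List.filter_append, List.filter_map]
    have : (List.range m).filter ((fun i => decide (i < L.length ∧ p (L.getD i d) = true)) ∘
        fun x => L.length + x) = [] := by
      rw [List.filter_eq_nil_iff]
      intro x _
      simp
    rw [this, List.map_nil, List.append_nil]
    refine List.filter_congr fun i hi => ?_
    simp [List.mem_range.1 hi]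
  have h2 : L = (List.range L.length).map fun i => L.getD i d := by
    refine List.ext_getElem (by simp) fun i hi _ => ?_
    rw [List.getElem_map, List.getElem_range, List.getD_eq_getElem _ d hi]
  rw [h1]
  conv_lhs => rw [h2, List.filter_map]
  rfl

namespace RAM

namespace Term

/-- A term is true if its value is not zero. -/
def Holds (A : ℕ → ℕ → ℕ) (ρ : ℕ → ℕ) (p : Term) : Prop := p.eval A ρ ≠ 0

instance (A ρ) (p : Term) : Decidable (p.Holds A ρ) := inferInstanceAs (Decidable (_ ≠ _))

/-- Sum of two terms. -/
def add (p q : Term) : Term := bin .add p q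

/-- Difference of two terms. -/
def sub (p q : Term) : Term := bin .sub p q

/-- The condition `p < q`. -/
def lt (p q : Term) : Term := bin .lt p q

/-- The condition `p ≤ q`. -/
def le (p q : Term) : Term := bin .lt p (bin .add q (const 1))

/-- The condition `p = q`. -/
def eq (p q : Term) : Term := bin .eq p q

/-- Conjunction. -/
def and (p q : Term) : Term := ite p q (const 0)

/-- The entry of a table with two indices. -/
def get2 (a : ℕ) (g s : Term) : Term := get a (bin .add (get 10 g) s)

/-- The entry of a table with three indices. -/
def get3 (a : ℕ) (g s x : Term) : Term := get a (bin .add (get 10 (bin .add (get 10 g) s)) x)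

/-- The number of values of `x` that satisfy `p`. -/
def count (x : ℕ) (p : Term) : Term := sum x (ite p (const 1) (const 0))

/-- The value of `f` at the element number `s` among those that satisfy `p`. -/
def nth (p : Term → Term) (s : Term) (f : Term → Term) : Term :=
  sum 4 (ite (and (p (var 4)) (eq (count 5 (and (lt (var 5) (var 4)) (p (var 5)))) s))
    (f (var 4)) (const 0))

/-- The condition that `v` is an internal node of `g`. -/
def isIntTerm (g v : Term) : Term :=
  and (and (le (const 1) v) (le v (get 1 g))) (eq (get2 13 g v) (const 0))

/-- The number of edges of `g`. -/
def edgeCountTerm (g : Term) : Term := sub (get 4 (add g (const 1))) (get 4 g)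

/-- The label of edge `i` of `g`. -/
def labTerm (g i : Term) : Term := get 5 (add (get 4 g) i)

/-- The length of the attachment string of edge `i` of `g`. -/
def attLengthTerm (g i : Term) : Term :=
  sub (get 6 (add (add (get 4 g) i) (const 1))) (get 6 (add (get 4 g) i))

/-- Entry `p` of the attachment string of edge `i` of `g`. -/
def attTerm (g i p : Term) : Term := get 7 (add (get 6 (add (get 4 g) i)) p)

/-- The number of external nodes of `g`. -/
def extLengthTerm (g : Term) : Term :=
  ite (eq g (const 0)) (const 0) (sub (get 2 (add g (const 1))) (get 2 g))

/-- Entry `j` of the string of external nodes of `g`. -/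
def extTerm (g j : Term) : Term := get 3 (add (get 2 g) j)

/-- The condition that `i` is a nonterminal edge of `g`. -/
def isNtTerm (g i : Term) : Term := and (lt i (edgeCountTerm g)) (lt (var 20) (labTerm g i))

/-- The statements that compute the tables. -/
def tableStmts : List Stmt :=
  [.fill 10 (sum 4 (add (sum 5 (var 1)) (var 2))),
   .fill 20 (nth (isNtTerm (var 1)) (var 2) fun i => i),
   .fill 11 (count 4 (isNtTerm (var 3) (var 4))),
   .fill 12 (sub (labTerm (var 1) (get2 20 (var 1) (var 2))) (var 20)),
   .fill 13 (ite (count 4 (and (lt (var 4) (extLengthTerm (var 1)))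
      (eq (extTerm (var 1) (var 4)) (var 2)))) (const 1) (const 0)),
   .fill 14 (count 4 (and (and (le (const 1) (var 4)) (le (var 4) (var 2)))
      (eq (get2 13 (var 1) (var 4)) (const 0)))),
   .fill 16 (get2 14 (var 3) (get 1 (var 3))),
   .fill 15 (sum 4 (ite (and (isIntTerm (var 1) (var 4))
      (eq (get2 14 (var 1) (var 4)) (var 2))) (var 4) (const 0))),
   .fill 17 (sum 4 (ite (and (lt (var 4) (extLengthTerm (get2 12 (var 0) (var 1))))
      (eq (extTerm (get2 12 (var 0) (var 1)) (var 4)) (var 2)))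
      (attTerm (var 0) (get2 20 (var 0) (var 1)) (var 4)) (const 0))),
   .fill 18 (sum 4 (ite (and (lt (var 4) (attLengthTerm (var 0) (get2 20 (var 0) (var 1))))
      (eq (attTerm (var 0) (get2 20 (var 0) (var 1)) (var 4)) (var 2)))
      (extTerm (get2 12 (var 0) (var 1)) (var 4)) (const 0))),
   .fix 21 22 (add (get 16 (var 3)) (sum 4 (ite (lt (var 4) (get 11 (var 3)))
      (get 21 (get2 12 (var 3) (var 4))) (const 0)))),
   .fill 19 (add (get 16 (var 1)) (sum 4 (ite (lt (var 4) (var 2))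
      (get 21 (get2 12 (var 1) (var 4))) (const 0))))]

/-- The condition that `u` is an internal node of `g` from which an edge leads to `v`. -/
def intNbrTerm (o : ℕ) (g v u : Term) : Term := and (isIntTerm g u) (get3 (o + 7) g u v)

/-- The condition that `u` is an external node of `g` from which an edge leads to `v`. -/
def extNbrTerm (o : ℕ) (g v u : Term) : Term := and (get2 13 g u) (get3 (o + 7) g u v)

/-- The condition that `s` is a nonterminal edge of `g` that gives neighbors of `v`. -/
def branchTerm (o : ℕ) (g v s : Term) : Term :=
  and (lt s (get 11 g)) (and (get3 18 g s v) (get2 (o + 9) (get2 12 g s) (get3 18 g s v)))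

/-- The statements that compute the lists of neighbors and branches. -/
def listStmts (o : ℕ) (fl : Bool) : List Stmt :=
  [.fill (o + 6) (count 4 (and (and (lt (var 4) (edgeCountTerm (var 0)))
      (le (labTerm (var 0) (var 4)) (var 20))) (and (eq (attLengthTerm (var 0) (var 4)) (const 2))
        (and (eq (attTerm (var 0) (var 4) (const 0)) (var (if fl then 2 else 1)))
          (eq (attTerm (var 0) (var 4) (const 1)) (var (if fl then 1 else 2))))))),
   .fix (o + 7) (o + 8) (add (get3 (o + 6) (var 0) (var 1) (var 2))
      (sum 4 (ite (and (lt (var 4) (get 11 (var 0)))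
        (and (get3 18 (var 0) (var 4) (var 1)) (get3 18 (var 0) (var 4) (var 2))))
        (get3 (o + 7) (get2 12 (var 0) (var 4)) (get3 18 (var 0) (var 4) (var 1))
          (get3 18 (var 0) (var 4) (var 2))) (const 0)))),
   .fill o (count 4 (intNbrTerm o (var 1) (var 2) (var 4))),
   .fill (o + 1) (nth (intNbrTerm o (var 0) (var 1)) (var 2) (get2 14 (var 0))),
   .fill (o + 2) (count 4 (extNbrTerm o (var 1) (var 2) (var 4))),
   .fill (o + 3) (nth (extNbrTerm o (var 0) (var 1)) (var 2) fun u => u),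
   .fix (o + 9) (o + 10) (add (get2 o (var 1) (var 2))
      (sum 4 (ite (and (lt (var 4) (get 11 (var 1))) (get3 18 (var 1) (var 4) (var 2)))
        (get2 (o + 9) (get2 12 (var 1) (var 4)) (get3 18 (var 1) (var 4) (var 2))) (const 0)))),
   .fill (o + 4) (count 4 (branchTerm o (var 1) (var 2) (var 4))),
   .fill (o + 5) (nth (branchTerm o (var 0) (var 1)) (var 2) fun s => s)]

/-- All statements of the preprocessing. -/
def allStmts : List Stmt := tableStmts ++ (listStmts 50 false ++ listStmts 70 true)

/-- The values of terms. -/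
theorem eval_values (A : ℕ → ℕ → ℕ) (ρ : ℕ → ℕ) :
    (∀ n, (const n).eval A ρ = n) ∧ (∀ x, (var x).eval A ρ = ρ x) ∧
    (∀ a p, (get a p).eval A ρ = A a (p.eval A ρ)) ∧
    (∀ p q, (add p q).eval A ρ = p.eval A ρ + q.eval A ρ) ∧
    (∀ p q, (sub p q).eval A ρ = p.eval A ρ - q.eval A ρ) ∧
    (∀ p q r, (ite p q r).eval A ρ = if p.Holds A ρ then q.eval A ρ else r.eval A ρ) ∧
    (∀ x p, (sum x p).eval A ρ =
      ∑ i ∈ Finset.range (ρ 22), p.eval A (Function.update ρ x i)) ∧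
    (∀ a p q, (get2 a p q).eval A ρ = A a (A 10 (p.eval A ρ) + q.eval A ρ)) ∧
    (∀ a p q r, (get3 a p q r).eval A ρ =
      A a (A 10 (A 10 (p.eval A ρ) + q.eval A ρ) + r.eval A ρ)) ∧
    (∀ a p q, (get2 a p q).Holds A ρ ↔ (get2 a p q).eval A ρ ≠ 0) ∧
    (∀ a p q r, (get3 a p q r).Holds A ρ ↔ (get3 a p q r).eval A ρ ≠ 0) ∧
    (∀ x p, (sum x p).Holds A ρ ↔ (sum x p).eval A ρ ≠ 0) ∧
    (∀ p q, (lt p q).Holds A ρ ↔ p.eval A ρ < q.eval A ρ) ∧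
    (∀ p q, (le p q).Holds A ρ ↔ p.eval A ρ ≤ q.eval A ρ) ∧
    (∀ p q, (eq p q).Holds A ρ ↔ p.eval A ρ = q.eval A ρ) ∧
    (∀ p q, (and p q).Holds A ρ ↔ p.Holds A ρ ∧ q.Holds A ρ) := by
  refine ⟨fun _ => rfl, fun _ => rfl, fun _ _ => rfl, fun _ _ => rfl, fun _ _ => rfl,
    fun _ _ _ => rfl, fun _ _ => rfl, fun _ _ _ => rfl, fun _ _ _ _ => rfl, fun _ _ _ => Iff.rfl,
    fun _ _ _ _ => Iff.rfl, fun _ _ => Iff.rfl, fun p q => ?_, fun p q => ?_, fun p q => ?_,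
    fun p q => ?_⟩
  · simp [Holds, lt, eval, Op.eval]
  · simp [Holds, le, eval, Op.eval]
  · simp [Holds, eq, eval, Op.eval]
  · by_cases h : p.eval A ρ = 0 <;> simp [Holds, and, eval, h]

/-- The composite terms. -/
theorem composite_eq :
    (∀ x p, count x p = sum x (ite p (const 1) (const 0))) ∧
    (∀ p s f, nth p s f = sum 4 (ite (and (p (var 4))
      (eq (count 5 (and (lt (var 5) (var 4)) (p (var 5)))) s)) (f (var 4)) (const 0))) ∧
    (∀ g v, isIntTerm g v =
      and (and (le (const 1) v) (le v (get 1 g))) (eq (get2 13 g v) (const 0))) ∧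
    (∀ g, edgeCountTerm g = sub (get 4 (add g (const 1))) (get 4 g)) ∧
    (∀ g i, labTerm g i = get 5 (add (get 4 g) i)) ∧
    (∀ g i, attLengthTerm g i =
      sub (get 6 (add (add (get 4 g) i) (const 1))) (get 6 (add (get 4 g) i))) ∧
    (∀ g i p, attTerm g i p = get 7 (add (get 6 (add (get 4 g) i)) p)) ∧
    (∀ g, extLengthTerm g =
      ite (eq g (const 0)) (const 0) (sub (get 2 (add g (const 1))) (get 2 g))) ∧
    (∀ g j, extTerm g j = get 3 (add (get 2 g) j)) ∧
    (∀ g i, isNtTerm g i = and (lt i (edgeCountTerm g)) (lt (var 20) (labTerm g i))) ∧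
    (∀ o g v u, intNbrTerm o g v u = and (isIntTerm g u) (get3 (o + 7) g u v)) ∧
    (∀ o g v u, extNbrTerm o g v u = and (get2 13 g u) (get3 (o + 7) g u v)) ∧
    (∀ o g v s, branchTerm o g v s = and (lt s (get 11 g))
      (and (get3 18 g s v) (get2 (o + 9) (get2 12 g s) (get3 18 g s v)))) :=
  ⟨fun _ _ => rfl, fun _ _ _ => rfl, fun _ _ => rfl, fun _ => rfl, fun _ _ => rfl, fun _ _ => rfl,
    fun _ _ _ => rfl, fun _ => rfl, fun _ _ => rfl, fun _ _ => rfl, fun _ _ _ _ => rfl,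
    fun _ _ _ _ => rfl, fun _ _ _ _ => rfl⟩

end Term

-- A finite check on the syntax: the input arrays are never written, and no table is overwritten
-- once it has been used.
open Term in
theorem allStmts_ok : stmtsOk [1, 2, 3, 4, 5, 6, 7] allStmts = true := by decide

end RAM

namespace RAM

/-! ## The values of the tables -/

/-- The variables while the cell with indices `i`, `j`, `l` is computed. -/
def indexEnv (B : ℕ) (ρ : ℕ → ℕ) (i j l : ℕ) : ℕ → ℕ := fun y =>
  if y = 0 then i else if y = 1 then j else if y = 2 then l
  else if y = 3 then (i * B + j) * B + l else ρ y

variable {B : ℕ} {ρ : ℕ → ℕ} {A : ℕ → ℕ → ℕ}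

theorem indexEnv_values (i j l : ℕ) : indexEnv B ρ i j l 0 = i ∧ indexEnv B ρ i j l 1 = j ∧
    indexEnv B ρ i j l 2 = l ∧ indexEnv B ρ i j l 3 = (i * B + j) * B + l ∧
    indexEnv B ρ i j l 20 = ρ 20 ∧ indexEnv B ρ i j l 22 = ρ 22 :=
  ⟨rfl, rfl, rfl, rfl, rfl, rfl⟩

theorem update_values (f : ℕ → ℕ) (n : ℕ) :
    Function.update f 4 n 0 = f 0 ∧ Function.update f 4 n 1 = f 1 ∧
    Function.update f 4 n 2 = f 2 ∧ Function.update f 4 n 3 = f 3 ∧ Function.update f 4 n 4 = n ∧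
    Function.update f 4 n 20 = f 20 ∧ Function.update f 4 n 22 = f 22 ∧
    Function.update f 5 n 0 = f 0 ∧ Function.update f 5 n 1 = f 1 ∧
    Function.update f 5 n 2 = f 2 ∧ Function.update f 5 n 3 = f 3 ∧ Function.update f 5 n 4 = f 4 ∧
    Function.update f 5 n 5 = n ∧ Function.update f 5 n 20 = f 20 ∧
    Function.update f 5 n 22 = f 22 :=
  ⟨rfl, rfl, rfl, rfl, rfl, rfl, rfl, rfl, rfl, rfl, rfl, rfl, rfl, rfl, rfl⟩

theorem cellEnv_eq {i j l : ℕ} (hj : j < B) (hl : l < B) :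
    cellEnv B ρ ((i * B + j) * B + l) = indexEnv B ρ i j l := by
  have h1 : ((i * B + j) * B + l) / B = i * B + j := by
    rw [mul_comm _ B, Nat.mul_add_div (by omega), Nat.div_eq_of_lt hl, add_zero]
  funext y
  unfold cellEnv indexEnv
  rw [← Nat.div_div_eq_div_mul, h1, mul_comm _ B, Nat.mul_add_div (by omega), Nat.div_eq_of_lt hj,
    Nat.mul_add_mod, mul_comm _ B, Nat.mul_add_mod, Nat.mod_eq_of_lt hj, Nat.mod_eq_of_lt hl,
    add_zero]

theorem cell_lt {i j l : ℕ} (hi : i < B) (hj : j < B) (hl : l < B) :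
    (i * B + j) * B + l < B * B * B := by
  have h1 : i * B + j + 1 ≤ B * B := by nlinarith
  nlinarith

theorem Stmt.Holds.cell {a : ℕ} {e : Term} (h : (Stmt.fill a e).Holds B ρ A) {i j l : ℕ}
    (hi : i < B) (hj : j < B) (hl : l < B) :
    A a ((i * B + j) * B + l) = e.eval A (indexEnv B ρ i j l) := by
  rw [h _ (cell_lt hi hj hl), cellEnv_eq hj hl]

/-- A recursive table is determined by its recursive equation, if this is well-founded. -/
theorem Stmt.Holds.fix_cell {a tmp : ℕ} {e : Term} (h : (Stmt.fix a tmp e).Holds B ρ A)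
    (V : ℕ → ℕ → ℕ → Prop) (dp val : ℕ → ℕ → ℕ → ℕ)
    (hV : ∀ i j l, V i j l → i < B ∧ j < B ∧ l < B ∧ dp i j l < B)
    (hval : ∀ (A' : ℕ → ℕ → ℕ) (i j l : ℕ), (∀ b, b ≠ a → A' b = A b) → V i j l →
      (∀ i' j' l', V i' j' l' → dp i' j' l' < dp i j l →
        A' a ((i' * B + j') * B + l') = val i' j' l') →
      e.eval A' (indexEnv B ρ i j l) = val i j l)
    {i j l : ℕ} (hijl : V i j l) : A a ((i * B + j) * B + l) = val i j l := by
  obtain ⟨X, hX⟩ := h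
  -- After `k` rounds all cells of depth below `k` are final, whatever the table contained at the
  -- start; all depths are below `B`.
  have key : ∀ k i j l, V i j l → dp i j l < k →
      (roundOf B ρ A a e)^[k] X ((i * B + j) * B + l) = val i j l := by
    intro k
    induction k with
    | zero => intro _ _ _ _ h; omega
    | succ k ih =>
      intro i j l hv hd
      obtain ⟨hi, hj, hl, _⟩ := hV i j l hv
      rw [Function.iterate_succ_apply', roundOf, if_pos (cell_lt hi hj hl), cellEnv_eq hj hl]
      refine hval _ i j l (fun b hb => Function.update_of_ne hb _ _) hv fun i' j' l' hv' hd' => ?_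
      rw [Function.update_self]
      exact ih i' j' l' hv' (by omega)
  rw [hX]
  exact key B i j l hijl (hV i j l hijl).2.2.2

theorem holds_of_getElem? {L : List Stmt} (h : ∀ s ∈ L, s.Holds B ρ A) (n : ℕ) {s : Stmt}
    (hs : L[n]? = some s) : s.Holds B ρ A :=
  h s (List.mem_of_getElem? hs)

/-- The array `10` holds the multiples of `B`. -/
def RowStarts (B : ℕ) (A : ℕ → ℕ → ℕ) : Prop := ∀ y < B * B, A 10 y = y * B

/-- Multiplication is missing, too, and is replaced by summation: with `y = B * j + l`, adding up
`j` over `B` rounds and adding `l` gives `y`, and adding this up `B` times gives `y * B`. Only two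
nested sums are needed, and afterwards tables with two and three indices are addressed in constant
time. -/
theorem rowStarts_of_holds (hρ : ρ 22 = B) (hA : ∀ s ∈ Term.tableStmts, s.Holds B ρ A) :
    RowStarts B A := by
  intro y hy
  have hB : 0 < B := by
    by_contra h
    have : B = 0 := by omega
    subst this
    simp at hy
  have h := (holds_of_getElem? hA 0 rfl).cell hB (Nat.div_lt_of_lt_mul hy) (Nat.mod_lt y hB)
  have hdm := Nat.div_add_mod y B
  rw [zero_mul, zero_add, mul_comm (y / B), hdm] at h
  rw [h]
  simp only [Term.eval_values, indexEnv_values, update_values, hρ, Finset.sum_const, Finset.card_range, smul_eq_mul, hdm]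
  rw [mul_comm]

theorem RowStarts.two (h10 : RowStarts B A) {g s : ℕ} (hg : g < B) : A 10 g + s = (0 * B + g) * B + s := by
  rw [h10 g (by nlinarith), zero_mul, zero_add]

theorem RowStarts.three (h10 : RowStarts B A) {g s x : ℕ} (hg : g < B) (hs : s < B) :
    A 10 (A 10 g + s) + x = (g * B + s) * B + x := by
  rw [h10 g (by nlinarith), h10 _ (by nlinarith)]

theorem Stmt.Holds.one {a : ℕ} {e : Term} (h : (Stmt.fill a e).Holds B ρ A) {g : ℕ} (hg : g < B) :
    A a g = e.eval A (indexEnv B ρ 0 0 g) := by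
  have := h.cell (i := 0) (j := 0) (by omega) (by omega) hg
  simpa using this

theorem Stmt.Holds.two {a : ℕ} {e : Term} (h : (Stmt.fill a e).Holds B ρ A) (h10 : RowStarts B A)
    {g s : ℕ} (hg : g < B) (hs : s < B) : A a (A 10 g + s) = e.eval A (indexEnv B ρ 0 g s) := by
  rw [h10.two hg]
  exact h.cell (by omega) hg hs

theorem Stmt.Holds.three {a : ℕ} {e : Term} (h : (Stmt.fill a e).Holds B ρ A)
    (h10 : RowStarts B A) {g s x : ℕ} (hg : g < B) (hs : s < B) (hx : x < B) :
    A a (A 10 (A 10 g + s) + x) = e.eval A (indexEnv B ρ g s x) := by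
  rw [h10.three hg hs]
  exact h.cell hg hs hx

end RAM

/-! ### Nonterminal and terminal edges by their positions in the edge list. -/

namespace SLHRGrammar

open RAM

variable {G : SLHRGrammar} {A : ℕ → ℕ → ℕ}

/-- The edge `i` of the graph `g` is a nonterminal edge. -/
def IsNtEdge (G : SLHRGrammar) (g i : ℕ) : Prop :=
  i < (G.edgeList g).length ∧ (G.edgeAt g i).lab ∈ G.N

instance (g i : ℕ) : Decidable (G.IsNtEdge g i) := by unfold IsNtEdge; infer_instance

theorem edgeAt_mem {g i : ℕ} (hi : i < (G.edgeList g).length) :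
    G.edgeAt g i ∈ (G.graph g).edges := by
  rw [edgeAt, List.getD_eq_getElem _ _ hi]
  exact (Multiset.mem_sort (· ≤ ·)).1 (List.getElem_mem hi)

theorem sib_eq {g B : ℕ} (hB : (G.edgeList g).length ≤ B) : G.sib (G.graph g) =
    ((List.range B).filter fun i => G.IsNtEdge g i).map (G.edgeAt g) := by
  refine (filter_eq_map_filter_range (G.edgeList g) (toLex ([], 0)) _ hB).trans ?_
  simp only [decide_eq_true_eq]
  rfl

theorem terminals_eq {g B : ℕ} (hB : (G.edgeList g).length ≤ B) : G.terminals (G.graph g) =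
    ((List.range B).filter fun i => i < (G.edgeList g).length ∧ (G.edgeAt g i).lab ∉ G.N).map
      (G.edgeAt g) := by
  refine (filter_eq_map_filter_range (G.edgeList g) (toLex ([], 0)) _ hB).trans ?_
  simp only [decide_eq_true_eq]
  rfl

/-- Nonterminals are coded by numbers above `σ` and terminals by themselves, so a single comparison
tells them apart. -/
theorem lt_labCode_iff {g i : ℕ} (hg : g ≤ G.N.card) (hi : i < (G.edgeList g).length) :
    G.σ < G.labCode (G.edgeAt g i).lab ↔ (G.edgeAt g i).lab ∈ G.N := by
  unfold labCode
  split_ifs with h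
  · simp only [h, iff_true]
    omega
  · rcases (graph_isOver hg).lab_mem _ (edgeAt_mem hi) with h' | h'
    · simp [h, h'.2]
    · exact absurd h' h

/-- A sum over the position of an entry in a list without repetitions. -/
theorem sum_ite_getD_eq {L : List ℕ} (hL : L.Nodup) {B : ℕ} (hB : L.length ≤ B) (v : ℕ)
    (f : ℕ → ℕ) : (∑ j ∈ Finset.range B, if j < L.length ∧ L.getD j 0 = v then f j else 0) =
      if v ∈ L then f (L.idxOf v) else 0 := by
  split_ifs with hv
  · have hi := List.idxOf_lt_length_iff.2 hv
    rw [Finset.sum_eq_single (L.idxOf v)]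
    · rw [if_pos ⟨hi, by rw [List.getD_eq_getElem _ _ hi]; exact List.getElem_idxOf hi⟩]
    · intro j _ hj
      refine if_neg fun ⟨h1, h2⟩ => hj ?_
      rw [List.getD_eq_getElem _ _ h1] at h2
      rw [← h2, hL.idxOf_getElem]
    · intro h
      exact absurd (Finset.mem_range.2 (by omega)) h
  · refine Finset.sum_eq_zero fun j _ => if_neg fun ⟨h1, h2⟩ => hv ?_
    rw [← h2, List.getD_eq_getElem _ _ h1]
    exact List.getElem_mem h1

end SLHRGrammar

namespace RuleSystem

theorem ix_le (S : RuleSystem) (g v : ℕ) : S.ix g v ≤ v := by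
  unfold ix
  rw [← Finset.card_filter]
  calc _ ≤ (Finset.Icc 1 v).card := Finset.card_le_card fun u hu => by
        rw [Finset.mem_Icc]; exact (Finset.mem_filter.1 hu).2.1
    _ = v := by simp

end RuleSystem

/-! ### Correctness of the tables that do not depend on the direction of edges. -/

namespace SLHRGrammar

open RAM

/-- The arrays hold the grammar and the tables computed from it, with `B` as bound on indices. -/
structure Prepared (G : SLHRGrammar) (B : ℕ) (ρ : ℕ → ℕ) (A : ℕ → ℕ → ℕ) : Prop where
  inp : G.InputArrays A
  bound : ρ 22 = B
  sigma : ρ 20 = G.σ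
  card_le : G.N.card + 2 ≤ B
  le : ∀ g ≤ G.N.card, (G.graph g).numNodes < B ∧ (G.graph g).ext.length ≤ B ∧
    (G.edgeList g).length ≤ B ∧ ∀ i < (G.edgeList g).length, (G.edgeAt g i).att.length ≤ B
  holds : ∀ s ∈ Term.tableStmts, s.Holds B ρ A

namespace Prepared

variable {G : SLHRGrammar} {B : ℕ} {ρ : ℕ → ℕ} {A : ℕ → ℕ → ℕ} (P : G.Prepared B ρ A)
include P

theorem lt {g : ℕ} (hg : g ≤ G.N.card) : g < B := by
  have := P.card_le
  omega

theorem rows : RowStarts B A := rowStarts_of_holds P.bound P.holds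

theorem isNt_iff {g : ℕ} (hg : g ≤ G.N.card) (i : ℕ) :
    (i < A 4 (g + 1) - A 4 g ∧ G.σ < A 5 (A 4 g + i)) ↔ G.IsNtEdge g i := by
  rw [P.inp.edge_length g hg]
  refine and_congr_right fun hi => ?_
  rw [P.inp.lab g hg i hi, lt_labCode_iff hg hi]

theorem length_sib {g : ℕ} (hg : g ≤ G.N.card) :
    (G.sib (G.graph g)).length = ((List.range B).filter fun i => G.IsNtEdge g i).length := by
  rw [sib_eq (P.le g hg).2.2.1, List.length_map]

theorem length_sib_le {g : ℕ} (hg : g ≤ G.N.card) : (G.sib (G.graph g)).length ≤ B := by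
  rw [P.length_sib hg]
  exact (List.length_filter_le _ _).trans (by simp)

theorem wf (fl : Bool) : (G.ruleSystem B fl).WF :=
  ruleSystem_wf P.card_le (fun g hg => (P.le g hg).1) (fun _ hg => P.length_sib_le hg) fl

/-- Table `20` translates a position among the nonterminal edges into a position in the full edge
list, through which labels and attachments are accessible. -/
theorem table_edge {g s : ℕ} (hg : g ≤ G.N.card) (hs : s < (G.sib (G.graph g)).length) :
    A 20 (A 10 g + s) < (G.edgeList g).length ∧
      G.edgeAt g (A 20 (A 10 g + s)) = G.ntEdge g s := by
  have hs' := hs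
  rw [P.length_sib hg] at hs'
  have h := (holds_of_getElem? P.holds 1 rfl).two P.rows (P.lt hg) (hs.trans_le (P.length_sib_le hg))
  simp only [Term.eval_values, Term.composite_eq, indexEnv_values, update_values, P.bound,
    P.sigma, P.isNt_iff hg] at h
  rw [sum_ite_rank_eq (fun i => G.IsNtEdge g i) (fun i => i) hs'] at h
  have hm := List.getElem_mem hs'
  rw [← h] at hm
  simp only [List.mem_filter, List.mem_range, decide_eq_true_eq] at hm
  refine ⟨hm.2.1, ?_⟩
  rw [h, ntEdge]
  simp only [sib_eq (P.le g hg).2.2.1]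
  rw [List.getD_eq_getElem _ _ (by simpa using hs'), List.getElem_map]

theorem table_ns {g : ℕ} (hg : g ≤ G.N.card) : A 11 g = (G.sib (G.graph g)).length := by
  have h := (holds_of_getElem? P.holds 2 rfl).one (P.lt hg)
  simp only [Term.eval_values, Term.composite_eq, indexEnv_values, update_values, P.bound, P.sigma, zero_mul,
    zero_add, P.isNt_iff hg] at h
  rw [h, P.length_sib hg, sum_ite_eq_length_filter]

/-- The codes are chosen such that subtracting `σ` from the code of a nonterminal gives the number
of its right-hand side. -/
theorem table_ch {g s : ℕ} (hg : g ≤ G.N.card) (hs : s < (G.sib (G.graph g)).length) :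
    A 12 (A 10 g + s) = G.childOf (G.ntEdge g s) := by
  have h := (holds_of_getElem? P.holds 3 rfl).two P.rows (P.lt hg) (hs.trans_le (P.length_sib_le hg))
  simp only [Term.eval_values, Term.composite_eq, indexEnv_values, P.sigma] at h
  obtain ⟨h1, h2⟩ := P.table_edge hg hs
  rw [h, P.inp.lab g hg _ h1, h2, labCode, if_pos (ntEdge_mem hs).2, childOf]
  omega

theorem ext_length {g : ℕ} (hg : g ≤ G.N.card) :
    (if g = 0 then 0 else A 2 (g + 1) - A 2 g) = (G.graph g).ext.length := by
  split_ifs with h0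
  · simp [h0, graph]
  · exact P.inp.ext_length g hg h0

theorem ext_get {g : ℕ} (hg : g ≤ G.N.card) {j : ℕ} (hj : j < (G.graph g).ext.length) :
    A 3 (A 2 g + j) = (G.graph g).ext.getD j 0 := by
  refine P.inp.ext_get g hg ?_ j hj
  rintro rfl
  simp [graph] at hj

theorem sum_ext {g : ℕ} (hg : g ≤ G.N.card) (v : ℕ) (f : ℕ → ℕ) :
    (∑ j ∈ Finset.range B,
      if j < (G.graph g).ext.length ∧ A 3 (A 2 g + j) = v then f j else 0) =
      if v ∈ (G.graph g).ext then f ((G.graph g).ext.idxOf v) else 0 := by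
  rw [← sum_ite_getD_eq (graph_isOver hg).ext_nodup (P.le g hg).2.1]
  refine Finset.sum_congr rfl fun j _ => if_congr (and_congr_right fun hj => ?_) rfl rfl
  rw [P.ext_get hg hj]

theorem table_ext {g v : ℕ} (hg : g ≤ G.N.card) (hv : v < B) :
    A 13 (A 10 g + v) = if v ∈ (G.graph g).ext then 1 else 0 := by
  have h := (holds_of_getElem? P.holds 4 rfl).two P.rows (P.lt hg) hv
  simp only [Term.eval_values, Term.composite_eq, indexEnv_values, update_values, P.bound,
    P.ext_length hg, P.sum_ext hg v fun _ => 1] at h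
  rw [h]
  by_cases hv : v ∈ (G.graph g).ext <;> simp [hv]

theorem table_ext_eq_zero_iff {fl : Bool} {g v : ℕ} (hg : g ≤ G.N.card) (hv : v < B) :
    A 13 (A 10 g + v) = 0 ↔ (G.ruleSystem B fl).xt g v = 0 := by
  rw [P.table_ext hg hv]
  rfl

theorem table_ix (fl : Bool) {g v : ℕ} (hg : g ≤ G.N.card) (hv : v < B) :
    A 14 (A 10 g + v) = (G.ruleSystem B fl).ix g v := by
  have h := (holds_of_getElem? P.holds 5 rfl).two P.rows (P.lt hg) hv
  simp only [Term.eval_values, Term.composite_eq, indexEnv_values, update_values, P.bound] at h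
  rw [h]
  refine Finset.sum_congr rfl fun u hu => if_congr (and_congr_right fun _ => ?_) rfl rfl
  exact P.table_ext_eq_zero_iff hg (Finset.mem_range.1 hu)

theorem table_ic (fl : Bool) {g : ℕ} (hg : g ≤ G.N.card) :
    A 16 g = (G.ruleSystem B fl).ic g := by
  have h := (holds_of_getElem? P.holds 6 rfl).one (P.lt hg)
  simp only [Term.eval_values, indexEnv_values, zero_mul,
    zero_add] at h
  rw [h, P.inp.nn g hg, P.table_ix fl hg (P.le g hg).1]
  rfl

theorem isInt_iff (fl : Bool) {g v : ℕ} (hg : g ≤ G.N.card) (hv : v < B) :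
    ((1 ≤ v ∧ v ≤ A 1 g) ∧ A 13 (A 10 g + v) = 0) ↔ (G.ruleSystem B fl).IsInt g v := by
  rw [P.inp.nn g hg, P.table_ext_eq_zero_iff hg hv]
  rfl

theorem table_inode (fl : Bool) {g x : ℕ} (hg : g ≤ G.N.card) (hx : x < B) :
    A 15 (A 10 g + x) = (G.ruleSystem B fl).inode g x := by
  have h := (holds_of_getElem? P.holds 7 rfl).two P.rows (P.lt hg) hx
  simp only [Term.eval_values, Term.composite_eq, indexEnv_values, update_values, P.bound] at h
  rw [h]
  refine Finset.sum_congr rfl fun u hu => if_congr ?_ rfl rfl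
  have hu := Finset.mem_range.1 hu
  rw [P.isInt_iff fl hg hu, P.table_ix fl hg hu]

theorem table_up (fl : Bool) {g s x : ℕ} (hg : g ≤ G.N.card)
    (hs : s < (G.sib (G.graph g)).length) (hx : x ∈ (G.graph (G.childOf (G.ntEdge g s))).ext) :
    A 17 (A 10 (A 10 g + s) + x) = (G.ruleSystem B fl).up g s x := by
  have hc := childOf_le (ntEdge_mem hs).2
  have hxB : x < B := ((graph_isOver hc).ext_mem x hx).2.trans_lt (P.le _ hc).1
  have h := (holds_of_getElem? P.holds 8 rfl).three P.rows (P.lt hg)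
    (hs.trans_le (P.length_sib_le hg)) hxB
  simp only [Term.eval_values, Term.composite_eq, indexEnv_values, update_values, P.bound,
    P.table_ch hg hs, P.ext_length hc] at h
  rw [h, P.sum_ext hc, if_pos hx]
  obtain ⟨h1, h2⟩ := P.table_edge hg hs
  rw [P.inp.att_get g hg _ h1, h2]
  · rfl
  · rw [h2, (graph_isOver hg).length_att _ (ntEdge_mem hs).1, ← G.rank_rhs _ (ntEdge_mem hs).2,
      ← graph_childOf (ntEdge_mem hs).2]
    exact List.idxOf_lt_length_iff.2 hx

theorem table_dn (fl : Bool) {g s v : ℕ} (hg : g ≤ G.N.card)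
    (hs : s < (G.sib (G.graph g)).length) (hv : v < B) :
    A 18 (A 10 (A 10 g + s) + v) = (G.ruleSystem B fl).dn g s v := by
  have hc := childOf_le (ntEdge_mem hs).2
  have h := (holds_of_getElem? P.holds 9 rfl).three P.rows (P.lt hg)
    (hs.trans_le (P.length_sib_le hg)) hv
  obtain ⟨h1, h2⟩ := P.table_edge hg hs
  have hl := P.inp.att_length g hg _ h1
  simp only [Term.eval_values, Term.composite_eq, indexEnv_values, update_values, P.bound,
    P.table_ch hg hs, hl] at h
  rw [h2] at h
  have hget := P.inp.att_get g hg _ h1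
  rw [h2] at hget
  have hB := (P.le g hg).2.2.2 _ h1
  rw [h2] at hB
  have hlen : (G.graph (G.childOf (G.ntEdge g s))).ext.length = (G.ntEdge g s).att.length := by
    rw [graph_childOf (ntEdge_mem hs).2, G.rank_rhs _ (ntEdge_mem hs).2,
      (graph_isOver hg).length_att _ (ntEdge_mem hs).1]
  rw [h]
  refine Eq.trans (Finset.sum_congr rfl fun j _ => ?_)
    (sum_ite_getD_eq ((graph_isOver hg).att_nodup _ (ntEdge_mem hs).1) hB v
      fun j => (G.graph (G.childOf (G.ntEdge g s))).ext.getD j 0)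
  by_cases hj : j < (G.ntEdge g s).att.length
  · rw [hget j hj, P.ext_get hc (by omega)]
  · simp [hj]

/-- Only the cells numbered by graphs matter, and such a cell refers to cells of smaller depth. The
other cells of the table hold arbitrary values. -/
theorem table_sz (fl : Bool) {g : ℕ} (hg : g ≤ G.N.card) : A 21 g = (G.ruleSystem B fl).sz g := by
  have h := holds_of_getElem? P.holds 10 rfl
  have h' := h.fix_cell (fun i j l => i = 0 ∧ j = 0 ∧ l ≤ G.N.card)
    (fun _ _ l => (G.ruleSystem B fl).dp l) (fun _ _ l => (G.ruleSystem B fl).sz l)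
    (fun i j l ⟨hi, hj, hl⟩ => ⟨by have := P.card_le; omega, by have := P.card_le; omega, P.lt hl,
      (P.wf fl).dp_lt_bound l hl⟩) ?_ (i := 0) (j := 0) (l := g) ⟨rfl, rfl, hg⟩
  · simpa using h'
  · rintro A' i j l hA' ⟨rfl, rfl, hl⟩ hY
    simp only [Term.eval_values, indexEnv_values, update_values, P.bound, zero_mul, zero_add,
      hA' 16 (by decide), hA' 11 (by decide), hA' 12 (by decide), hA' 10 (by decide),
      P.table_ic fl hl, P.table_ns hl]
    rw [RuleSystem.sz_eq (P.wf fl) hl, sum_range_guard (P.length_sib_le hl)]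
    congr 1
    refine Finset.sum_congr rfl fun s hs => ?_
    have hs := Finset.mem_range.1 hs
    rw [P.table_ch hl hs]
    have h := hY 0 0 _ ⟨rfl, rfl, (P.wf fl).ch_le l hl s hs⟩ ((P.wf fl).dp_lt l hl s hs)
    simp only [zero_mul, zero_add] at h
    exact h

theorem table_pre (fl : Bool) {g s : ℕ} (hg : g ≤ G.N.card)
    (hs : s < (G.sib (G.graph g)).length) :
    A 19 (A 10 g + s) = (G.ruleSystem B fl).pre g s := by
  have hsB := hs.trans_le (P.length_sib_le hg)
  have h := (holds_of_getElem? P.holds 11 rfl).two P.rows (P.lt hg) hsB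
  simp only [Term.eval_values, indexEnv_values, update_values, P.bound, P.table_ic fl hg] at h
  rw [h, RuleSystem.pre, sum_range_guard hsB.le]
  congr 1
  refine Finset.sum_congr rfl fun i hi => ?_
  have hi := (Finset.mem_range.1 hi).trans hs
  rw [P.table_ch hg hi, P.table_sz fl (childOf_le (ntEdge_mem hi).2)]
  rfl

theorem inTables (fl : Bool) : (G.ruleSystem B fl).InTables A where
  ns _ hg := P.table_ns hg
  ch _ hg _ hs := P.table_ch hg hs
  xt _ hg _ hv := P.table_ext hg (hv.2.trans_lt (P.le _ hg).1)
  ix _ hg _ hv := P.table_ix fl hg (hv.2.trans_lt (P.le _ hg).1)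
  inode g hg x _ hx := P.table_inode fl hg
    ((hx.trans (RuleSystem.ix_le _ _ _)).trans_lt (P.le _ hg).1)
  ic _ hg := P.table_ic fl hg
  up g hg s hs x hx := P.table_up fl hg hs (by simpa [ruleSystem] using hx)
  dn _ hg _ hs _ hv := P.table_dn fl hg hs (hv.2.trans_lt (P.le _ hg).1)
  pre _ hg _ hs := P.table_pre fl hg hs

end Prepared

end SLHRGrammar

/-! ### Correctness of the tables of edges, neighbors and branches, for either direction. -/

theorem sum_count_eq {B : ℕ} {C P : ℕ → Prop} [DecidablePred C] [DecidablePred P]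
    (h : ∀ u < B, C u ↔ P u) : (∑ u ∈ Finset.range B, if C u then 1 else 0) =
      ((List.range B).filter fun u => P u).length := by
  rw [← sum_ite_eq_length_filter]
  exact Finset.sum_congr rfl fun u hu => if_congr (h u (Finset.mem_range.1 hu)) rfl rfl

theorem sum_nth_eq {B s : ℕ} {C P : ℕ → Prop} [DecidablePred C] [DecidablePred P]
    (h : ∀ u < B, C u ↔ P u) {f f' : ℕ → ℕ} (hf : ∀ u < B, f u = f' u)
    (hs : s < ((List.range B).filter fun u => P u).length) :
    (∑ i ∈ Finset.range B,
      if C i ∧ (∑ u ∈ Finset.range B, if u < i ∧ C u then 1 else 0) = s then f i else 0) =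
      f' (((List.range B).filter fun i => P i)[s]) := by
  rw [← sum_ite_rank_eq P f' hs]
  refine Finset.sum_congr rfl fun i hi => ?_
  have hi := Finset.mem_range.1 hi
  have : (∑ u ∈ Finset.range B, if u < i ∧ C u then 1 else 0) =
      ∑ u ∈ Finset.range B, if u < i ∧ P u then 1 else 0 :=
    Finset.sum_congr rfl fun u hu =>
      if_congr (and_congr_right fun _ => h u (Finset.mem_range.1 hu)) rfl rfl
  rw [this, hf i hi]
  exact if_congr (and_congr_left fun _ => h i hi) rfl rfl

namespace SLHRGrammar.Prepared

open RAM

variable {G : SLHRGrammar} {B : ℕ} {ρ : ℕ → ℕ} {A : ℕ → ℕ → ℕ} (P : G.Prepared B ρ A)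
include P

theorem isTerminalBetween_iff {g : ℕ} (hg : g ≤ G.N.card) (i a b : ℕ) :
    ((i < A 4 (g + 1) - A 4 g ∧ A 5 (A 4 g + i) ≤ G.σ) ∧
      A 6 (A 4 g + i + 1) - A 6 (A 4 g + i) = 2 ∧
        A 7 (A 6 (A 4 g + i) + 0) = a ∧ A 7 (A 6 (A 4 g + i) + 1) = b) ↔
      (G.edgeAt g i).att = [a, b] ∧ i < (G.edgeList g).length ∧ (G.edgeAt g i).lab ∉ G.N := by
  rw [P.inp.edge_length g hg]
  by_cases hi : i < (G.edgeList g).length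
  · rw [P.inp.lab g hg i hi, P.inp.att_length g hg i hi, ← not_lt, lt_labCode_iff hg hi]
    have h : ((G.edgeAt g i).att.length = 2 ∧ A 7 (A 6 (A 4 g + i) + 0) = a ∧
        A 7 (A 6 (A 4 g + i) + 1) = b) ↔ (G.edgeAt g i).att = [a, b] := by
      constructor
      · rintro ⟨h2, ha, hb⟩
        rw [P.inp.att_get g hg i hi _ (by omega)] at ha hb
        obtain ⟨x, y, h⟩ := List.length_eq_two.1 h2
        rw [h] at ha hb ⊢
        simp at ha hb
        simp [ha, hb]
      · intro h
        have hl : (G.edgeAt g i).att.length = 2 := by simp [h]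
        rw [P.inp.att_get g hg i hi _ (by omega), P.inp.att_get g hg i hi _ (by omega), h]
        simp
    rw [h]
    simp only [hi, true_and]
    exact and_comm
  · simp [hi]

theorem tt_eq (fl : Bool) {g : ℕ} (hg : g ≤ G.N.card) (u v : ℕ) :
    (G.ruleSystem B fl).tt g u v = ∑ i ∈ Finset.range B,
      if (G.edgeAt g i).att = pairString fl u v ∧ i < (G.edgeList g).length ∧
        (G.edgeAt g i).lab ∉ G.N then 1 else 0 := by
  rw [sum_ite_eq_length_filter]
  show (G.terminals (G.graph g)).countP _ = _
  rw [terminals_eq (P.le g hg).2.2.1, List.countP_map, List.countP_eq_length_filter,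
    List.filter_filter]
  congr 2
  funext i
  simp

/-- Needed for every `v`, attached or not: the default value zero must be a legal index as well,
because the cells of the recursive table are addressed under this bound. -/
theorem dn_lt (fl : Bool) {g s : ℕ} (hg : g ≤ G.N.card) (hs : s < (G.sib (G.graph g)).length)
    (v : ℕ) : (G.ruleSystem B fl).dn g s v < B := by
  have h := P.wf fl
  have hc : (G.ruleSystem B fl).ch g s ≤ G.N.card := h.ch_le g hg s hs
  by_cases h0 : (G.ruleSystem B fl).dn g s v = 0
  · have := P.card_le
    omega
  · exact (h.node_of_xt _ hc _ (h.xt_dn g hg s hs v h0)).2.trans_lt (h.nn_lt _ hc)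

variable {o : ℕ} {fl : Bool} (ho : 20 ≤ o) (hL : ∀ s ∈ Term.listStmts o fl, s.Holds B ρ A)

include hL in
theorem table_tt {g u v : ℕ} (hg : g ≤ G.N.card) (hu : u < B) (hv : v < B) :
    A (o + 6) (A 10 (A 10 g + u) + v) = (G.ruleSystem B fl).tt g u v := by
  have h := (holds_of_getElem? hL 0 rfl).three P.rows (P.lt hg) hu hv
  rw [P.tt_eq fl hg]
  cases fl <;>
  · simp only [Term.eval_values, Term.composite_eq, indexEnv_values, update_values, P.bound, P.sigma, Bool.false_eq_true, reduceIte, P.isTerminalBetween_iff hg] at h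
    exact h

-- The recursion changes all three indices, but its depth depends on the graph alone. The condition
-- on `o` keeps the iterated array apart from the tables it is computed from.
include ho hL in
theorem table_cn {g u v : ℕ} (hg : g ≤ G.N.card) (hu : u < B) (hv : v < B) :
    A (o + 7) (A 10 (A 10 g + u) + v) = (G.ruleSystem B fl).cn g u v := by
  rw [P.rows.three (P.lt hg) hu]
  refine (holds_of_getElem? hL 1 rfl).fix_cell (fun i j l => i ≤ G.N.card ∧ j < B ∧ l < B)
    (fun i _ _ => (G.ruleSystem B fl).dp i) (fun i j l => (G.ruleSystem B fl).cn i j l)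
    (fun i j l ⟨hi, hj, hl⟩ => ⟨P.lt hi, hj, hl, (P.wf fl).dp_lt_bound i hi⟩) ?_ ⟨hg, hu, hv⟩
  rintro A' g u v hA' ⟨hg, hu, hv⟩ hY
  simp only [Term.eval_values, indexEnv_values, update_values, P.bound, hA' (o + 6) (by omega), hA' 10 (by omega), hA' 11 (by omega), hA' 12 (by omega),
    hA' 18 (by omega), P.table_tt hL hg hu hv, P.table_ns hg]
  have hns : (G.ruleSystem B fl).ns g = (G.sib (G.graph g)).length := rfl
  rw [RuleSystem.cn_eq (P.wf fl) hg, hns, ← sum_range_guard (P.length_sib_le hg)]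
  congr 1
  refine Finset.sum_congr rfl fun s _ => ?_
  by_cases hs : s < (G.sib (G.graph g)).length
  · have hc : G.childOf (G.ntEdge g s) ≤ G.N.card := (P.wf fl).ch_le g hg s hs
    simp only [hs, true_and, P.table_dn fl hg hs hu, P.table_dn fl hg hs hv, P.table_ch hg hs,
      if_true]
    refine if_congr Iff.rfl ?_ rfl
    rw [P.rows.three (P.lt hc) (P.dn_lt fl hg hs u)]
    exact hY _ _ _ ⟨hc, P.dn_lt fl hg hs u, P.dn_lt fl hg hs v⟩ ((P.wf fl).dp_lt g hg s hs)
  · simp [hs]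

include ho hL

theorem intNbr_iff {g v : ℕ} (hg : g ≤ G.N.card) (hv : v < B) (u : ℕ) (hu : u < B) :
    (((1 ≤ u ∧ u ≤ A 1 g) ∧ A 13 (A 10 g + u) = 0) ∧ A (o + 7) (A 10 (A 10 g + u) + v) ≠ 0) ↔
      (G.ruleSystem B fl).IsInt g u ∧ (G.ruleSystem B fl).cn g u v ≠ 0 := by
  rw [P.isInt_iff fl hg hu, P.table_cn ho hL hg hu hv]

theorem extNbr_iff {g v : ℕ} (hg : g ≤ G.N.card) (hv : v < B) (u : ℕ) (hu : u < B) :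
    (A 13 (A 10 g + u) ≠ 0 ∧ A (o + 7) (A 10 (A 10 g + u) + v) ≠ 0) ↔
      (G.ruleSystem B fl).xt g u ≠ 0 ∧ (G.ruleSystem B fl).cn g u v ≠ 0 := by
  rw [Ne, P.table_ext_eq_zero_iff hg hu, P.table_cn ho hL hg hu hv]

theorem table_intNbrs_length {g v : ℕ} (hg : g ≤ G.N.card) (hv : v < B) :
    A o (A 10 g + v) = ((G.ruleSystem B fl).intNbrs g v).length := by
  have h := (holds_of_getElem? hL 2 rfl).two P.rows (P.lt hg) hv
  simp only [Term.eval_values, Term.composite_eq, indexEnv_values, update_values, P.bound] at h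
  rw [h]
  exact sum_count_eq (P.intNbr_iff ho hL hg hv)

theorem table_intNbrs {g v i : ℕ} (hg : g ≤ G.N.card) (hv : v < B)
    (hi : i < ((G.ruleSystem B fl).intNbrs g v).length) :
    A (o + 1) (A 10 (A 10 g + v) + i) =
      (G.ruleSystem B fl).ix g ((G.ruleSystem B fl).intNbrs g v)[i] := by
  have hiB : i < B := hi.trans_le ((List.length_filter_le _ _).trans (by simp [ruleSystem]))
  have h := (holds_of_getElem? hL 3 rfl).three P.rows (P.lt hg) hv hiB
  simp only [Term.eval_values, Term.composite_eq, indexEnv_values, update_values, P.bound] at h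
  rw [h]
  exact sum_nth_eq (P.intNbr_iff ho hL hg hv) (fun u hu => P.table_ix fl hg hu) hi

theorem table_extNbrs_length {g v : ℕ} (hg : g ≤ G.N.card) (hv : v < B) :
    A (o + 2) (A 10 g + v) = ((G.ruleSystem B fl).extNbrs g v).length := by
  have h := (holds_of_getElem? hL 4 rfl).two P.rows (P.lt hg) hv
  simp only [Term.eval_values, Term.composite_eq, indexEnv_values, update_values, P.bound] at h
  rw [h]
  exact sum_count_eq (P.extNbr_iff ho hL hg hv)

theorem table_extNbrs {g v i : ℕ} (hg : g ≤ G.N.card) (hv : v < B)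
    (hi : i < ((G.ruleSystem B fl).extNbrs g v).length) :
    A (o + 3) (A 10 (A 10 g + v) + i) = ((G.ruleSystem B fl).extNbrs g v)[i] := by
  have hiB : i < B := hi.trans_le ((List.length_filter_le _ _).trans (by simp [ruleSystem]))
  have h := (holds_of_getElem? hL 5 rfl).three P.rows (P.lt hg) hv hiB
  simp only [Term.eval_values, Term.composite_eq, indexEnv_values, update_values, P.bound] at h
  rw [h]
  exact sum_nth_eq (f' := fun u => u) (P.extNbr_iff ho hL hg hv) (fun _ _ => rfl) hi

theorem table_ne {g v : ℕ} (hg : g ≤ G.N.card) (hv : v < B) :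
    A (o + 9) (A 10 g + v) = (G.ruleSystem B fl).ne g v := by
  rw [P.rows.two (P.lt hg)]
  refine (holds_of_getElem? hL 6 rfl).fix_cell (fun i j l => i = 0 ∧ j ≤ G.N.card ∧ l < B)
    (fun _ j _ => (G.ruleSystem B fl).dp j) (fun _ j l => (G.ruleSystem B fl).ne j l)
    (fun i j l ⟨hi, hj, hl⟩ => ⟨by omega, P.lt hj, hl, (P.wf fl).dp_lt_bound j hj⟩) ?_ ⟨rfl, hg, hv⟩
  rintro A' _ g v hA' ⟨rfl, hg, hv⟩ hY
  simp only [Term.eval_values, indexEnv_values, update_values, P.bound, hA' o (by omega), hA' 10 (by omega), hA' 11 (by omega), hA' 12 (by omega),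
    hA' 18 (by omega), P.table_intNbrs_length ho hL hg hv, P.table_ns hg]
  have hns : (G.ruleSystem B fl).ns g = (G.sib (G.graph g)).length := rfl
  rw [RuleSystem.ne_eq' (P.wf fl) hg, hns, ← sum_range_guard (P.length_sib_le hg)]
  congr 1
  refine Finset.sum_congr rfl fun s _ => ?_
  by_cases hs : s < (G.sib (G.graph g)).length
  · have hc : G.childOf (G.ntEdge g s) ≤ G.N.card := (P.wf fl).ch_le g hg s hs
    simp only [hs, true_and, P.table_dn fl hg hs hv, P.table_ch hg hs, if_true]
    refine if_congr Iff.rfl ?_ rfl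
    rw [P.rows.two (P.lt hc)]
    exact hY _ _ _ ⟨rfl, hc, P.dn_lt fl hg hs v⟩ ((P.wf fl).dp_lt g hg s hs)
  · simp [hs]

theorem branch_iff {g v : ℕ} (hg : g ≤ G.N.card) (hv : v < B) (s : ℕ) (_ : s < B) :
    (s < A 11 g ∧ A 18 (A 10 (A 10 g + s) + v) ≠ 0 ∧
      A (o + 9) (A 10 (A 12 (A 10 g + s)) + A 18 (A 10 (A 10 g + s) + v)) ≠ 0) ↔
      s < (G.ruleSystem B fl).ns g ∧ (G.ruleSystem B fl).dn g s v ≠ 0 ∧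
        (G.ruleSystem B fl).ne ((G.ruleSystem B fl).ch g s) ((G.ruleSystem B fl).dn g s v) ≠ 0 := by
  rw [P.table_ns hg]
  refine and_congr_right fun hs => ?_
  have hc : G.childOf (G.ntEdge g s) ≤ G.N.card := (P.wf fl).ch_le g hg s hs
  rw [P.table_dn fl hg hs hv, P.table_ch hg hs, P.table_ne ho hL hc (P.dn_lt fl hg hs v)]
  rfl

theorem inLists : (G.ruleSystem B fl).InLists o A where
  int_length _ hg _ hv := P.table_intNbrs_length ho hL hg (hv.2.trans_lt (P.le _ hg).1)
  int_get _ hg _ hv _ hi := P.table_intNbrs ho hL hg (hv.2.trans_lt (P.le _ hg).1) hi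
  ext_length _ hg _ hv := P.table_extNbrs_length ho hL hg (hv.2.trans_lt (P.le _ hg).1)
  ext_get _ hg _ hv _ hi := P.table_extNbrs ho hL hg (hv.2.trans_lt (P.le _ hg).1) hi
  branch_length g hg v hv := by
    have hv := hv.2.trans_lt (P.le _ hg).1
    have h := (holds_of_getElem? hL 7 rfl).two P.rows (P.lt hg) hv
    simp only [Term.eval_values, Term.composite_eq, indexEnv_values, update_values, P.bound] at h
    rw [h]
    exact sum_count_eq (P.branch_iff ho hL hg hv)
  branch_get g hg v hv i hi := by
    have hv := hv.2.trans_lt (P.le _ hg).1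
    have hiB : i < B := hi.trans_le ((List.length_filter_le _ _).trans (by simp [ruleSystem]))
    have h := (holds_of_getElem? hL 8 rfl).three P.rows (P.lt hg) hv hiB
    simp only [Term.eval_values, Term.composite_eq, indexEnv_values, update_values, P.bound] at h
    rw [h]
    exact sum_nth_eq (f' := fun u => u) (P.branch_iff ho hL hg hv) (fun _ _ => rfl) hi

end SLHRGrammar.Prepared

/-! ## The preprocessing -/

namespace RAM

/-- The preprocessing: find a bound on the indices, then compute the tables. -/
def preProg : Prog :=
  .seq (.seq (.setReg 40 (.reg 1)) <| .seq (.setReg 42 (.reg 0))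
    (.setReg 44 (.add (.reg 0) (.const 1)))) <|
  .seq ((Term.sum 4 (.get 1 (.var 4))).compile 0) <|
  .seq (.setReg 44 (.add (.add (.add (.add (.add (.const 2) (.reg 42)) (.reg 1))
      (.get 2 (.add (.reg 42) (.const 1)))) (.get 4 (.add (.reg 42) (.const 1))))
      (.get 6 (.get 4 (.add (.reg 42) (.const 1)))))) <|
  stmtsProg Term.allStmts

/-- A bound on the time for the preprocessing. -/
def preCost (B : ℕ) : ℕ :=
  8 + ((Term.sum 4 (.get 1 (.var 4))).cost B + (24 + stmtsCost B Term.allStmts))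

theorem polyBdd_preCost : PolyBdd preCost :=
  (PolyBdd.const 8).add ((Term.polyBdd_cost _).add ((PolyBdd.const 24).add (polyBdd_stmtsCost _)))

/-- The constant variables during the preprocessing. -/
def preEnv (σ N B : ℕ) : ℕ → ℕ := fun y =>
  if y = 20 then σ else if y = 21 then N else if y = 22 then B else 0

theorem Answers.mono {P : Prog} {M : Memory} {k T T' : ℕ} {L : List ℕ} (h : Answers P M k T L)
    (hT : T ≤ T') : Answers P M k T' L := by
  obtain ⟨t, ht, h⟩ := h
  exact ⟨t, ht.trans hT, h⟩

end RAM

namespace SLHRGrammar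

open RAM

variable {G : SLHRGrammar}

theorem InputArrays.congr {A A' : ℕ → ℕ → ℕ} (h : G.InputArrays A)
    (hA : ∀ a ∈ [1, 2, 3, 4, 5, 6, 7], A' a = A a) : G.InputArrays A' := by
  simp only [List.forall_mem_cons] at hA
  obtain ⟨h1, h2, h3, h4, h5, h6, h7, -⟩ := hA
  refine ⟨?_, ?_, ?_, ?_, ?_, ?_, ?_⟩
  · rw [h1]; exact h.nn
  · rw [h2]; exact h.ext_length
  · rw [h2, h3]; exact h.ext_get
  · rw [h4]; exact h.edge_length
  · rw [h4, h5]; exact h.lab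
  · rw [h4, h6]; exact h.att_length
  · rw [h4, h6, h7]; exact h.att_get

/-- Register `44`, the range of all sums, is used in two roles. It is first set to the number of
graphs, so that a compiled sum yields the total number of nodes; from this total and the final
offsets in the input the proper bound `indexBound` is then computed. -/
theorem preProg_spec (G : SLHRGrammar) :
    HaltsIn preProg G.input (preCost G.indexBound) fun M =>
      G.Prepared G.indexBound (preEnv G.σ G.N.card G.indexBound) M.arr ∧
      (∀ s ∈ Term.listStmts 50 false,
        s.Holds G.indexBound (preEnv G.σ G.N.card G.indexBound) M.arr) ∧
      ∀ s ∈ Term.listStmts 70 true,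
        s.Holds G.indexBound (preEnv G.σ G.N.card G.indexBound) M.arr := by
  obtain ⟨hB, hle⟩ := G.le_indexBound
  have hodd : ∀ x a, 2 * x ≠ 2 * a + 1 := by omega
  refine HaltsIn.seq' (Q := fun M => M.arr = G.input.arr ∧ M.reg 44 = G.N.card + 1 ∧
      ∀ x, 4 ≤ x → x ≠ 22 → M.reg (2 * x) = preEnv G.σ G.N.card G.indexBound x) 8 _ le_rfl
    (HaltsIn.exec rfl ?_ : HaltsIn _ _ 8 _) fun M₁ ⟨hA₁, h44, hV₁⟩ => ?_
  · refine ⟨rfl, ?_, fun x hx h22 => ?_⟩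
    · simp [Prog.exec, Expr.eval, Memory.setReg_reg, input]
    · simp only [Prog.exec, Expr.eval, Memory.setReg_reg, input, preEnv]
      by_cases h20 : x = 20
      · simp [h20]
      · by_cases h21 : x = 21
        · simp [h21]
        · simp [h20, h21, h22, show 2 * x ≠ 40 by omega, show 2 * x ≠ 42 by omega,
            show 2 * x ≠ 44 by omega, show x ≠ 0 by omega]
  -- The provisional range `|N| + 1` is within `indexBound`, so the time bound may be stated for the
  -- latter.
  refine HaltsIn.seq' _ _ le_rfl (Term.compile_spec _ 0 M₁ G.indexBound (by omega))
    fun M₂ ⟨hA₂, hv, hf⟩ => ?_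
  have hsum : M₂.reg 1 = ∑ g ∈ Finset.range (G.N.card + 1), G.input.arr 1 g := by
    refine hv.trans ?_
    simp only [Term.eval, hA₁, h44, Function.update_self]
  have h42 : M₂.reg 42 = G.N.card := (hf 42 (by simp)).trans (hV₁ 21 (by simp) (by simp))
  refine HaltsIn.seq' (Q := fun M => M.arr = G.input.arr ∧
      VarsOk (preEnv G.σ G.N.card G.indexBound) M) 24 _ le_rfl
    ((HaltsIn.exec rfl ?_).mono (by simp [Prog.time, Expr.cost]) fun _ h => h) fun M₃ ⟨hA₃, hV₃⟩ => ?_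
  · refine ⟨hA₂.trans hA₁, fun x hx => ?_⟩
    by_cases h22 : x = 22
    · subst h22
      simp [Prog.exec, Expr.eval, Memory.setReg_reg, h42, hsum, hA₂, hA₁, preEnv, indexBound]
    · simp only [Prog.exec, Memory.setReg_reg]
      rw [if_neg (by omega), hf _ (.inl (by omega)), hV₁ x hx h22]
  · refine (stmtsProg_spec (B := G.indexBound) (by omega) rfl Term.allStmts _ allStmts_ok M₃ hV₃).mono le_rfl
      fun M ⟨hA, hs⟩ => ?_
    simp only [Term.allStmts, List.forall_mem_append] at hs
    refine ⟨⟨inputArrays_input.congr fun a ha => ?_, rfl, rfl, hB, hle, hs.1⟩, hs.2.1, hs.2.2⟩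
    rw [hA a ha, hA₃]

theorem exists_preCost_le : ∃ C c, ∀ G : SLHRGrammar, preCost G.indexBound ≤ C * G.size ^ c := by
  obtain ⟨K, c, h⟩ := polyBdd_preCost
  -- As `indexBound` is at most seven times the size and the size is positive, `indexBound + 1` is
  -- at most eight times the size.
  refine ⟨K * 8 ^ c, c, fun G => (h _).trans ?_⟩
  obtain ⟨h1, h2⟩ := G.indexBound_le
  rw [mul_assoc, ← mul_pow]
  exact Nat.mul_le_mul_left _ (Nat.pow_le_pow_left (by omega) _)

/-- The condition on the depth excludes the start graph, for which `IsBinary` says nothing. -/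
theorem ns_le_two (hG : G.IsBinary) (B : ℕ) (fl : Bool) :
    ∀ g ≤ (G.ruleSystem B fl).last, (G.ruleSystem B fl).dp g < (G.ruleSystem B fl).dp 0 →
      (G.ruleSystem B fl).ns g ≤ 2 := by
  intro g hg hd
  cases g with
  | zero => omega
  | succ g => exact hG _ (sort_getD_mem hg)

/-- The depth of the start graph is one more than the height; the factor two absorbs the difference
because `ν` is at least one. -/
theorem cost_le_nu (G : SLHRGrammar) (B : ℕ) (fl : Bool) :
    1 + Nat.log 2 ((G.ruleSystem B fl).ns 0) + (G.ruleSystem B fl).dp 0 ≤ 2 * G.nu := by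
  have h1 : (G.ruleSystem B fl).ns 0 = (G.sib G.start).length := rfl
  have h2 : (G.ruleSystem B fl).dp 0 = G.height + 1 := rfl
  rw [h1, h2, nu]
  omega

theorem nodup_length_eq_ncard {L : List ℕ} (hL : L.Nodup) {s : Set ℕ} (h : ∀ u, u ∈ L ↔ u ∈ s) :
    L.length = s.ncard := by
  have : s = ↑L.toFinset := by
    ext u
    simp [h]
  rw [this, Set.ncard_coe_finset, List.toFinset_card_of_nodup hL]

theorem answers_neighbors {ρ : ℕ → ℕ} {B k o : ℕ} {M : Memory} (P : G.Prepared B ρ M.arr)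
    (hG : G.IsBinary) {fl : Bool} (hL : ∀ s ∈ Term.listStmts o fl, s.Holds B ρ M.arr)
    (ho : 20 ≤ o) (ho' : o < 90) (hk1 : 1 ≤ k) (hk : k ≤ G.val.numNodes) {s : Set ℕ}
    (hs : ∀ x, x ∈ s ↔ (G.ruleSystem B fl).Edge 0 ((G.ruleSystem B fl).ix 0) 0 x k) :
    ∃ L : List ℕ, L.Nodup ∧ (∀ u, u ∈ L ↔ u ∈ s) ∧
      Answers (nbrProg o) M k (1400 * (G.nu * max 1 s.ncard)) L := by
  obtain ⟨L, hnd, hmem, ha⟩ := nbrProg_spec (P.wf fl) (P.inTables fl) ho ho' (P.inLists ho hL)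
    (ns_le_two hG B fl) hk1 (by rw [← val_numNodes (P.wf fl)]; exact hk) M fun _ _ _ => rfl
  have hmem' : ∀ u, u ∈ L ↔ u ∈ s := fun u => (hmem u).trans (hs u).symm
  refine ⟨L, hnd, hmem', ha.mono ?_⟩
  rw [nodup_length_eq_ncard hnd hmem']
  have := Nat.mul_le_mul_right (max 1 s.ncard) (cost_le_nu G B fl)
  rw [mul_assoc] at this
  omega

theorem answers_gRep {ρ : ℕ → ℕ} {B k : ℕ} {M : Memory} (P : G.Prepared B ρ M.arr)
    (hG : G.IsBinary) (hk1 : 1 ≤ k) (hk : k ≤ G.val.numNodes) :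
    Answers repProg M k (600 * G.nu) (G.gRep k) := by
  obtain ⟨w, r, v, hw, hv, hkv, ha⟩ := repProg_spec (P.wf false) (P.inTables false)
    (ns_le_two hG B false) hk1 (by rw [← val_numNodes (P.wf false)]; exact hk) M fun _ _ _ => rfl
  rw [gRep_eq (P.wf false) hw hv hkv]
  have := cost_le_nu G B false
  exact ha.mono (by omega)

end SLHRGrammar

/-- There are fixed programs: one that preprocesses a grammar in polynomial time, and, on the memory
that it leaves, one that computes the `G`-representation of a node of `val(G)` in time `O(ν)`, and
two that compute the in-neighbors and the out-neighbors of a node in time `O(ν n)`. -/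
theorem mainTheorem11 :
    ∃ (pre rep inn out : RAM.Prog) (C c : ℕ), ∀ G : SLHRGrammar, G.IsBinary →
      ∃ M : RAM.Memory, (∃ t ≤ C * G.size ^ c, RAM.Runs pre G.input t M) ∧
        ∀ k : ℕ, 1 ≤ k → k ≤ G.val.numNodes →
          RAM.Answers rep M k (C * G.nu) (G.gRep k) ∧
          (∃ L : List ℕ, L.Nodup ∧ (∀ u, u ∈ L ↔ u ∈ G.val.inNeighbors k) ∧
            RAM.Answers inn M k (C * (G.nu * max 1 (G.val.inNeighbors k).ncard)) L) ∧
          (∃ L : List ℕ, L.Nodup ∧ (∀ u, u ∈ L ↔ u ∈ G.val.outNeighbors k) ∧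
            RAM.Answers out M k (C * (G.nu * max 1 (G.val.outNeighbors k).ncard)) L) := by
  obtain ⟨C, c, hC⟩ := SLHRGrammar.exists_preCost_le
  -- Both directions use the same query program, with lists from array `50` on for the original
  -- edges and from array `70` on for the reversed ones. The summand `1400` covers the constants of
  -- all three queries.
  refine ⟨RAM.preProg, RAM.repProg, RAM.nbrProg 50, RAM.nbrProg 70, C + 1400, c, fun G hG => ?_⟩
  obtain ⟨t, ht, M, hr, P, hin, hout⟩ := G.preProg_spec
  refine ⟨M, ⟨t, ht.trans ((hC G).trans (Nat.mul_le_mul_right _ (by omega))), hr⟩,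
    fun k hk1 hk => ⟨?_, ?_, ?_⟩⟩
  · exact (SLHRGrammar.answers_gRep P hG hk1 hk).mono (Nat.mul_le_mul_right _ (by omega))
  · obtain ⟨L, h1, h2, h3⟩ := SLHRGrammar.answers_neighbors P hG hin (by decide) (by decide) hk1 hk
      fun x => SLHRGrammar.mem_inNeighbors (P.wf false)
    exact ⟨L, h1, h2, h3.mono (Nat.mul_le_mul_right _ (by omega))⟩
  · obtain ⟨L, h1, h2, h3⟩ := SLHRGrammar.answers_neighbors P hG hout (by decide) (by decide) hk1 hk
      fun x => SLHRGrammar.mem_outNeighbors (P.wf true)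
    exact ⟨L, h1, h2, h3.mono (Nat.mul_le_mul_right _ (by omega))⟩
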